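/- **Theorem 1.** Let $V$ be a finite set, $r\notin V$ an additional node, $G=(V+r,E)$ a digraph (parallel edges allowed) with nonnegative rational edge costs $c$, let $T\subseteq V$ be a set of terminals, and let $f:2^V\to\mathbb Z$. For a multiset $I$ of directed edges on $V+r$ let $d_I(A)$ be the number of edges of $I$ that enter $A\subseteq V$ (head in $A$, tail not in $A$), and let $f^I(A)=\max\{f(A)-d_I(A),0\}$; for a set function $g$ let $k_g=\max\{g(A):A\subseteq V\}$. An edge set $J\subseteq E$ is an $f$-cover if $d_J(A)\ge f(A)$ for all $A\subseteq V$. Assume that * $f$ is positively $T$-intersecting supermodular: $f(A)+f(B)\le f(A\cap B)+f(A\cup B)$ whenever $A\cap B\cap T\ne\emptyset$ and $f(A),f(B)>0$; * every $f$-positive set (set $A\subseteq V$ with $f(A)>0$) contains a terminal, that is, $A\cap T\neq\emptyset$; * $G$ is quasi-bipartite: every edge of $G$ has an end in $T$ or is contained in no $f$-positive set (that is, no $f$-positive set contains both of its ends). The function $f$ is accessible only through an oracle that, given any finite multiset $I$ of edges on $V+r$ (not necessarily edges of $G$), returns a list of the cores, i.e. the inclusion-minimal members, of the family $\{A\subseteq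 V: f^I(A)=k_{f^I}\}$; an oracle call is charged with the length of the query and of the reply. (So if these cores can be found in polynomial time, the oracle algorithm below is a polynomial-time algorithm.) Then there is an oracle algorithm, the same for all $G,c,T,f$ as above, that runs in time polynomial in $|V|$, $|E|$ and the total bit-length of the costs and, whenever $f$ has a cover $J\subseteq E$, outputs an $f$-cover $J\subseteq E$ with $$c(J)\ \le\ 2H(k_f)\,(1+\ln|T|)\cdot c(J')\qquad\text{for every } f\text{-cover } J'\subseteq E .$$ Here $H(k)=\sum_{i=1}^k 1/i$, with $H(k)=0$ for $k\le 0$ (if $T=\emptyset$ then $k_f\le 0$ and the ratio is read as $0$). -/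

import Mathlib

namespace EdgeCover

/-! ### Set functions and edge sets

The ground set is `V = Fin n`; the extra node `r` is `none`, so `V + r = Option (Fin n)`.
A directed edge is a pair (tail, head); edge sets may contain parallel edges. -/

/-- The node set `V + r`, with `none` in the role of `r`. -/
abbrev Node (n : ℕ) : Type := Option (Fin n)

/-- A directed edge `(tail, head)` on `V + r`. -/
abbrev DEdge (n : ℕ) : Type := Node n × Node n

/-- A set of nodes `A ⊆ V`, seen as a subset of `V + r`. -/
abbrev lift {n : ℕ} (A : Finset (Fin n)) : Finset (Node n) := A.map Function.Embedding.some

/-- `d_I(A)`: the number of edges of `I` (with multiplicity) that enter `A`. -/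
def inDeg {n : ℕ} (I : Multiset (DEdge n)) (A : Finset (Fin n)) : ℕ :=
  I.countP fun e => e.2 ∈ lift A ∧ e.1 ∉ lift A

/-- `f` is positively `T`-intersecting supermodular. -/
def PosIntersectingSupermodular {n : ℕ} (T : Finset (Fin n)) (f : Finset (Fin n) → ℤ) : Prop :=
  ∀ A B : Finset (Fin n), (A ∩ B ∩ T).Nonempty → 0 < f A → 0 < f B →
    f A + f B ≤ f (A ∩ B) + f (A ∪ B)

/-- `k_f`, the maximum of `f` over all subsets of `V`. -/
def maxVal {n : ℕ} (f : Finset (Fin n) → ℤ) : ℤ :=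
  Finset.univ.sup' Finset.univ_nonempty f

/-- The residual function `f^I(A) = max {f(A) - d_I(A), 0}`. -/
def residual {n : ℕ} (f : Finset (Fin n) → ℤ) (I : Multiset (DEdge n)) :
    Finset (Fin n) → ℤ :=
  fun A => max (f A - (inDeg I A : ℤ)) 0

/-- The family `{A ⊆ V : f(A) = k_f}`. -/
def maxFamily {n : ℕ} (f : Finset (Fin n) → ℤ) : Set (Finset (Fin n)) :=
  {A | f A = maxVal f}

/-- `C` is an inclusion-minimal member of the family `F`. -/
def IsCore {n : ℕ} (F : Set (Finset (Fin n))) (C : Finset (Fin n)) : Prop :=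
  Minimal (fun A => A ∈ F) C

/-! ### Instances -/

/-- The explicit part of an instance: the digraph `(V + r, E)` with `V = Fin n` and `E` indexed by
`Fin m` (parallel edges allowed), nonnegative rational edge costs, and the set `T` of terminals. -/
structure Network where
  n : ℕ
  m : ℕ
  edge : Fin m → DEdge n
  cost : Fin m → ℚ
  cost_nonneg : ∀ e, 0 ≤ cost e
  T : Finset (Fin n)

namespace Network

/-- The input size: number of nodes, number of edges, and total bit-length of the costs. -/
def size (G : Network) : ℕ :=
  G.n + G.m + ∑ e : Fin G.m, (Nat.size (G.cost e).num.natAbs + Nat.size (G.cost e).den)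

/-- `J ⊆ E` covers `f`: `d_J(A) ≥ f(A)` for all `A ⊆ V`. -/
def Covers (G : Network) (f : Finset (Fin G.n) → ℤ) (J : Finset (Fin G.m)) : Prop :=
  ∀ A : Finset (Fin G.n), f A ≤ (inDeg (J.val.map G.edge) A : ℤ)

/-- The cost of an edge set. -/
def totalCost (G : Network) (J : Finset (Fin G.m)) : ℚ := ∑ e ∈ J, G.cost e

/-- `G` is quasi-bipartite: every edge has an end in `T` or has not both of its ends in a common
`f`-positive set. -/
def QuasiBipartite (G : Network) (f : Finset (Fin G.n) → ℤ) : Prop :=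
  ∀ e : Fin G.m,
    ((G.edge e).1 ∈ lift G.T ∨ (G.edge e).2 ∈ lift G.T) ∨
      ∀ A : Finset (Fin G.n), 0 < f A → ¬ ((G.edge e).1 ∈ lift A ∧ (G.edge e).2 ∈ lift A)

end Network

/-! ### The model of computation

A `while` language over list-structured data whose atoms are `nil` and rational numbers.
Every elementary operation costs one step. The only arithmetic operations are addition,
subtraction and comparison, so after `t` steps every number is an integral combination, with
coefficients at most `2 ^ t` in absolute value, of numbers in the input, the program and the oracle
replies; bit-lengths stay polynomial, as do the shared (pointer) representations of the lists.
Hence polynomially many steps here amount to polynomial time on a Turing machine with the same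
oracle. -/

/-- Data values. -/
inductive Val : Type
  | nil : Val
  | num : ℚ → Val
  | cons : Val → Val → Val

namespace Val

/-- First component of a pair (`nil` on atoms). -/
def head : Val → Val
  | cons a _ => a
  | _ => nil

/-- Second component of a pair (`nil` on atoms). -/
def tail : Val → Val
  | cons _ b => b
  | _ => nil

/-- Sum of two numbers (`nil` if an argument is not a number). -/
def add : Val → Val → Val
  | num a, num b => num (a + b)
  | _, _ => nil

/-- Difference of two numbers (`nil` if an argument is not a number). -/
def sub : Val → Val → Val
  | num a, num b => num (a - b)
  | _, _ => nil

/-- Strict comparison of two numbers: `num 1` for true, `nil` for false. -/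
def lt : Val → Val → Val
  | num a, num b => if a < b then num 1 else nil
  | _, _ => nil

/-- Equality test of two numbers: `num 1` for true, `nil` for false. -/
def eq : Val → Val → Val
  | num a, num b => if a = b then num 1 else nil
  | _, _ => nil

/-- Number of symbols of a value. -/
def size : Val → ℕ
  | nil => 1
  | num _ => 1
  | cons a b => a.size + b.size + 1

end Val

/-- A memory state: the values of the program variables. -/
abbrev State : Type := ℕ → Val

/-- Expressions. -/
inductive Exp : Type
  | var : ℕ → Exp
  | nil : Exp
  | num : ℚ → Exp
  | cons : Exp → Exp → Exp
  | head : Exp → Exp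
  | tail : Exp → Exp
  | add : Exp → Exp → Exp
  | sub : Exp → Exp → Exp
  | lt : Exp → Exp → Exp
  | eq : Exp → Exp → Exp

namespace Exp

/-- The value of an expression. -/
def eval (s : State) : Exp → Val
  | var x => s x
  | nil => Val.nil
  | num q => Val.num q
  | cons a b => Val.cons (a.eval s) (b.eval s)
  | head a => (a.eval s).head
  | tail a => (a.eval s).tail
  | add a b => (a.eval s).add (b.eval s)
  | sub a b => (a.eval s).sub (b.eval s)
  | lt a b => (a.eval s).lt (b.eval s)
  | eq a b => (a.eval s).eq (b.eval s)

/-- The number of steps needed to evaluate an expression. -/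
def steps : Exp → ℕ
  | var _ => 1
  | nil => 1
  | num _ => 1
  | cons a b => a.steps + b.steps + 1
  | head a => a.steps + 1
  | tail a => a.steps + 1
  | add a b => a.steps + b.steps + 1
  | sub a b => a.steps + b.steps + 1
  | lt a b => a.steps + b.steps + 1
  | eq a b => a.steps + b.steps + 1

end Exp

/-- Programs. In `cond` and `loop` the value `nil` means false and every other value means true;
`query x a` assigns to `x` the reply of the oracle to the value of `a`. -/
inductive Prog : Type
  | skip : Prog
  | assign : ℕ → Exp → Prog
  | query : ℕ → Exp → Prog
  | seq : Prog → Prog → Prog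
  | cond : Exp → Prog → Prog → Prog
  | loop : Exp → Prog → Prog

/-- `Exec orc p s t s'`: with oracle `orc`, program `p` started in state `s` halts in state `s'`
after `t` steps. An oracle call is charged with the lengths of the query and of the reply. -/
inductive Exec (orc : Val → Val) : Prog → State → ℕ → State → Prop
  | skip (s : State) : Exec orc Prog.skip s 1 s
  | assign (x : ℕ) (a : Exp) (s : State) :
      Exec orc (Prog.assign x a) s (a.steps + 1) (Function.update s x (a.eval s))
  | query (x : ℕ) (a : Exp) (s : State) :
      Exec orc (Prog.query x a) s
        (a.steps + (a.eval s).size + (orc (a.eval s)).size + 1)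
        (Function.update s x (orc (a.eval s)))
  | seq {p q : Prog} {s s₁ s₂ : State} {t₁ t₂ : ℕ}
      (hp : Exec orc p s t₁ s₁) (hq : Exec orc q s₁ t₂ s₂) :
      Exec orc (Prog.seq p q) s (t₁ + t₂ + 1) s₂
  | cond_true {a : Exp} {p q : Prog} {s s₁ : State} {t : ℕ}
      (ha : a.eval s ≠ Val.nil) (hp : Exec orc p s t s₁) :
      Exec orc (Prog.cond a p q) s (a.steps + t + 1) s₁
  | cond_false {a : Exp} {p q : Prog} {s s₁ : State} {t : ℕ}
      (ha : a.eval s = Val.nil) (hq : Exec orc q s t s₁) :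
      Exec orc (Prog.cond a p q) s (a.steps + t + 1) s₁
  | loop_done {a : Exp} {p : Prog} {s : State} (ha : a.eval s = Val.nil) :
      Exec orc (Prog.loop a p) s (a.steps + 1) s
  | loop_step {a : Exp} {p : Prog} {s s₁ s₂ : State} {t₁ t₂ : ℕ}
      (ha : a.eval s ≠ Val.nil) (hp : Exec orc p s t₁ s₁)
      (hl : Exec orc (Prog.loop a p) s₁ t₂ s₂) :
      Exec orc (Prog.loop a p) s (a.steps + t₁ + t₂ + 1) s₂

/-! ### Encodings of inputs, outputs, queries and replies -/

/-- Lists of values as values. -/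
def encList : List Val → Val
  | [] => Val.nil
  | v :: l => Val.cons v (encList l)

/-- The node `r` is encoded by `0`, the node `i ∈ V = {0, …, n - 1}` by `i + 1`. -/
def encNode {n : ℕ} : Node n → Val
  | none => Val.num 0
  | some i => Val.num ((i : ℕ) + 1)

/-- An edge is encoded by the pair of its tail and its head. -/
def encEdge {n : ℕ} (e : DEdge n) : Val := Val.cons (encNode e.1) (encNode e.2)

/-- A list of nodes of `V`. -/
def encNodes {n : ℕ} (C : List (Fin n)) : Val := encList (C.map fun v => encNode (some v))

/-- The input of the program: `n`, the terminals, and the list of edges with their costs. -/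
def encNetwork (G : Network) : Val :=
  Val.cons (Val.num G.n)
    (Val.cons (encNodes ((List.finRange G.n).filter fun v => v ∈ G.T))
      (encList (List.ofFn fun e => Val.cons (encEdge (G.edge e)) (Val.num (G.cost e)))))

/-- The initial state: the input in variable `0`, all other variables `nil`. -/
def initState (G : Network) : State :=
  fun x => if x = 0 then encNetwork G else Val.nil

/-- The final state `s` outputs `J`: variable `0` lists the indices of the edges of `J`, in some
order and without repetitions. -/
def Outputs (G : Network) (s : State) (J : Finset (Fin G.m)) : Prop :=
  ∃ L : List (Fin G.m), L.Nodup ∧ L.toFinset = J ∧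
    s 0 = encList (L.map fun e => Val.num ((e : ℕ) : ℚ))

/-- `orc` is a core oracle for `f`: asked for any list `I` of edges on `V + r` (repetitions are
parallel edges), it replies with a list, in some order and without repetitions, of the cores of the
family `{A ⊆ V : f^I(A) = k_{f^I}}`, each given by a list of its elements. -/
def IsCoreOracle {n : ℕ} (f : Finset (Fin n) → ℤ) (orc : Val → Val) : Prop :=
  ∀ I : List (DEdge n), ∃ L : List (List (Fin n)),
    orc (encList (I.map encEdge)) = encList (L.map encNodes) ∧
    (∀ C ∈ L, C.Nodup) ∧ (L.map List.toFinset).Nodup ∧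
    ∀ A : Finset (Fin n), A ∈ L.map List.toFinset ↔
      IsCore (maxFamily (residual f (I : Multiset (DEdge n)))) A

end EdgeCover

/-! The algorithm is a primal-dual greedy. Let `I` be the edges bought so far, `l` the maximum of
the residual function (the level), `F` the family of sets attaining it, and `ν` the number of cores
of `F`. While `l > 0`, the family `F` is closed under intersection and union of members that share a
terminal (`intersectingFamily_residual`), so distinct cores share no terminal and `ν ≤ |T|`. A halo
of a core `C` is a member of `F` containing no other core. The halos of `C` form a lattice, and
halos of different cores share no terminal (`halo_core_eq`).

A spider is an edge `e` together with shortest paths from its head to several cores whose halos it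
enters. Distances are those of a Dijkstra search among the halos of one core, in which reaching a
node reaches its whole least halo. Buying a spider at an unchanged level forces every surviving
member that contains one of its cores to contain both ends of `e`. By quasi-bipartiteness one of
these ends is a terminal, so all such members intersect in `T`. Hence `ν` drops by at least the
number of feet if `e` is inner, that is, if some core has halos reaching both of its ends, and
otherwise by at least half that number (`ncard_cores_le`, `Problem.decrease`). The price is
accordingly the total length, doubled when `e` is not inner, and a spider of least price per foot is
bought.

For the lower bound (`Problem.dual_bound`), grow balls of radius up to `β` around all cores. Each
ball is a halo, so every cover sends at least `l` remaining edges into it; integration over the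
radius gives `l * ν * β`. An edge `e` pays at most `c(e)` for all cores together. At most one core
has both ends of `e` in its halos, again because of the terminal end; the other cores that are
charged are the feet of a spider, whose price is at least `2 * β` per foot (`Problem.sum_load_le`).
With `β` equal to half the least density, an iteration of cost `w` satisfies `w * l * ν ≤ 2 * c(J) *
(ν - ν')` if the level stays and `w * l ≤ 2 * c(J)` if it drops (`Problem.improve_spec`). Within
level `l` these charges sum to at most `H(ν) / l`, which is at most `(1 + ln |T|) / l`; summing over
levels gives `H(k_f) * (1 + ln |T|)`. The function `potential` turns this into a one-step
inequality.

The oracle returns only cores, so least halos must be extracted from cores of modified queries: an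
artificial edge into the core excludes sets that contain the core but miss a prescribed node, and a
second query verifies the candidate (`probe`).

Separately, list combinators for the machine model carry explicit time bounds. The algorithm is a
function on lists, implemented step by step, and the bounds compose to a polynomial. -/

namespace EdgeCover

/-! ### Programs as functions -/

/-- `e.inst k` reads its only variable from register `k`. -/
def Exp.inst (k : ℕ) : Exp → Exp
  | var _ => var k
  | nil => nil
  | num q => num q
  | cons a b => cons (a.inst k) (b.inst k)
  | head a => head (a.inst k)
  | tail a => tail (a.inst k)
  | add a b => add (a.inst k) (b.inst k)
  | sub a b => sub (a.inst k) (b.inst k)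
  | lt a b => lt (a.inst k) (b.inst k)
  | eq a b => eq (a.inst k) (b.inst k)

/-- The value of an expression in one variable. -/
def Exp.ev (e : Exp) (v : Val) : Val := e.eval fun _ => v

theorem Exp.eval_inst (k : ℕ) (s : State) (e : Exp) : (e.inst k).eval s = e.ev (s k) := by
  unfold Exp.ev
  induction e <;> simp_all [Exp.inst, Exp.eval]

theorem Exp.steps_inst (k : ℕ) (e : Exp) : (e.inst k).steps = e.steps := by
  induction e <;> simp_all [Exp.inst, Exp.steps]

/-- The input without its first `i` components. -/
def Exp.drop : ℕ → Exp
  | 0 => var 0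
  | i + 1 => tail (drop i)

/-- The `i`-th component of the input. -/
def Exp.arg (i : ℕ) : Exp := head (drop i)

@[simp] theorem Exp.steps_drop (i : ℕ) : (Exp.drop i).steps = i + 1 := by
  induction i <;> simp_all [Exp.drop, Exp.steps]

@[simp] theorem Exp.steps_arg (i : ℕ) : (Exp.arg i).steps = i + 2 := by
  simp [Exp.arg, Exp.steps]

/-- A program fragment that reads its input from a given register, leaves its output there, and
does not change smaller registers. -/
abbrev Fn : Type := ℕ → Prog

/-- With oracle `orc`, the fragment `f` turns the input `v` into `w` in at most `t` steps. -/
def Run (orc : Val → Val) (f : Fn) (v w : Val) (t : ℕ) : Prop :=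
  ∀ (k : ℕ) (s : State), s k = v →
    ∃ t' s', t' ≤ t ∧ Exec orc (f k) s t' s' ∧ s' k = w ∧ ∀ i < k, s' i = s i

namespace Fn

def exp (e : Exp) : Fn := fun k => Prog.assign k (e.inst k)

/-- `f` followed by `g`. -/
def comp (f g : Fn) : Fn := fun k => Prog.seq (f k) (g k)

/-- The function `f` applied to the value of `e`. -/
def call (e : Exp) (f : Fn) : Fn := comp (exp e) f

/-- `g` run on the input extended by the output of `f`. -/
def push (f g : Fn) : Fn := fun k =>
  Prog.seq (Prog.assign (k + 1) (Exp.var k)) (Prog.seq (f (k + 1))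
    (Prog.seq (Prog.assign k (Exp.cons (Exp.var (k + 1)) (Exp.var k))) (g k)))

def ite (e : Exp) (f g : Fn) : Fn := fun k => Prog.cond (e.inst k) (f k) (g k)

/-- The reply of the oracle to the input. -/
def ask : Fn := fun k => Prog.query k (Exp.var k)

/-- The body of the loop in `fold`. -/
def foldBody (body : Fn) (k : ℕ) : Prog :=
  Prog.seq (Prog.assign (k + 3)
      (Exp.cons (Exp.head (Exp.var k)) (Exp.cons (Exp.var (k + 1)) (Exp.var (k + 2)))))
    (Prog.seq (body (k + 3)) (Prog.seq (Prog.assign (k + 1) (Exp.var (k + 3)))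
      (Prog.assign k (Exp.tail (Exp.var k)))))

/-- Left fold over the first component of the input, with the second one as initial value; `body`
gets the current element, the accumulator and the rest of the input. -/
def fold (body : Fn) : Fn := fun k =>
  Prog.seq (Prog.assign (k + 1) (Exp.head (Exp.tail (Exp.var k))))
    (Prog.seq (Prog.assign (k + 2) (Exp.tail (Exp.tail (Exp.var k))))
      (Prog.seq (Prog.assign k (Exp.head (Exp.var k)))
        (Prog.seq (Prog.loop (Exp.var k) (foldBody body k)) (Prog.assign k (Exp.var (k + 1))))))

end Fn

namespace Run

variable {orc : Val → Val}

theorem mono {f : Fn} {v w : Val} {t t' : ℕ} (h : Run orc f v w t) (ht : t ≤ t') :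
    Run orc f v w t' := fun k s hs =>
  let ⟨a, s', ha, h'⟩ := h k s hs
  ⟨a, s', ha.trans ht, h'⟩

theorem exp (e : Exp) (v : Val) : Run orc (Fn.exp e) v (e.ev v) (e.steps + 1) := by
  intro k s hs
  refine ⟨_, Function.update s k ((e.inst k).eval s), le_rfl, ?_, ?_, ?_⟩
  · rw [← Exp.steps_inst k]; exact Exec.assign k (e.inst k) s
  · simp [Exp.eval_inst, hs]
  · intro i hi; simp [hi.ne]

theorem comp {f g : Fn} {u v w : Val} {t₁ t₂ : ℕ} (hf : Run orc f u v t₁)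
    (hg : Run orc g v w t₂) : Run orc (Fn.comp f g) u w (t₁ + t₂ + 1) := by
  intro k s hs
  obtain ⟨a, s₁, ha, e₁, h₁, p₁⟩ := hf k s hs
  obtain ⟨b, s₂, hb, e₂, h₂, p₂⟩ := hg k s₁ h₁
  exact ⟨_, s₂, by omega, Exec.seq e₁ e₂, h₂, fun i hi => (p₂ i hi).trans (p₁ i hi)⟩

theorem call {e : Exp} {f : Fn} {v w : Val} {t : ℕ} (hf : Run orc f (e.ev v) w t) :
    Run orc (Fn.call e f) v w (e.steps + t + 2) :=
  (comp (exp e v) hf).mono (by omega)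

/-- Register `k` keeps a copy of the input, because `f` runs at `k + 1` and leaves smaller registers
alone. Nested scopes thus need no renaming: every bound value becomes one more component in front of
the input. -/
theorem push {f g : Fn} {v a w : Val} {t₁ t₂ : ℕ} (hf : Run orc f v a t₁)
    (hg : Run orc g (Val.cons a v) w t₂) : Run orc (Fn.push f g) v w (t₁ + t₂ + 10) := by
  intro k s hs
  obtain ⟨a', s₁, ha, e₁, h₁, p₁⟩ := hf (k + 1) (Function.update s (k + 1) v) (by simp)
  have h1k : s₁ k = v := by rw [p₁ k (by omega)]; simp [hs]
  obtain ⟨b, s₂, hb, e₂, h₂, p₂⟩ := hg k (Function.update s₁ k (Val.cons a v)) (by simp)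
  refine ⟨_, s₂, ?_, Exec.seq (Exec.assign _ _ _) (Exec.seq (s₁ := s₁) (t₁ := a') ?_
    (Exec.seq (Exec.assign _ _ _) (t₂ := b) (s₂ := s₂) ?_)), h₂, ?_⟩
  · simp [Exp.steps]; omega
  · simpa [Exp.eval, hs] using e₁
  · simpa [Exp.eval, h₁, h1k] using e₂
  · intro i hi
    rw [p₂ i hi, Function.update_of_ne hi.ne, p₁ i (by omega),
      Function.update_of_ne (by omega)]

theorem ite {p : Prop} {e : Exp} {f g : Fn} {v w : Val} {t : ℕ}
    (hp : e.ev v ≠ Val.nil ↔ p) (hf : p → Run orc f v w t) (hg : ¬ p → Run orc g v w t) :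
    Run orc (Fn.ite e f g) v w (e.steps + t + 1) := by
  intro k s hs
  by_cases h : p
  · obtain ⟨a, s₁, ha, e₁, h₁, p₁⟩ := hf h k s hs
    refine ⟨_, s₁, ?_, Exec.cond_true (by rwa [Exp.eval_inst, hs, hp]) e₁, h₁, p₁⟩
    rw [Exp.steps_inst]; omega
  · obtain ⟨a, s₁, ha, e₁, h₁, p₁⟩ := hg h k s hs
    refine ⟨_, s₁, ?_, Exec.cond_false ?_ e₁, h₁, p₁⟩
    · rw [Exp.steps_inst]; omega
    · rw [Exp.eval_inst, hs]; by_contra h'; exact h (hp.1 h')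

theorem ask (v : Val) : Run orc Fn.ask v (orc v) (v.size + (orc v).size + 2) := by
  intro k s hs
  refine ⟨_, Function.update s k (orc ((Exp.var k).eval s)), ?_, Exec.query k _ s, ?_, ?_⟩
  · simp [Exp.eval, Exp.steps, hs]; omega
  · simp [Exp.eval, hs]
  · intro i hi; simp [hi.ne]

/-- Registers `k`, `k + 1`, `k + 2` hold the remaining list, the accumulator and the environment,
and the body runs at `k + 3`, out of their way. The body need only be correct on accumulators that
occur, namely folds over prefixes of the list. -/
theorem fold_loop {α β : Type*} {body : Fn} {B : ℕ} {env : Val} (encA : α → Val) (encB : β → Val)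
    (step : β → α → β) (l : List α) :
    ∀ (b : β) (k : ℕ) (s : State), (∀ l₁ x l₂, l = l₁ ++ x :: l₂ →
        Run orc body (Val.cons (encA x) (Val.cons (encB (l₁.foldl step b)) env))
          (encB (step (l₁.foldl step b) x)) B) →
      s k = encList (l.map encA) → s (k + 1) = encB b → s (k + 2) = env →
      ∃ t' s', t' ≤ l.length * (B + 20) + 2 ∧
        Exec orc (Prog.loop (Exp.var k) (Fn.foldBody body k)) s t' s' ∧
        s' (k + 1) = encB (l.foldl step b) ∧ ∀ i < k, s' i = s i := by
  induction l with
  | nil =>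
    intro b k s _ h0 h1 _
    exact ⟨_, s, by simp [Exp.steps], Exec.loop_done (by simpa [Exp.eval, encList] using h0),
      by simpa using h1, fun _ _ => rfl⟩
  | cons x l ih =>
    intro b k s hb h0 h1 h2
    have hr := hb [] x l rfl
    simp only [List.foldl_nil] at hr
    simp only [List.map_cons, encList] at h0
    obtain ⟨a, s₁, ha, e₁, g₁, p₁⟩ := hr (k + 3) (Function.update s (k + 3)
      (Val.cons (encA x) (Val.cons (encB b) env))) (by simp)
    have q0 : s₁ k = s k := by rw [p₁ k (by omega), Function.update_of_ne (by omega)]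
    have q2 : s₁ (k + 2) = s (k + 2) := by
      rw [p₁ (k + 2) (by omega), Function.update_of_ne (by omega)]
    let s₂ := Function.update (Function.update s₁ (k + 1) (encB (step b x))) k
      (encList (l.map encA))
    obtain ⟨c, s₃, hc, e₃, g₃, p₃⟩ := ih (step b x) k s₂
      (fun l₁ y l₂ hl => hb (x :: l₁) y l₂ (by rw [hl]; rfl))
      (by simp [s₂]) (by simp [s₂])
      (by simp [s₂, q2, h2])
    have hbody : Exec orc (Fn.foldBody body k) s
        ((Exp.cons (Exp.head (Exp.var k)) (Exp.cons (Exp.var (k + 1)) (Exp.var (k + 2)))).steps + 1 +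
          (a + ((Exp.var (k + 3)).steps + 1 + ((Exp.tail (Exp.var k)).steps + 1) + 1) + 1) + 1) s₂ := by
      refine Exec.seq (Exec.assign _ _ _) (Exec.seq (s₁ := s₁) ?_ ?_)
      · simpa [Exp.eval, h0, h1, h2, Val.head] using e₁
      · have := Exec.seq (Exec.assign (orc := orc) (k + 1) (Exp.var (k + 3)) s₁)
          (Exec.assign k (Exp.tail (Exp.var k)) _)
        simpa [Exp.eval, g₁, q0, h0, Val.tail] using this
    refine ⟨_, s₃, ?_, Exec.loop_step (by simp [Exp.eval, h0]) hbody e₃, by simpa using g₃, ?_⟩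
    · simp only [Exp.steps, List.length_cons]
      rw [Nat.succ_mul]; omega
    · intro i hi
      rw [p₃ i hi]
      simp only [s₂]
      rw [Function.update_of_ne (by omega), Function.update_of_ne (by omega), p₁ i (by omega),
        Function.update_of_ne (by omega)]

theorem fold_prefix {α β : Type*} {body : Fn} {B N : ℕ} {env : Val} (encA : α → Val)
    (encB : β → Val) (step : β → α → β) (l : List α) (b : β) (hl : l.length ≤ N)
    (hb : ∀ l₁ x l₂, l = l₁ ++ x :: l₂ →
        Run orc body (Val.cons (encA x) (Val.cons (encB (l₁.foldl step b)) env))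
          (encB (step (l₁.foldl step b) x)) B) :
    Run orc (Fn.fold body) (Val.cons (encList (l.map encA)) (Val.cons (encB b) env))
      (encB (l.foldl step b)) (N * (B + 20) + 30) := by
  intro k s hs
  let s₁ := Function.update (Function.update (Function.update s (k + 1) (encB b)) (k + 2) env) k
    (encList (l.map encA))
  obtain ⟨c, s₃, hc, e₃, g₃, p₃⟩ := fold_loop encA encB step l b k s₁ hb
    (by simp [s₁]) (by simp [s₁]) (by simp [s₁])
  refine ⟨_, Function.update s₃ k (s₃ (k + 1)), ?_, Exec.seq (Exec.assign _ _ _)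
    (Exec.seq (Exec.assign _ _ _) (Exec.seq (Exec.assign _ _ _)
      (Exec.seq (s₁ := s₃) (t₁ := c) ?_ (Exec.assign _ _ _)))), by simp [g₃], ?_⟩
  · have := Nat.mul_le_mul_right (B + 20) hl
    simp only [Exp.steps]; omega
  · simpa [Exp.eval, hs, Val.head, Val.tail] using e₃
  · intro i hi
    rw [Function.update_of_ne hi.ne, p₃ i hi]
    simp only [s₁]
    rw [Function.update_of_ne (by omega), Function.update_of_ne (by omega),
      Function.update_of_ne (by omega)]

/-- The form with an invariant, for bodies whose bounds do not depend on the number of elements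
already processed. -/
theorem fold {α β : Type*} {body : Fn} {B N : ℕ} {env : Val} (encA : α → Val) (encB : β → Val)
    (step : β → α → β) (Inv : β → Prop) (l : List α) (b : β) (hl : l.length ≤ N) (hI : Inv b)
    (hb : ∀ x ∈ l, ∀ b, Inv b → Inv (step b x) ∧
      Run orc body (Val.cons (encA x) (Val.cons (encB b) env)) (encB (step b x)) B) :
    Run orc (Fn.fold body) (Val.cons (encList (l.map encA)) (Val.cons (encB b) env))
      (encB (l.foldl step b)) (N * (B + 20) + 30) := by
  refine fold_prefix encA encB step l b hl fun l₁ x l₂ h => (hb x (by simp [h]) _ ?_).2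
  have hsub : l₁ ⊆ l := by simp [h]
  clear h
  induction l₁ using List.reverseRecOn with
  | nil => exact hI
  | append_singleton l₁ y ih =>
    rw [List.foldl_append]
    exact (hb y (hsub (by simp)) _ (ih fun z hz => hsub (by simp [hz]))).1

end Run

/-! ### List processing -/

def encBool (b : Bool) : Val := cond b (Val.num 1) Val.nil

theorem encBool_ne_nil (b : Bool) : encBool b ≠ Val.nil ↔ b = true := by
  cases b <;> simp [encBool]

def encOption {α : Type*} (enc : α → Val) : Option α → Val
  | none => Val.nil
  | some a => enc a

/-- The last element of a list that satisfies `p`. -/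
def lastSat {α : Type*} (p : α → Bool) (l : List α) : Option α :=
  l.foldl (fun acc x => if p x then some x else acc) none

/-- This is why `reverse` occurs throughout the algorithm: a fold builds its output back to front,
and the functions below are written to agree literally with what the programs compute. -/
theorem foldl_cons_eq {α : Type*} (l b : List α) :
    l.foldl (fun acc x => x :: acc) b = l.reverse ++ b := by
  induction l generalizing b <;> simp_all

theorem foldl_reverse_append {α β : Type*} (g : α → List β) (l : List α) (b : List β) :
    l.foldl (fun acc x => (g x).reverse ++ acc) b = (l.flatMap g).reverse ++ b := by
  induction l generalizing b <;> simp_all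

theorem foldl_or {α : Type*} (p : α → Bool) (l : List α) (b : Bool) :
    l.foldl (fun acc x => if p x then true else acc) b = (b || l.any p) := by
  induction l generalizing b with
  | nil => simp
  | cons x l ih => simp only [List.foldl_cons, ih, List.any_cons]; cases p x <;> simp

namespace Fn

/-- The reverse of the first component, followed by the second one. -/
def reverseAppend : Fn := fold (exp (.cons (.arg 0) (.arg 1)))

def flatMap (g : Fn) : Fn :=
  call (.cons (.arg 0) (.cons .nil (.drop 1))) (fold (push (call (.cons (.arg 0) (.drop 2)) g)
    (call (.cons (.arg 0) (.cons (.arg 2) .nil)) reverseAppend)))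

def filter (p : Fn) : Fn :=
  flatMap (push p (ite (.arg 0) (exp (.cons (.arg 1) .nil)) (exp .nil)))

def map (f : Fn) : Fn := flatMap (comp f (exp (.cons (.var 0) .nil)))

def any (p : Fn) : Fn :=
  call (.cons (.arg 0) (.cons .nil (.drop 1))) (fold (push (call (.cons (.arg 0) (.drop 2)) p)
    (ite (.arg 0) (exp (.num 1)) (exp (.arg 2)))))

def last (p : Fn) : Fn :=
  call (.cons (.arg 0) (.cons .nil (.drop 1))) (fold (push (call (.cons (.arg 0) (.drop 2)) p)
    (ite (.arg 0) (exp (.arg 1)) (exp (.arg 2)))))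

def argmin (lt : Fn) : Fn :=
  call (.cons (.arg 0) (.cons .nil (.drop 1))) (fold (ite (.arg 1) (push lt
    (ite (.arg 0) (exp (.arg 1)) (exp (.arg 2)))) (exp (.arg 0))))

end Fn

namespace Run

variable {orc : Val → Val} {env : Val} {α β : Type*} {t N : ℕ}

theorem reverseAppend (enc : α → Val) (a b : List α)
    (ha : a.length ≤ N) :
    Run orc Fn.reverseAppend
      (Val.cons (encList (a.map enc)) (Val.cons (encList (b.map enc)) env))
      (encList ((a.reverse ++ b).map enc)) (N * 30 + 30) := by
  rw [← foldl_cons_eq]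
  refine fold (B := 10) enc (fun l => encList (l.map enc)) (fun acc x => x :: acc) (fun _ => True)
    a b ha trivial fun x _ b _ => ⟨trivial, ?_⟩
  exact (exp (.cons (.arg 0) (.arg 1)) _).mono (by simp [Exp.steps])

theorem flatMap (encA : α → Val) (encB : β → Val) (g : α → List β) (l : List α) (hl : l.length ≤ N) {gF : Fn} {K : ℕ}
    (hg : ∀ x ∈ l, Run orc gF (Val.cons (encA x) env) (encList ((g x).map encB)) t)
    (hK : ∀ x ∈ l, (g x).length ≤ K) :
    Run orc (Fn.flatMap gF) (Val.cons (encList (l.map encA)) env)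
      (encList ((l.flatMap g).reverse.map encB)) (N * (t + K * 30 + 90) + 50) := by
  have := foldl_reverse_append g l []
  rw [List.append_nil] at this
  rw [← this]
  refine (call (t := N * (t + K * 30 + 70 + 20) + 30) (fold encA
    (fun l => encList (l.map encB)) (fun acc x => (g x).reverse ++ acc) (fun _ => True) l []
    hl trivial fun x hx b _ => ⟨trivial, ?_⟩)).mono ?_
  · refine (push (call (hg x hx)) (call (reverseAppend (env := Val.nil) encB (g x) b (hK x hx)))).mono ?_
    simp [Exp.steps]; omega
  · have : N * (t + K * 30 + 70 + 20) = N * (t + K * 30 + 90) := by ring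
    simp only [Exp.steps, Exp.steps_arg, Exp.steps_drop]; omega

theorem filter (enc : α → Val) (p : α → Bool) (l : List α) (hl : l.length ≤ N) {pF : Fn}
    (hp : ∀ x ∈ l, Run orc pF (Val.cons (enc x) env) (encBool (p x)) t) :
    Run orc (Fn.filter pF) (Val.cons (encList (l.map enc)) env)
      (encList ((l.filter p).reverse.map enc)) (N * (t + 150) + 50) := by
  have h : l.filter p = l.flatMap fun x => if p x then [x] else [] := by
    clear hl hp
    induction l with
    | nil => rfl
    | cons a l ih =>
      simp only [List.filter_cons, List.flatMap_cons, ih]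
      split <;> simp
  rw [h]
  refine (flatMap (t := t + 30) (K := 1) enc enc (fun x => if p x then [x] else []) l hl
    (fun x hx => ?_) fun x _ => by split <;> simp).mono
    (by gcongr)
  refine (push (hp x hx) (ite (t := 10) (p := p x = true) (by simp [Exp.ev, Exp.eval, Exp.arg, Exp.drop, Val.head, encBool_ne_nil]) (fun h => ?_)
    fun h => ?_)).mono (by simp)
  · rw [if_pos h]; exact (exp _ _).mono (by simp [Exp.steps])
  · rw [if_neg h]; exact (exp _ _).mono (by simp [Exp.steps])

theorem map (encA : α → Val) (encB : β → Val) (f : α → β) (l : List α) (hl : l.length ≤ N) {fF : Fn}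
    (hf : ∀ x ∈ l, Run orc fF (Val.cons (encA x) env) (encB (f x)) t) :
    Run orc (Fn.map fF) (Val.cons (encList (l.map encA)) env)
      (encList ((l.map f).reverse.map encB)) (N * (t + 150) + 50) := by
  rw [List.map_eq_flatMap (f := f)]
  refine (flatMap (t := t + 30) (K := 1) encA encB (fun x => [f x]) l hl
    (fun x hx => ?_) fun x _ => by simp).mono (by gcongr)
  exact (comp (hf x hx) (exp _ _)).mono (by simp [Exp.steps])

theorem any (enc : α → Val) (p : α → Bool) (l : List α) (hl : l.length ≤ N) {pF : Fn}
    (hp : ∀ x ∈ l, Run orc pF (Val.cons (enc x) env) (encBool (p x)) t) :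
    Run orc (Fn.any pF) (Val.cons (encList (l.map enc)) env) (encBool (l.any p))
      (N * (t + 100) + 50) := by
  have := foldl_or p l false
  rw [Bool.false_or] at this
  rw [← this]
  refine (call (t := N * (t + 50 + 20) + 30) (fold enc encBool
    (fun acc x => if p x then true else acc) (fun _ => True) l false
    hl trivial fun x hx b _ => ⟨trivial, ?_⟩)).mono ?_
  · refine (push (call (hp x hx)) (ite (t := 10) (p := p x = true)
      (by simp [Exp.ev, Exp.eval, Exp.arg, Exp.drop, Val.head, encBool_ne_nil]) (fun h => ?_) fun h => ?_)).mono
      (by simp [Exp.steps]; omega)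
    · rw [if_pos h]; exact (exp _ _).mono (by simp [Exp.steps])
    · rw [if_neg h]; exact (exp _ _).mono (by simp)
  · have : N * (t + 50 + 20) ≤ N * (t + 100) := Nat.mul_le_mul_left _ (by omega)
    simp only [Exp.steps, Exp.steps_arg, Exp.steps_drop]; omega

theorem last (enc : α → Val) (p : α → Bool) (l : List α) (hl : l.length ≤ N) {pF : Fn}
    (hp : ∀ x ∈ l, Run orc pF (Val.cons (enc x) env) (encBool (p x)) t) :
    Run orc (Fn.last pF) (Val.cons (encList (l.map enc)) env) (encOption enc (lastSat p l))
      (N * (t + 100) + 50) := by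
  refine (call (t := N * (t + 50 + 20) + 30) (fold enc (encOption enc)
    (fun acc x => if p x then some x else acc) (fun _ => True) l none
    hl trivial fun x hx b _ => ⟨trivial, ?_⟩)).mono ?_
  · refine (push (call (hp x hx)) (ite (t := 10) (p := p x = true)
      (by simp [Exp.ev, Exp.eval, Exp.arg, Exp.drop, Val.head, encBool_ne_nil]) (fun h => ?_) fun h => ?_)).mono
      (by simp [Exp.steps]; omega)
    · rw [if_pos h]; exact (exp _ _).mono (by simp)
    · rw [if_neg h]; exact (exp _ _).mono (by simp)
  · have : N * (t + 50 + 20) ≤ N * (t + 100) := Nat.mul_le_mul_left _ (by omega)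
    simp only [Exp.steps, Exp.steps_arg, Exp.steps_drop]; omega

/-- The fold is the one that defines `List.argmin`. An empty accumulator is encoded by `nil`, so
testing it is sound only if no element has that encoding. -/
theorem argmin (enc : α → Val) (key : α → ℚ) (l : List α) (hl : l.length ≤ N) {ltF : Fn}
    (hne : ∀ x, enc x ≠ Val.nil)
    (hlt : ∀ x ∈ l, ∀ y ∈ l, Run orc ltF (Val.cons (enc x) (Val.cons (enc y) env))
      (encBool (decide (key x < key y))) t) :
    Run orc (Fn.argmin ltF) (Val.cons (encList (l.map enc)) env)
      (encOption enc (l.argmin key)) (N * (t + 100) + 50) := by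
  refine (call (t := N * (t + 50 + 20) + 30) (fold enc (encOption enc)
    (List.argAux fun b c => key b < key c) (fun o => ∀ y ∈ o, y ∈ l) l none
    hl (by simp) fun x hx o ho => ⟨?_, ?_⟩)).mono ?_
  · intro y hy
    cases o with
    | none => simp [List.argAux] at hy; exact hy ▸ hx
    | some z =>
      simp only [List.argAux] at hy
      split at hy <;> simp at hy
      · exact hy ▸ hx
      · exact hy ▸ ho z rfl
  · refine (ite (t := t + 30) (p := o.isSome) ?_ (fun h => ?_) fun h => ?_).mono
      (by simp; omega)
    · cases o <;> simp [Exp.ev, Exp.eval, Exp.arg, Exp.drop, Val.head, Val.tail, encOption, hne]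
    · obtain ⟨y, rfl⟩ := Option.isSome_iff_exists.1 h
      refine (push (hlt x hx y (ho y rfl)) (ite (t := 10) (p := key x < key y)
        (by simp [Exp.ev, Exp.eval, Exp.arg, Exp.drop, Val.head, encBool_ne_nil]) (fun h => ?_) fun h => ?_)).mono
        (by simp)
      · simp only [List.argAux, if_pos h]; exact (exp _ _).mono (by simp)
      · simp only [List.argAux, if_neg h]; exact (exp _ _).mono (by simp)
    · obtain rfl : o = none := by simpa using h
      exact (exp _ _).mono (by simp)
  · have : N * (t + 50 + 20) ≤ N * (t + 100) := Nat.mul_le_mul_left _ (by omega)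
    simp only [Exp.steps, Exp.steps_arg, Exp.steps_drop]; omega

end Run

/-! ### The algorithm -/

/-- Membership of a node in a list of nodes. -/
def mem {n : ℕ} (u : Node n) (A : List (Fin n)) : Bool := A.any fun x => decide (some x = u)

/-- Some element of `A` is missing in `B`. -/
def notSub {n : ℕ} (A B : List (Fin n)) : Bool := A.any fun x => !mem (some x) B

/-- `A` contains `u` and `C`, and contains no list of `L` that is not contained in `C`. -/
def goodCore {n : ℕ} (L : List (List (Fin n))) (C : List (Fin n)) (u : Node n)
    (A : List (Fin n)) : Bool :=
  mem u A && (!notSub C A && !(L.any fun C' => !notSub C' A && notSub C' C))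

/-- Edges that enter every nonempty set other than `C` and `A ⊇ C`. -/
def isolating {n : ℕ} (C A : List (Fin n)) : List (DEdge n) :=
  ((List.finRange n).flatMap fun y =>
    if mem (some y) A then
      ((A.filter fun x => !mem (some y) C || mem (some x) C).reverse.map fun x =>
        ((some x, some y) : DEdge n)).reverse
    else [(none, some y)]).reverse

/-- A set of nodes with a distance to a core, and a path realizing it. -/
structure Label (n m : ℕ) where
  set : List (Fin n)
  dist : ℚ
  path : List (Fin m)

/-- An edge with a list of paths that continue it to distinct cores. -/
structure Spider (n m : ℕ) where
  edge : Fin m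
  price : ℚ
  feet : List (Label n m)

/-- The price per foot. -/
def Spider.density {n m : ℕ} (s : Spider n m) : ℚ := s.price / s.feet.length

/-- The label that was entered first among those whose set contains `v` (labels are listed with the
most recent first). -/
def findLabel {n m : ℕ} (l : List (Label n m)) (v : Node n) : Option (Label n m) :=
  lastSat (fun en => mem v en.set) l

/-- The data that are fixed in one iteration: the edges `Q` bought, the current cores `L` and the
remaining edges `R`. -/
structure Ctx (n m : ℕ) where
  Q : List (DEdge n)
  L : List (List (Fin n))
  R : List (Fin m)

section

variable (G : Network) (cores : List (DEdge G.n) → List (List (Fin G.n))) (c : Ctx G.n G.m)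

/-- `G.m` copies of the edges that isolate `C` and `A`. -/
def heavy (C A : List (Fin G.n)) : List (DEdge G.n) :=
  ((List.finRange G.m).reverse.flatMap fun _ => isolating C A).reverse

/-- The least member of the halo family of `C` that contains `u`, or `[]` if there is none. -/
def probe (C : List (Fin G.n)) (u : Node G.n) : List (Fin G.n) :=
  match C with
  | [] => []
  | x :: _ =>
    -- The extra edge enters every set that contains `x` but not `u`. Members containing the core
    -- survive this query only if they contain `u`.
    let A := (lastSat (goodCore c.L C u) (cores ((u, some x) :: c.Q))).getD []
    if A = [] then [] else
      -- If the extra edge enters all members, the maximum drops and the candidate may come from a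
      -- lower level. The heavy edges eliminate every nonempty set except `C` and `A`, so this query
      -- compares just these two.
      if mem u ((cores ((u, some x) :: ((heavy G C A).reverse ++ c.Q))).headD []) then A else []

/-- The labels that can be derived from `l`. -/
def relax (C : List (Fin G.n)) (l : List (Label G.n G.m)) : List (Label G.n G.m) :=
  (c.R.flatMap fun e =>
    match findLabel l (G.edge e).2 with
    | none => []
    | some en =>
      if (findLabel l (G.edge e).1).isSome then [] else
        if probe G cores c C (G.edge e).1 = [] then [] else
          [⟨probe G cores c C (G.edge e).1, en.dist + G.cost e, e :: en.path⟩]).reverse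

/-- One step of Dijkstra's algorithm. -/
def grow (C : List (Fin G.n)) (l : List (Label G.n G.m)) : List (Label G.n G.m) :=
  match (relax G cores c C l).argmin Label.dist with
  | none => l
  | some en => en :: l

def labels (C : List (Fin G.n)) : List (Label G.n G.m) :=
  (List.finRange G.n).foldl (fun l _ => grow G cores c C l) [⟨C, 0, []⟩]

/-- The cores with their labels. -/
def table : List (List (Fin G.n) × List (Label G.n G.m)) :=
  (c.L.map fun C => (C, labels G cores c C)).reverse

/-- The paths of length at most `θ` from the head of `e` to cores whose halo family `e` enters. -/
def feet (e : Fin G.m) (θ : ℚ) : List (Label G.n G.m) :=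
  ((table G cores c).flatMap fun p =>
    if probe G cores c p.1 (G.edge e).1 = [] then
      match findLabel p.2 (G.edge e).2 with
      | none => []
      | some en => if θ < en.dist then [] else [en]
    else []).reverse

/-- Some halo family has a member that contains both ends of `e`. -/
def inner (e : Fin G.m) : Bool :=
  c.L.any fun C => !decide (probe G cores c C (G.edge e).1 = []) &&
    !decide (probe G cores c C (G.edge e).2 = [])

def price (e : Fin G.m) (X : List (Label G.n G.m)) : ℚ :=
  let s := X.foldl (fun s en => s + en.dist) (G.cost e)
  -- When `e` is not inner, the number of cores may drop by only half the number of feet; doubling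
  -- the price compensates for this.
  if inner G cores c e then s else s + s

def spider (e : Fin G.m) (θ : ℚ) : List (Spider G.n G.m) :=
  if feet G cores c e θ = [] then [] else
    [⟨e, price G cores c e (feet G cores c e θ), feet G cores c e θ⟩]

/-- The set of feet changes only at radii that are label distances, so trying these radii loses no
spider. -/
def spiders : List (Spider G.n G.m) :=
  (c.R.flatMap fun e => ((table G cores c).flatMap fun p =>
    (p.2.flatMap fun en => spider G cores c e en.dist).reverse).reverse).reverse

/-- The edges of a spider. -/
def Spider.has {n m : ℕ} (s : Spider n m) (e : Fin m) : Bool :=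
  decide (s.edge = e) || s.feet.any fun en => en.path.any fun e' => decide (e' = e)

/-- The context for the edges `R` remaining and the edges `I` bought. -/
def context (s : List (Fin G.m) × List (Fin G.m)) : Ctx G.n G.m :=
  ⟨(s.2.map G.edge).reverse, cores (s.2.map G.edge).reverse, s.1⟩

/-- One iteration: buy the spider of least density. -/
def improve (s : List (Fin G.m) × List (Fin G.m)) : List (Fin G.m) × List (Fin G.m) :=
  let c := context G cores s
  -- At level `0` the empty set is the only core; at a positive level every core meets `T`. The
  -- first core therefore tells whether anything is left to cover.
  if c.L.headD [] = [] then s else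
    match (spiders G cores c).argmin Spider.density with
    | none => s
    | some b => ((s.1.filter fun e => !b.has e).reverse, s.1.filter b.has ++ s.2)

/-- The edges bought in the end. -/
def solution : List (Fin G.m) :=
  -- Every round at a positive level buys at least one new edge, so `G.m` rounds suffice; the list
  -- only serves as a counter.
  ((List.finRange G.m).reverse.foldl (fun s _ => improve G cores s)
    ((List.finRange G.m).reverse, [])).2

end

/-! ### Implementation -/

section Encodings

variable (G : Network)

/-- Paths and purchases consist of whole records, so the ends and the cost of an edge are read
without a search. -/
def encRec (e : Fin G.m) : Val :=
  Val.cons (Val.num ((e : ℕ) : ℚ)) (Val.cons (encEdge (G.edge e)) (Val.num (G.cost e)))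

def encRecs (l : List (Fin G.m)) : Val := encList (l.map (encRec G))

def encLabel (en : Label G.n G.m) : Val :=
  Val.cons (encNodes en.set) (Val.cons (Val.num en.dist) (encRecs G en.path))

def encLabels (l : List (Label G.n G.m)) : Val := encList (l.map (encLabel G))

def encRow (p : List (Fin G.n) × List (Label G.n G.m)) : Val :=
  Val.cons (encNodes p.1) (encLabels G p.2)

def encSpider (s : Spider G.n G.m) : Val :=
  Val.cons (encRec G s.edge) (Val.cons (Val.num s.price) (encLabels G s.feet))

def encQuery {n : ℕ} (l : List (DEdge n)) : Val := encList (l.map encEdge)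

def encCores {n : ℕ} (l : List (List (Fin n))) : Val := encList (l.map encNodes)

def encCtx (c : Ctx G.n G.m) : Val :=
  Val.cons (encQuery c.Q) (Val.cons (encCores c.L) (Val.cons (encNodes (List.finRange G.n))
    (Val.cons (encRecs G (List.finRange G.m).reverse) (Val.cons (encRecs G c.R) Val.nil))))

def encPurchase (s : List (Fin G.m) × List (Fin G.m)) : Val :=
  Val.cons (encRecs G s.1) (encRecs G s.2)

end Encodings

theorem Val.num_eq (a b : ℚ) : (Val.num a).eq (Val.num b) = encBool (decide (a = b)) := by
  by_cases h : a = b <;> simp [Val.eq, encBool, h]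

theorem Val.num_lt (a b : ℚ) : (Val.num a).lt (Val.num b) = encBool (decide (a < b)) := by
  by_cases h : a < b <;> simp [Val.lt, encBool, h]

theorem encNode_eq {n : ℕ} (u v : Node n) : (encNode u).eq (encNode v) = encBool (decide (u = v)) := by
  have h (i : ℕ) : ((i : ℚ) + 1) ≠ 0 := by positivity
  rcases u with _ | u <;> rcases v with _ | v <;>
    simp [encNode, Val.num_eq, h, (h _).symm, Fin.ext_iff]

theorem encNodes_ne_nil {n : ℕ} (A : List (Fin n)) : encNodes A ≠ Val.nil ↔ A ≠ [] := by
  cases A <;> simp [encNodes, encList]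

theorem encLabels_ne_nil (G : Network) (l : List (Label G.n G.m)) :
    encLabels G l ≠ Val.nil ↔ l ≠ [] := by
  cases l <;> simp [encLabels, encList]

theorem encOption_ne_nil {α : Type*} {enc : α → Val} (h : ∀ a, enc a ≠ Val.nil) (o : Option α) :
    encOption enc o ≠ Val.nil ↔ o.isSome = true := by
  cases o <;> simp [encOption, h]

theorem Run.iteBool {orc : Val → Val} {b : Bool} {e : Exp} {f g : Fn} {v w : Val} {t : ℕ}
    (hb : e.ev v = encBool b) (hf : b = true → Run orc f v w t) (hg : b = false → Run orc g v w t) :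
    Run orc (Fn.ite e f g) v w (e.steps + t + 1) :=
  Run.ite (by rw [hb]; exact encBool_ne_nil b) hf fun h => hg (by simpa using h)

/-- A Boolean function followed by a constant for either value. -/
theorem Run.exp_const {orc : Val → Val} {v w : Val} {e : Exp} {t : ℕ} (h : e.ev v = w)
    (ht : e.steps + 1 ≤ t) : Run orc (Fn.exp e) v w t :=
  h ▸ (Run.exp e v).mono ht

/-! ### Programs for the functions of the algorithm. -/

namespace Fn

open Exp (arg drop)

def mem : Fn := call (.cons (arg 1) (.cons (arg 0) .nil)) (any (exp (.eq (arg 0) (arg 1))))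

def notSub : Fn := call (.cons (arg 0) (.cons (arg 1) .nil))
  (any (push mem (ite (arg 0) (exp .nil) (exp (.num 1)))))

def goodCore : Fn :=
  push (call (.cons (arg 2) (.cons (arg 0) .nil)) mem) (ite (arg 0)
    (push (call (.cons (arg 2) (.cons (arg 1) .nil)) notSub) (ite (arg 0) (exp .nil)
      (push (call (.cons (arg 5) (.cons (arg 2) (.cons (arg 3) .nil)))
          (any (push notSub (ite (arg 0) (exp .nil)
            (call (.cons (arg 1) (.cons (arg 3) .nil)) notSub)))))
        (ite (arg 0) (exp .nil) (exp (.num 1))))))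
    (exp .nil))

def isolating : Fn :=
  call (.cons (arg 2) (.cons (arg 1) (.cons (arg 0) .nil)))
    (flatMap (push mem (ite (arg 0)
      (push (call (.cons (arg 2) (.cons (arg 1) (.cons (arg 3) .nil)))
          (filter (push (call (.cons (arg 1) (.cons (arg 2) .nil)) mem)
            (ite (arg 0) (call (.cons (arg 1) (.cons (arg 3) .nil)) mem) (exp (.num 1))))))
        (call (.cons (arg 0) (.cons (arg 2) .nil)) (map (exp (.cons (arg 0) (arg 1))))))
      (exp (.cons (.cons (.num 0) (arg 1)) .nil)))))

def probe : Fn :=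
  ite (arg 0)
    (push (exp (.cons (arg 1) (.head (arg 0))))
      (push (call (.cons (arg 0) (arg 3)) ask)
        (push (call (.cons (arg 0) (.cons (arg 2) (.cons (arg 3) (.cons (arg 5) .nil))))
            (last goodCore))
          (ite (arg 0)
            (push (call (.cons (arg 3) (.cons (arg 0) (.cons (arg 7) .nil))) isolating)
              (push (call (.cons (arg 9) (.cons (arg 0) .nil)) (flatMap (exp (arg 1))))
                (push (call (.cons (arg 0) (.cons (arg 7) .nil)) reverseAppend)
                  (push (call (.cons (arg 5) (arg 0)) ask)
                    (push (call (.cons (arg 8) (.cons (.head (arg 0)) .nil)) mem)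
                      (ite (arg 0) (exp (arg 5)) (exp .nil)))))))
            (exp .nil)))))
    (exp .nil)

def findLabel : Fn := call (.cons (arg 1) (.cons (arg 0) .nil))
  (last (call (.cons (arg 1) (.cons (.head (arg 0)) .nil)) mem))

end Fn

/-- The tail of an encoded edge record. -/
def Exp.src (e : Exp) : Exp := head (head (tail e))
/-- The head of an encoded edge record. -/
def Exp.dst (e : Exp) : Exp := tail (head (tail e))
/-- The cost in an encoded edge record. -/
def Exp.cost (e : Exp) : Exp := tail (tail e)

@[simp] theorem Exp.steps_src (e : Exp) : e.src.steps = e.steps + 3 := rfl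
@[simp] theorem Exp.steps_dst (e : Exp) : e.dst.steps = e.steps + 3 := rfl
@[simp] theorem Exp.steps_cost (e : Exp) : e.cost.steps = e.steps + 2 := rfl

namespace Fn

open Exp (arg drop)

def relaxEdge : Fn :=
  push (call (.cons (arg 0).dst (.cons (arg 2) .nil)) findLabel) (ite (arg 0)
    (push (call (.cons (arg 1).src (.cons (arg 3) .nil)) findLabel) (ite (arg 0)
      (exp .nil)
      (push (call (.cons (arg 3) (.cons (arg 2).src (drop 5))) probe) (ite (arg 0)
        (exp (.cons (.cons (arg 0) (.cons (.add (.head (.tail (arg 2))) (arg 3).cost)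
          (.cons (arg 3) (.tail (.tail (arg 2)))))) .nil))
        (exp .nil)))))
    (exp .nil))

def relax : Fn := call (.cons (arg 6) (drop 0)) (flatMap relaxEdge)

def grow : Fn :=
  push relax (push (call (.cons (arg 0) .nil)
      (argmin (exp (.lt (.head (.tail (arg 0))) (.head (.tail (arg 1)))))))
    (ite (arg 0) (exp (.cons (arg 0) (arg 3))) (exp (arg 3))))

def labels : Fn :=
  call (.cons (arg 3) (.cons (.cons (.cons (arg 0) (.cons (.num 0) .nil)) .nil) (drop 0)))
    (fold (call (.cons (arg 2) (.cons (arg 1) (drop 3))) grow))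

def table : Fn := call (.cons (arg 1) (drop 0)) (map (push labels (exp (.cons (arg 1) (arg 0)))))

def feet : Fn :=
  call (.cons (arg 2) (.cons (arg 0) (.cons (arg 1) (drop 3))))
    (flatMap (push (call (.cons (.head (arg 0)) (.cons (arg 1).src (drop 3))) probe) (ite (arg 0)
      (exp .nil)
      (push (call (.cons (arg 2).dst (.cons (.tail (arg 1)) .nil)) findLabel) (ite (arg 0)
        (ite (.lt (arg 4) (.head (.tail (arg 0)))) (exp .nil) (exp (.cons (arg 0) .nil)))
        (exp .nil))))))

def inner : Fn :=
  call (.cons (arg 2) (drop 0))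
    (any (push (call (.cons (arg 0) (.cons (arg 1).src (drop 2))) probe) (ite (arg 0)
      (push (call (.cons (arg 1) (.cons (arg 2).dst (drop 3))) probe)
        (ite (arg 0) (exp (.num 1)) (exp .nil)))
      (exp .nil))))

def price : Fn :=
  push (call (.cons (arg 1) (.cons (arg 0).cost .nil))
      (fold (exp (.add (arg 1) (.head (.tail (arg 0)))))))
    (push (call (.cons (arg 1) (drop 3)) inner)
      (ite (arg 0) (exp (arg 1)) (exp (.add (arg 1) (arg 1)))))

def spider : Fn :=
  push feet (ite (arg 0)
    (push (call (.cons (arg 1) (.cons (arg 0) (drop 4))) price)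
      (exp (.cons (.cons (arg 2) (.cons (arg 0) (arg 1))) .nil)))
    (exp .nil))

def spiders : Fn :=
  call (.cons (arg 5) (drop 0)) (flatMap (call (.cons (arg 1) (drop 0))
    (flatMap (call (.cons (.tail (arg 0)) (drop 1))
      (flatMap (call (.cons (arg 1) (.cons (.head (.tail (arg 0))) (drop 2))) spider))))))

/-- Densities are compared by cross-multiplication, since there is no division; the factors are list
lengths, so multiplication is repeated addition. -/
def times : Fn := call (.cons (arg 1) (.cons (.num 0) (.cons (arg 0) .nil)))
  (fold (exp (.add (arg 1) (arg 2))))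

def lessDense : Fn :=
  push (call (.cons (.head (.tail (arg 0))) (.cons (.tail (.tail (arg 1))) .nil)) times)
    (push (call (.cons (.head (.tail (arg 2))) (.cons (.tail (.tail (arg 1))) .nil)) times)
      (exp (.lt (arg 1) (arg 0))))

def has : Fn :=
  ite (.eq (.head (.head (arg 1))) (.head (arg 0))) (exp (.num 1))
    (call (.cons (.tail (.tail (arg 1))) (.cons (arg 0) .nil))
      (any (call (.cons (.tail (.tail (arg 0))) (.cons (arg 1) .nil))
        (any (exp (.eq (.head (arg 0)) (.head (arg 1))))))))

def improve : Fn :=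
  push (call (.cons (.tail (arg 0)) .nil) (map (exp (.head (.tail (arg 0))))))
    (push (call (arg 0) ask) (ite (.head (arg 0))
      (push (exp (.cons (arg 1) (.cons (arg 0) (.cons (arg 3) (.cons (arg 4)
          (.cons (.head (arg 2)) .nil))))))
        (push (call (arg 0) table) (push (call (.cons (arg 0) (arg 1)) spiders)
          (push (call (.cons (arg 0) .nil) (argmin lessDense)) (ite (arg 0)
            (push (call (.cons (.head (arg 6)) (.cons (arg 0) .nil))
                (filter (push has (ite (arg 0) (exp .nil) (exp (.num 1))))))
              (push (call (.cons (.head (arg 7)) (.cons (arg 1) .nil)) (filter has))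
                (push (call (.cons (arg 0) (.cons (.tail (arg 8)) .nil)) reverseAppend)
                  (exp (.cons (arg 2) (arg 0))))))
            (exp (arg 6)))))))
      (exp (arg 2))))

/-- The list of the numbers from `1` to the input. -/
def iota : Fn := fun k =>
  Prog.seq (Prog.assign (k + 1) .nil)
    (Prog.seq (Prog.loop (.lt (.num 0) (.var k))
        (Prog.seq (Prog.assign (k + 1) (.cons (.var k) (.var (k + 1))))
          (Prog.assign k (.sub (.var k) (.num 1)))))
      (Prog.assign k (.var (k + 1))))

def main : Fn :=
  push (call (arg 0) iota)
    (push (call (.cons (drop 3) (.cons (.cons (.num 0) .nil) .nil))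
        (fold (exp (.cons (.add (.head (arg 1)) (.num 1))
          (.cons (.cons (.head (arg 1)) (arg 0)) (.tail (arg 1)))))))
      (push (call (.cons (.tail (arg 0)) (.cons (.cons (.tail (arg 0)) .nil)
          (.cons (arg 1) (.cons (.tail (arg 0)) .nil)))) (fold (call (drop 1) improve)))
        (call (.cons (.tail (arg 0)) .nil) (map (exp (.head (arg 0)))))))

end Fn

/-! ### Running times of set operations and isolating edges. -/

namespace Run

section Sets

variable {orc : Val → Val} {env : Val} {n N : ℕ}

def tMem (N : ℕ) : ℕ := N * (20 + 100) + 100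

theorem mem (u : Node n) (A : List (Fin n)) (hA : A.length ≤ N) :
    Run orc Fn.mem (Val.cons (encNode u) (Val.cons (encNodes A) env)) (encBool (mem u A))
      (tMem N) :=
  (call (any (t := 20) (env := Val.cons (encNode u) Val.nil) (fun x => encNode (some x))
    (fun x => decide (some x = u)) A hA fun x _ =>
      exp_const (e := .eq (.arg 0) (.arg 1)) (encNode_eq (some x) u) (by simp [Exp.steps]))).mono (by simp [Exp.steps, tMem]; omega)

def tNotSub (N : ℕ) : ℕ := N * (tMem N + 30 + 100) + 100

theorem notSub (A B : List (Fin n)) (hA : A.length ≤ N) (hB : B.length ≤ N) :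
    Run orc Fn.notSub (Val.cons (encNodes A) (Val.cons (encNodes B) env)) (encBool (notSub A B))
      (tNotSub N) := by
  refine (call (any (t := tMem N + 30) (env := Val.cons (encNodes B) Val.nil)
    (fun x => encNode (some x)) (fun x => !EdgeCover.mem (some x) B) A hA fun x _ => ?_)).mono
    (by simp [Exp.steps, tNotSub]; omega)
  refine (push (mem (some x) B hB) (iteBool (t := 10) rfl (fun h => ?_) fun h => ?_)).mono
    (by simp)
  · exact exp_const (by simp [h]; rfl) (by simp [Exp.steps])
  · exact exp_const (by simp [h]; rfl) (by simp [Exp.steps])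

def tGood (N : ℕ) : ℕ := tMem N + tNotSub N + N * (2 * tNotSub N + 50 + 100) + 300

theorem goodCore (L : List (List (Fin n))) (C A : List (Fin n)) (u : Node n) (hL : L.length ≤ N)
    (hLC : ∀ C ∈ L, C.length ≤ N) (hC : C.length ≤ N) (hA : A.length ≤ N) :
    Run orc Fn.goodCore (Val.cons (encNodes A) (Val.cons (encNodes C) (Val.cons (encNode u)
      (Val.cons (encCores L) env)))) (encBool (goodCore L C u A)) (tGood N) := by
  unfold EdgeCover.goodCore
  refine (push (call (mem u A hA)) (iteBool (t := tNotSub N + N * (2 * tNotSub N + 50 + 100) + 200)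
    rfl (fun h1 => ?_) fun h1 => ?_)).mono (by simp [Exp.steps, tGood]; omega)
  · refine (push (call (notSub C A hC hA)) (iteBool (t := N * (2 * tNotSub N + 50 + 100) + 150)
      rfl (fun h2 => ?_) fun h2 => ?_)).mono (by simp [Exp.steps]; omega)
    · exact exp_const (by simp [h1, h2]; rfl) (by simp [Exp.steps])
    · refine (push (call (any (t := 2 * tNotSub N + 50) (N := N)
        (env := Val.cons (encNodes A) (Val.cons (encNodes C) Val.nil)) encNodes
        (fun C' => !EdgeCover.notSub C' A && EdgeCover.notSub C' C) L hL fun C' hC' => ?_))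
        (iteBool (t := 10) rfl (fun h3 => ?_) fun h3 => ?_)).mono (by simp [Exp.steps]; omega)
      · refine (push (notSub C' A (hLC _ hC') hA) (iteBool (t := tNotSub N + 20) rfl (fun h4 => ?_)
          fun h4 => ?_)).mono (by simp; omega)
        · exact exp_const (by simp [h4]; rfl) (by simp [Exp.steps])
        · rw [h4]
          exact (call (notSub C' C (hLC _ hC') hC)).mono (by simp [Exp.steps]; omega)
      · exact exp_const (by simp only [h1, h2, h3]; rfl) (by simp [Exp.steps])
      · exact exp_const (by simp only [h1, h2, h3]; rfl) (by simp [Exp.steps])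
  · exact exp_const (by simp [h1]; rfl) (by simp [Exp.steps])

def tIsol (N : ℕ) : ℕ :=
  N * ((tMem N + (N * ((2 * tMem N + 40) + 150) + 50) + (N * (20 + 150) + 50) + 200) + N * 30 + 90) +
    100

theorem length_isolating (C A : List (Fin n)) (hn : n + 1 ≤ N) (hA : A.length ≤ N) :
    (isolating C A).length ≤ N * N := by
  simp only [isolating, List.length_reverse, List.length_flatMap]
  refine (List.sum_le_card_nsmul _ N fun x hx => ?_).trans ?_
  · simp only [List.mem_map, List.mem_finRange, true_and] at hx
    obtain ⟨y, rfl⟩ := hx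
    split
    · simpa using (List.length_filter_le _ _).trans hA
    · simp; omega
  · simp only [List.length_map, List.length_finRange, smul_eq_mul]
    gcongr; omega

theorem isolating (C A : List (Fin n)) (hn : n + 1 ≤ N) (hC : C.length ≤ N) (hA : A.length ≤ N) :
    Run orc Fn.isolating (Val.cons (encNodes C) (Val.cons (encNodes A)
      (Val.cons (encNodes (List.finRange n)) env))) (encQuery (isolating C A)) (tIsol N) := by
  refine (call (flatMap (N := N) (K := N)
    (t := tMem N + (N * ((2 * tMem N + 40) + 150) + 50) + (N * (20 + 150) + 50) + 200)
    (env := Val.cons (encNodes A) (Val.cons (encNodes C) Val.nil))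
    (fun x => encNode (some x)) encEdge _ (List.finRange n)
    (by simp; omega) (fun y _ => ?_) fun y _ => ?_)).mono (by simp [Exp.steps, tIsol]; omega)
  · refine (push (mem (some y) A hA) (iteBool
      (t := (N * ((2 * tMem N + 40) + 150) + 50) + (N * (20 + 150) + 50) + 100)
      rfl (fun h => ?_) fun h => ?_)).mono (by simp; omega)
    · rw [if_pos h]
      refine (push (call (filter (N := N) (t := 2 * tMem N + 40)
        (env := Val.cons (encNode (some y)) (Val.cons (encNodes C) Val.nil))
        (fun x => encNode (some x)) _ A hA
        fun x _ => ?_)) (call (map (N := N) (t := 20) (env := Val.cons (encNode (some y)) Val.nil)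
        (fun x => encNode (some x)) encEdge _ _ ?_ fun x _ => exp_const ?_ ?_))).mono
        (by simp [Exp.steps]; omega)
      · refine (push (call (mem (some y) C hC)) (iteBool (t := tMem N + 15) rfl (fun h => ?_)
          fun h => ?_)).mono (by simp [Exp.steps]; omega)
        · rw [h]
          exact (call (mem (some x) C hC)).mono (by simp [Exp.steps]; omega)
        · exact exp_const (by simp [h]; rfl) (by simp [Exp.steps])
      · simpa using (List.length_filter_le _ _).trans hA
      · rfl
      · simp [Exp.steps]
    · rw [if_neg (by simp [h])]
      exact exp_const rfl (by simp [Exp.steps])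
  · split
    · simpa using (List.length_filter_le _ _).trans hA
    · simp; omega

end Sets

end Run

/-! ### Size bounds, and the running time of a probe. -/

theorem length_encList_size_le {l : List Val} {K N : ℕ} (hl : l.length ≤ N)
    (h : ∀ v ∈ l, v.size ≤ K) : (encList l).size ≤ N * (K + 1) + 1 := by
  refine le_trans ?_ (Nat.add_le_add_right (Nat.mul_le_mul_right (K + 1) hl) 1)
  clear hl
  induction l with
  | nil => simp [encList, Val.size]
  | cons a l ih =>
    have h1 := h a (by simp)
    have h2 := ih fun v hv => h v (by simp [hv])
    simp only [encList, Val.size, List.length_cons]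
    rw [Nat.succ_mul]; omega

theorem size_encNode {n : ℕ} (u : Node n) : (encNode u).size = 1 := by
  cases u <;> rfl

/-- `cores` lists the replies of `orc`, and `N` bounds all relevant lengths. -/
structure Bounded (orc : Val → Val) (G : Network)
    (cores : List (DEdge G.n) → List (List (Fin G.n))) (N : ℕ) : Prop where
  n_lt : G.n + 1 ≤ N
  m_lt : G.m + 1 ≤ N
  reply : ∀ I, orc (encQuery I) = encCores (cores I)
  length_cores : ∀ I, (cores I).length ≤ N
  length_core : ∀ I, ∀ C ∈ cores I, C.length ≤ N

structure Ctx.Small {n m : ℕ} (c : Ctx n m) (N : ℕ) : Prop where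
  Q : c.Q.length ≤ N
  L : c.L.length ≤ N
  R : c.R.length ≤ N
  core : ∀ C ∈ c.L, C.length ≤ N

def Label.Small {n m : ℕ} (en : Label n m) (N : ℕ) : Prop :=
  en.set.length ≤ N ∧ en.path.length ≤ N

theorem lastSat_spec {α : Type*} (p : α → Bool) (l : List α) :
    (lastSat p l = none ∧ ∀ x ∈ l, p x = false) ∨
      ∃ l₁ x l₂, l = l₁ ++ x :: l₂ ∧ lastSat p l = some x ∧ p x = true ∧
        ∀ y ∈ l₂, p y = false := by
  induction l using List.reverseRecOn with
  | nil => left; simp [lastSat]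
  | append_singleton l a ih =>
    have h : lastSat p (l ++ [a]) = if p a then some a else lastSat p l := by
      simp [lastSat, List.foldl_append]
    rw [h]
    cases ha : p a with
    | true => right; exact ⟨l, a, [], by simp [ha]⟩
    | false =>
      rcases ih with ⟨h1, h2⟩ | ⟨l₁, x, l₂, rfl, h2, h3, h4⟩
      · left
        refine ⟨by simp [h1], fun x hx => ?_⟩
        rcases List.mem_append.1 hx with hx | hx
        · exact h2 x hx
        · simp at hx; exact hx ▸ ha
      · right
        refine ⟨l₁, x, l₂ ++ [a], by simp, by simp [h2], h3, fun y hy => ?_⟩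
        rcases List.mem_append.1 hy with hy | hy
        · exact h4 y hy
        · simp at hy; exact hy ▸ ha

theorem mem_of_lastSat {α : Type*} {p : α → Bool} {l : List α} {x : α} (h : lastSat p l = some x) :
    x ∈ l ∧ p x = true := by
  rcases lastSat_spec p l with ⟨h1, -⟩ | ⟨l₁, y, l₂, rfl, h2, h3, -⟩
  · simp [h1] at h
  · rw [h2] at h; cases h; exact ⟨by simp, h3⟩

theorem head_encCores {n : ℕ} (l : List (List (Fin n))) :
    (encCores l).head = encNodes (l.headD []) := by
  cases l <;> rfl

namespace Run

theorem iteOf {orc : Val → Val} {p : Prop} {e : Exp} {f g : Fn} {v v' w : Val} {t : ℕ}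
    (hp : v' ≠ Val.nil ↔ p) (he : e.ev v = v') (hf : p → Run orc f v w t)
    (hg : ¬ p → Run orc g v w t) : Run orc (Fn.ite e f g) v w (e.steps + t + 1) :=
  ite (he ▸ hp) hf hg

theorem callOf {orc : Val → Val} {e : Exp} {f : Fn} {v v' w : Val} {t : ℕ}
    (hf : Run orc f v' w t) (he : e.ev v = v') : Run orc (Fn.call e f) v w (e.steps + t + 2) :=
  call (he ▸ hf)

variable {orc : Val → Val} {G : Network} {cores : List (DEdge G.n) → List (List (Fin G.n))}
  {c : Ctx G.n G.m} {env : Val} {N : ℕ}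

def tAsk (M N : ℕ) : ℕ := M * 4 + 1 + (N * (N * 2 + 1 + 1) + 1) + 2

theorem ask_cores {M : ℕ} (hB : Bounded orc G cores N) (I : List (DEdge G.n)) (hI : I.length ≤ M) :
    Run orc Fn.ask (encQuery I) (encCores (cores I)) (tAsk M N) := by
  have h := ask (orc := orc) (encQuery I)
  rw [hB.reply] at h
  refine h.mono ?_
  have h1 : (encQuery I).size ≤ M * (3 + 1) + 1 :=
    length_encList_size_le (by simpa using hI) fun v hv => by
      obtain ⟨e, -, rfl⟩ := List.mem_map.1 hv
      simp [encEdge, Val.size, size_encNode]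
  have h2 : (encCores (cores I)).size ≤ N * (N * 2 + 1 + 1) + 1 :=
    length_encList_size_le (by simpa using hB.length_cores I) fun v hv => by
      obtain ⟨C, hC, rfl⟩ := List.mem_map.1 hv
      exact length_encList_size_le (K := 1) (by simpa using hB.length_core I C hC) fun v hv => by
        obtain ⟨x, -, rfl⟩ := List.mem_map.1 hv
        exact (size_encNode _).le
  simp only [tAsk]; omega

def tProbe (N : ℕ) : ℕ :=
  tAsk (N + 1) N + (N * (tGood N + 100) + 50) + tIsol N + (N * (10 + N * N * 30 + 90) + 50) +
    (N * (N * N) * 30 + 30) + tAsk (N * (N * N) + N + 1) N + tMem N + 300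

theorem length_heavy (hB : Bounded orc G cores N) (C A : List (Fin G.n)) (hA : A.length ≤ N) :
    (heavy G C A).length ≤ N * (N * N) := by
  simp only [heavy, List.length_reverse, List.length_flatMap]
  refine (List.sum_le_card_nsmul _ (N * N) fun x hx => ?_).trans ?_
  · simp only [List.mem_map] at hx
    obtain ⟨y, -, rfl⟩ := hx
    exact length_isolating C A hB.n_lt hA
  · simp only [List.length_map, List.length_reverse, List.length_finRange, smul_eq_mul]
    have := hB.m_lt
    gcongr; omega

theorem length_probe (hB : Bounded orc G cores N) (C : List (Fin G.n)) (u : Node G.n) :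
    (probe G cores c C u).length ≤ N := by
  unfold probe
  split
  · simp
  · dsimp only
    split
    · simp
    · split
      · rename_i x _ _ _
        cases h : lastSat (EdgeCover.goodCore c.L _ u) (cores ((u, some x) :: c.Q)) with
        | none => simp
        | some A => exact hB.length_core _ A (mem_of_lastSat h).1
      · simp

theorem probe (hB : Bounded orc G cores N) (hc : c.Small N) (C : List (Fin G.n))
    (hC : C.length ≤ N) (u : Node G.n) :
    Run orc Fn.probe (Val.cons (encNodes C) (Val.cons (encNode u) (encCtx G c)))
      (encNodes (probe G cores c C u)) (tProbe N) := by
  refine (iteOf (t := tProbe N - 10) (encNodes_ne_nil C) (by rfl) (fun h => ?_) fun h => ?_).mono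
    (by simp [tProbe]; omega)
  · obtain ⟨x, C', rfl⟩ := List.exists_cons_of_ne_nil h
    have e1 := call (e := .cons (.arg 0) (.arg 3))
      (v := Val.cons (encEdge (u, some x)) (Val.cons (encNodes (x :: C')) (Val.cons (encNode u)
        (encCtx G c)))) (ask_cores hB ((u, some x) :: c.Q) (M := N + 1)
          (by simpa using hc.Q))
    set A := (lastSat (EdgeCover.goodCore c.L (x :: C') u) (cores ((u, some x) :: c.Q))).getD []
      with hA
    have hprobe : EdgeCover.probe G cores c (x :: C') u = if A = [] then [] else
      if EdgeCover.mem u ((cores ((u, some x) :: ((heavy G (x :: C') A).reverse ++ c.Q))).headD [])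
        then A else [] := rfl
    have hAN : A.length ≤ N := by
      cases h : lastSat (EdgeCover.goodCore c.L (x :: C') u) (cores ((u, some x) :: c.Q)) with
      | none => simp [hA, h]
      | some A' => simpa [hA, h] using hB.length_core _ A' (mem_of_lastSat h).1
    have hAe : encOption encNodes (lastSat (EdgeCover.goodCore c.L (x :: C') u)
        (cores ((u, some x) :: c.Q))) = encNodes A := by
      rw [hA]
      cases lastSat (EdgeCover.goodCore c.L (x :: C') u) (cores ((u, some x) :: c.Q)) <;> rfl
    have e2 := call (e := .cons (.arg 0) (.cons (.arg 2) (.cons (.arg 3) (.cons (.arg 5) .nil))))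
      (v := Val.cons (encCores (cores ((u, some x) :: c.Q))) (Val.cons (encEdge (u, some x))
        (Val.cons (encNodes (x :: C')) (Val.cons (encNode u) (encCtx G c)))))
      (last (N := N) (orc := orc) (t := tGood N)
        (env := Val.cons (encNodes (x :: C')) (Val.cons (encNode u) (Val.cons (encCores c.L) Val.nil)))
        encNodes (EdgeCover.goodCore c.L (x :: C') u) _ (hB.length_cores _) fun A hA =>
          goodCore c.L _ A u hc.L hc.core hC (hB.length_core _ _ hA))
    rw [hAe] at e2
    refine (push (exp _ _) (push e1 (push e2 (iteOf (t := tIsol N + (N * (10 + N * N * 30 + 90) + 50) +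
      (N * (N * N) * 30 + 30) + tAsk (N * (N * N) + N + 1) N + tMem N + 200) (encNodes_ne_nil A) (by rfl)
      (fun hne => ?_) fun hne => ?_)))).mono (by simp [Exp.steps, tProbe]; omega)
    · have hH := length_heavy hB (x :: C') A hAN
      have hcQ := hc.Q
      have hmem : (((cores ((u, some x) ::
          ((heavy G (x :: C') A).reverse ++ c.Q))).headD []).length ≤ N) := by
        rw [List.headD_eq_head?_getD]
        cases h : (cores ((u, some x) :: ((heavy G (x :: C') A).reverse ++ c.Q))).head? with
        | none => simp
        | some B => exact hB.length_core _ B (List.mem_of_mem_head? h)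
      refine (push (call (isolating (x :: C') A hB.n_lt hC hAN)) (push
        (call (e := .cons (.arg 9) (.cons (.arg 0) .nil)) (flatMap (t := 10) (K := N * N) (N := N)
          (env := Val.cons (encQuery (EdgeCover.isolating (x :: C') A)) Val.nil) (encRec G) encEdge
          (fun _ => EdgeCover.isolating (x :: C') A) (List.finRange G.m).reverse
          (by simpa using Nat.le_of_succ_le hB.m_lt) (fun _ _ => exp_const rfl (by simp))
          fun _ _ => length_isolating _ _ hB.n_lt hAN))
        (push (call (reverseAppend encEdge (heavy G (x :: C') A) c.Q hH))
          (push (call (e := .cons (.arg 5) (.arg 0)) (ask_cores hB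
            ((u, some x) :: ((heavy G (x :: C') A).reverse ++ c.Q)) (M := N * (N * N) + N + 1)
            (by simp; omega)))
            (push (callOf (mem (env := Val.nil) u _ hmem)
              (by exact congrArg (fun z => Val.cons (encNode u) (Val.cons z Val.nil)) (head_encCores _)))
              (iteBool (t := 10) rfl (fun h => ?_) fun h => ?_)))))).mono
        (by simp [Exp.steps]; omega)
      · exact exp_const (by rw [hprobe, if_neg hne, if_pos h]; rfl) (by simp)
      · exact exp_const (by rw [hprobe, if_neg hne, if_neg (by rw [h]; simp)]; rfl) (by simp [Exp.steps])
    · exact exp_const (by rw [hprobe, if_pos (by simpa using hne)]; rfl)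
        (by simp [Exp.steps])
  · obtain rfl : C = [] := by simpa using h
    exact exp_const rfl (by simp [Exp.steps, tProbe])

end Run

theorem encLabel_ne_nil (G : Network) (en : Label G.n G.m) : encLabel G en ≠ Val.nil := by
  simp [encLabel]

section Sizes

variable {orc : Val → Val} {G : Network} {cores : List (DEdge G.n) → List (List (Fin G.n))}
  {c : Ctx G.n G.m} {N : ℕ}

theorem length_relaxEdge_le (C : List (Fin G.n)) (l : List (Label G.n G.m)) (e : Fin G.m) :
    (match findLabel l (G.edge e).2 with
    | none => []
    | some en =>
      if (findLabel l (G.edge e).1).isSome then [] else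
        if probe G cores c C (G.edge e).1 = [] then [] else
          [(⟨probe G cores c C (G.edge e).1, en.dist + G.cost e, e :: en.path⟩ :
            Label G.n G.m)]).length ≤ 1 := by
  split
  · simp
  · split
    · simp
    · split <;> simp

theorem mem_relax {C : List (Fin G.n)} {l : List (Label G.n G.m)} {a : Label G.n G.m} :
    a ∈ relax G cores c C l ↔ ∃ e ∈ c.R, ∃ en, findLabel l (G.edge e).2 = some en ∧
      findLabel l (G.edge e).1 = none ∧ probe G cores c C (G.edge e).1 ≠ [] ∧
      a = ⟨probe G cores c C (G.edge e).1, en.dist + G.cost e, e :: en.path⟩ := by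
  simp only [relax, List.mem_reverse, List.mem_flatMap]
  refine exists_congr fun e => and_congr_right fun _ => ?_
  cases findLabel l (G.edge e).2 <;> cases findLabel l (G.edge e).1 <;>
    by_cases h : probe G cores c C (G.edge e).1 = [] <;> simp [h]

theorem length_relax (hc : c.Small N) (C : List (Fin G.n)) (l : List (Label G.n G.m)) :
    (relax G cores c C l).length ≤ N := by
  rw [relax, List.length_reverse, List.length_flatMap]
  refine (List.sum_le_card_nsmul _ 1 fun x hx => ?_).trans (by simpa using hc.R)
  obtain ⟨e, -, rfl⟩ := List.mem_map.1 hx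
  exact length_relaxEdge_le C l e

theorem mem_of_findLabel {l : List (Label G.n G.m)} {v : Node G.n} {en : Label G.n G.m}
    (h : findLabel l v = some en) : en ∈ l ∧ mem v en.set = true :=
  mem_of_lastSat h

/-- The labels after a number of steps. -/
theorem grow_small (hB : Bounded orc G cores N) (C : List (Fin G.n)) {l : List (Label G.n G.m)}
    {k : ℕ} (hl : l.length ≤ k + 1) (hs : ∀ en ∈ l, en.set.length ≤ N ∧ en.path.length ≤ k) :
    (grow G cores c C l).length ≤ k + 2 ∧
      ∀ en ∈ grow G cores c C l, en.set.length ≤ N ∧ en.path.length ≤ k + 1 := by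
  unfold grow
  split
  · exact ⟨by omega, fun en h => ⟨(hs en h).1, (hs en h).2.trans (by omega)⟩⟩
  · rename_i a ha
    refine ⟨by simpa using hl, fun en hen => ?_⟩
    rcases List.mem_cons.1 hen with rfl | hen
    · obtain ⟨e, he, a, h1, -, -, rfl⟩ := mem_relax.1 (List.argmin_mem ha)
      exact ⟨Run.length_probe hB _ _, by simpa using (hs a (mem_of_findLabel h1).1).2⟩
    · exact ⟨(hs en hen).1, (hs en hen).2.trans (by omega)⟩

/-- A round adds at most one label, and its path extends an old one by one edge; both lengths are
bounded by the number of rounds. -/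
theorem foldl_grow_small (hB : Bounded orc G cores N) (C : List (Fin G.n)) (hC : C.length ≤ N)
    (r : List (Fin G.n)) :
    (r.foldl (fun l _ => grow G cores c C l) [⟨C, 0, []⟩]).length ≤ r.length + 1 ∧
      ∀ en ∈ r.foldl (fun l _ => grow G cores c C l) [⟨C, 0, []⟩],
        en.set.length ≤ N ∧ en.path.length ≤ r.length := by
  induction r using List.reverseRecOn with
  | nil => simpa using hC
  | append_singleton r x ih =>
    simpa [List.foldl_append] using grow_small (c := c) hB C ih.1 ih.2

theorem length_labels (hB : Bounded orc G cores N) {C : List (Fin G.n)} (hC : C.length ≤ N) :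
    (labels G cores c C).length ≤ N :=
  (foldl_grow_small hB C hC _).1.trans (by simpa using hB.n_lt)

theorem small_of_mem_labels (hB : Bounded orc G cores N) {C : List (Fin G.n)} (hC : C.length ≤ N) :
    ∀ en ∈ labels G cores c C, en.Small N := fun en h =>
  ⟨((foldl_grow_small hB C hC _).2 en h).1,
    ((foldl_grow_small hB C hC _).2 en h).2.trans (by
      have := hB.n_lt; simp; omega)⟩

theorem mem_table {p : List (Fin G.n) × List (Label G.n G.m)} :
    p ∈ table G cores c ↔ p.1 ∈ c.L ∧ p.2 = labels G cores c p.1 := by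
  rcases p with ⟨C, l⟩
  simp only [table, List.mem_reverse, List.mem_map, Prod.mk.injEq]
  constructor
  · rintro ⟨a, h, rfl, rfl⟩; exact ⟨h, rfl⟩
  · rintro ⟨h, rfl⟩; exact ⟨_, h, rfl, rfl⟩

theorem length_table (hc : c.Small N) : (table G cores c).length ≤ N := by
  simpa [table] using hc.L

theorem mem_feet {e : Fin G.m} {θ : ℚ} {en : Label G.n G.m} :
    en ∈ feet G cores c e θ ↔ ∃ C ∈ c.L, probe G cores c C (G.edge e).1 = [] ∧
      findLabel (labels G cores c C) (G.edge e).2 = some en ∧ en.dist ≤ θ := by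
  simp only [feet, List.mem_reverse, List.mem_flatMap, mem_table]
  constructor
  · rintro ⟨⟨C, l⟩, ⟨hC, hl⟩, h⟩
    dsimp only at hC hl h
    subst hl
    refine ⟨C, hC, ?_⟩
    split at h
    · rename_i h1
      refine ⟨h1, ?_⟩
      cases h2 : findLabel (labels G cores c C) (G.edge e).2 with
      | none => simp [h2] at h
      | some a =>
        simp only [h2] at h
        split at h
        · simp at h
        · rename_i h3
          simp only [List.mem_singleton] at h
          exact ⟨by rw [h], h ▸ not_lt.1 h3⟩
    · simp at h
  · rintro ⟨C, hC, h1, h2, h3⟩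
    exact ⟨(C, labels G cores c C), ⟨hC, rfl⟩, by simp [h1, h2, not_lt.2 h3]⟩

theorem length_feet (hc : c.Small N) (e : Fin G.m) (θ : ℚ) :
    (feet G cores c e θ).length ≤ N := by
  rw [feet, List.length_reverse, List.length_flatMap]
  refine (List.sum_le_card_nsmul _ 1 fun x hx => ?_).trans
    (by simpa using length_table (cores := cores) hc)
  obtain ⟨e, -, rfl⟩ := List.mem_map.1 hx
  split
  · split
    · simp
    · split <;> simp
  · simp

theorem mem_spider {e : Fin G.m} {θ : ℚ} {s : Spider G.n G.m} :
    s ∈ spider G cores c e θ ↔ feet G cores c e θ ≠ [] ∧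
      s = ⟨e, price G cores c e (feet G cores c e θ), feet G cores c e θ⟩ := by
  unfold spider; split <;> simp [*]

theorem mem_spiders {s : Spider G.n G.m} :
    s ∈ spiders G cores c ↔ ∃ e ∈ c.R, ∃ C ∈ c.L, ∃ en ∈ labels G cores c C,
      feet G cores c e en.dist ≠ [] ∧
      s = ⟨e, price G cores c e (feet G cores c e en.dist), feet G cores c e en.dist⟩ := by
  simp only [spiders, List.mem_reverse, List.mem_flatMap, mem_table, mem_spider]
  refine exists_congr fun e => and_congr_right fun _ => ?_
  constructor
  · rintro ⟨⟨C, l⟩, ⟨hC, hl⟩, h⟩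
    dsimp only at hC hl h
    subst hl
    exact ⟨C, hC, h⟩
  · rintro ⟨C, hC, h⟩; exact ⟨(C, _), ⟨hC, rfl⟩, h⟩

end Sizes

/-! ### Running time of the search for distances and feet. -/

namespace Run

variable {orc : Val → Val} {G : Network} {cores : List (DEdge G.n) → List (List (Fin G.n))}
  {c : Ctx G.n G.m} {env : Val} {N : ℕ}

def tFind (N : ℕ) : ℕ := N * ((tMem N + 30) + 100) + 100

theorem findLabel (l : List (Label G.n G.m)) (v : Node G.n) (hl : l.length ≤ N)
    (hs : ∀ en ∈ l, en.Small N) :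
    Run orc Fn.findLabel (Val.cons (encNode v) (Val.cons (encLabels G l) env))
      (encOption (encLabel G) (findLabel l v)) (tFind N) :=
  (call (last (t := tMem N + 30) (env := Val.cons (encNode v) Val.nil) (encLabel G)
    (fun en => EdgeCover.mem v en.set) l hl fun en hen =>
      (call (mem v en.set (hs en hen).1)).mono (by simp [Exp.steps]; omega))).mono
    (by simp [Exp.steps, tFind]; omega)

def tRelax (N : ℕ) : ℕ := N * ((2 * tFind N + tProbe N + 200) + 1 * 30 + 90) + 100

theorem relax (hB : Bounded orc G cores N) (hc : c.Small N) (C : List (Fin G.n))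
    (hC : C.length ≤ N) (l : List (Label G.n G.m)) (hl : l.length ≤ N)
    (hs : ∀ en ∈ l, en.Small N) :
    Run orc Fn.relax (Val.cons (encNodes C) (Val.cons (encLabels G l) (encCtx G c)))
      (encLabels G (relax G cores c C l)) (tRelax N) := by
  refine (call (flatMap (N := N) (K := 1) (t := 2 * tFind N + tProbe N + 200)
    (env := Val.cons (encNodes C) (Val.cons (encLabels G l) (encCtx G c)))
    (encRec G) (encLabel G) _ c.R hc.R (fun e _ => ?_)
    fun e _ => length_relaxEdge_le (cores := cores) (c := c) C l e)).mono
    (by simp [Exp.steps, tRelax]; omega)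
  refine (push (call (findLabel l (G.edge e).2 hl hs)) (iteOf (t := tFind N + tProbe N + 150)
    (encOption_ne_nil (encLabel_ne_nil G) _) (by rfl) (fun h1 => ?_) fun h1 => ?_)).mono
    (by simp [Exp.steps]; omega)
  · obtain ⟨en, hen⟩ := Option.isSome_iff_exists.1 h1
    rw [hen]
    refine (push (callOf (findLabel (env := Val.nil) l (G.edge e).1 hl hs) (by rfl)) (iteOf
      (t := tProbe N + 100)
      (encOption_ne_nil (encLabel_ne_nil G) _) (by rfl) (fun h2 => ?_) fun h2 => ?_)).mono
      (by simp [Exp.steps]; omega)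
    · simp only [if_pos h2]
      exact exp_const rfl (by simp [Exp.steps])
    · simp only [if_neg h2]
      refine (push (callOf (probe hB hc C hC (G.edge e).1) (by rfl)) (iteOf
        (t := 60) (encNodes_ne_nil _) (by rfl) (fun h3 => ?_) fun h3 => ?_)).mono
        (by simp [Exp.steps, Exp.src]; omega)
      · simp only [if_neg h3]
        exact exp_const rfl (by simp [Exp.steps, Exp.cost])
      · rw [not_not] at h3; simp only [if_pos h3]
        exact exp_const rfl (by simp [Exp.steps])
  · have : EdgeCover.findLabel l (G.edge e).2 = none := by simpa using h1
    rw [this]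
    exact exp_const rfl (by simp [Exp.steps])

def tGrow (N : ℕ) : ℕ := tRelax N + (N * (20 + 100) + 50) + 100

theorem grow (hB : Bounded orc G cores N) (hc : c.Small N) (C : List (Fin G.n))
    (hC : C.length ≤ N) (l : List (Label G.n G.m)) (hl : l.length ≤ N)
    (hs : ∀ en ∈ l, en.Small N) :
    Run orc Fn.grow (Val.cons (encNodes C) (Val.cons (encLabels G l) (encCtx G c)))
      (encLabels G (grow G cores c C l)) (tGrow N) := by
  unfold EdgeCover.grow
  refine (push (relax hB hc C hC l hl hs) (push (callOf (argmin (N := N) (t := 20)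
    (env := Val.nil) (encLabel G) Label.dist _ (length_relax (cores := cores) hc C l)
    (encLabel_ne_nil G)
    fun x _ y _ => exp_const (by exact Val.num_lt x.dist y.dist) (by simp [Exp.steps])) (by rfl))
    (iteOf (t := 20) (encOption_ne_nil (encLabel_ne_nil G) _) (by rfl)
      (fun h1 => ?_) fun h1 => ?_))).mono (by simp [Exp.steps, tGrow]; omega)
  · obtain ⟨en, hen⟩ := Option.isSome_iff_exists.1 h1
    rw [hen]
    exact exp_const rfl (by simp [Exp.steps])
  · have : (EdgeCover.relax G cores c C l).argmin Label.dist = none := by simpa using h1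
    rw [this]
    exact exp_const rfl (by simp)

def tLabels (N : ℕ) : ℕ := N * ((tGrow N + 30) + 20) + 100

theorem labels (hB : Bounded orc G cores N) (hc : c.Small N) (C : List (Fin G.n))
    (hC : C.length ≤ N) :
    Run orc Fn.labels (Val.cons (encNodes C) (encCtx G c))
      (encLabels G (labels G cores c C)) (tLabels N) := by
  have hn := hB.n_lt
  -- The sizes of the labels grow from round to round and stay below `N` only because there are
  -- `G.n` rounds, so the prefix form of the fold is needed.
  refine (callOf (fold_prefix (N := N) (B := tGrow N + 30)
    (env := Val.cons (encNodes C) (encCtx G c)) (fun x => encNode (some x)) (encLabels G)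
    (fun l _ => EdgeCover.grow G cores c C l) (List.finRange G.n) [⟨C, 0, []⟩]
    (by simp; omega) fun l₁ x l₂ h => ?_) (by rfl)).mono
    (by simp [Exp.steps, tLabels]; omega)
  have hlen : l₁.length < G.n := by
    have := congrArg List.length h
    simp at this; omega
  obtain ⟨h1, h2⟩ := foldl_grow_small (c := c) hB C hC l₁
  exact (callOf (grow hB hc C hC _ (by omega) fun en hen =>
    ⟨(h2 en hen).1, (h2 en hen).2.trans (by omega)⟩) (by rfl)).mono (by simp [Exp.steps]; omega)

def tTable (N : ℕ) : ℕ := N * ((tLabels N + 30) + 150) + 100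

theorem table (hB : Bounded orc G cores N) (hc : c.Small N) :
    Run orc Fn.table (encCtx G c) (encList ((table G cores c).map (encRow G))) (tTable N) :=
  (call (map (N := N) (t := tLabels N + 30) (env := encCtx G c) encNodes (encRow G)
    (fun C => (C, EdgeCover.labels G cores c C)) c.L hc.L fun C hC =>
      (push (labels hB hc C (hc.core C hC)) (exp_const (t := 20) rfl
        (by simp [Exp.steps]))).mono (by omega))).mono (by simp [Exp.steps, tTable]; omega)

def tFeet (N : ℕ) : ℕ := N * ((tProbe N + tFind N + 100) + 1 * 30 + 90) + 100

theorem feet (hB : Bounded orc G cores N) (hc : c.Small N) (e : Fin G.m) (θ : ℚ) :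
    Run orc Fn.feet (Val.cons (encRec G e) (Val.cons (Val.num θ)
      (Val.cons (encList ((EdgeCover.table G cores c).map (encRow G))) (encCtx G c))))
      (encLabels G (feet G cores c e θ)) (tFeet N) := by
  refine (call (flatMap (N := N) (K := 1) (t := tProbe N + tFind N + 100)
    (env := Val.cons (encRec G e) (Val.cons (Val.num θ) (encCtx G c)))
    (encRow G) (encLabel G) _ _ (length_table hc) (fun p hp => ?_) fun p hp => ?_)).mono
    (by simp [Exp.steps, tFeet]; omega)
  · obtain ⟨hp1, hp2⟩ := mem_table.1 hp
    refine (push (callOf (probe hB hc p.1 (hc.core _ hp1) (G.edge e).1) (by rfl)) (iteOf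
      (t := tFind N + 70) (encNodes_ne_nil _) (by rfl) (fun h1 => ?_) fun h1 => ?_)).mono
      (by simp [Exp.steps, Exp.src]; omega)
    · rw [if_neg h1]
      exact exp_const rfl (by simp [Exp.steps])
    · rw [if_pos (by simpa using h1)]
      refine (push (callOf (findLabel (N := N) (env := Val.nil) p.2 (G.edge e).2
        (hp2 ▸ length_labels hB (hc.core _ hp1)) (hp2 ▸ small_of_mem_labels hB (hc.core _ hp1)))
        (by rfl)) (iteOf (t := 30) (encOption_ne_nil (encLabel_ne_nil G) _) (by rfl)
        (fun h2 => ?_) fun h2 => ?_)).mono (by simp [Exp.steps, Exp.dst]; omega)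
      · obtain ⟨en, hen⟩ := Option.isSome_iff_exists.1 h2
        rw [hen]
        refine (iteBool (t := 10) (b := decide (θ < en.dist)) (by exact Val.num_lt _ _) (fun h3 => ?_)
          fun h3 => ?_).mono (by simp [Exp.steps])
        · simp only [decide_eq_true_eq] at h3
          simp only [if_pos h3]
          exact exp_const rfl (by simp [Exp.steps])
        · simp only [decide_eq_false_iff_not] at h3
          simp only [if_neg h3]
          exact exp_const rfl (by simp [Exp.steps])
      · have : EdgeCover.findLabel p.2 (G.edge e).2 = none := by simpa using h2
        rw [this]
        exact exp_const rfl (by simp [Exp.steps])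
  · split
    · split
      · simp
      · split <;> simp
    · simp

end Run

/-- The feet of `s` are nonempty and of bounded size. -/
structure Spider.Small {n m : ℕ} (s : Spider n m) (N : ℕ) : Prop where
  feet_ne : s.feet ≠ []
  length_feet : s.feet.length ≤ N
  path : ∀ en ∈ s.feet, en.path.length ≤ N

theorem Spider.density_lt {n m : ℕ} {s t : Spider n m} (hs : s.feet ≠ []) (ht : t.feet ≠ []) :
    s.density < t.density ↔ t.feet.length * s.price < s.feet.length * t.price := by
  have h1 : (0 : ℚ) < s.feet.length := by exact_mod_cast List.length_pos_iff.2 hs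
  have h2 : (0 : ℚ) < t.feet.length := by exact_mod_cast List.length_pos_iff.2 ht
  rw [Spider.density, Spider.density, div_lt_div_iff₀ h1 h2, mul_comm, mul_comm t.price]

theorem encSpider_ne_nil (G : Network) (s : Spider G.n G.m) : encSpider G s ≠ Val.nil := by
  simp [encSpider]

section Sizes

variable {orc : Val → Val} {G : Network} {cores : List (DEdge G.n) → List (List (Fin G.n))}
  {c : Ctx G.n G.m} {N : ℕ}

theorem small_of_mem_spiders (hB : Bounded orc G cores N) (hc : c.Small N) {s : Spider G.n G.m}
    (hs : s ∈ spiders G cores c) : s.Small N := by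
  obtain ⟨e, -, C, -, en, -, h1, rfl⟩ := mem_spiders.1 hs
  refine ⟨h1, length_feet hc _ _, fun a ha => ?_⟩
  obtain ⟨C', hC', -, h2, -⟩ := mem_feet.1 ha
  exact (small_of_mem_labels hB (hc.core _ hC') a (mem_of_findLabel h2).1).2

theorem length_spider_le (e : Fin G.m) (θ : ℚ) : (spider G cores c e θ).length ≤ 1 := by
  unfold spider; split <;> simp

theorem length_flatMap_le {α β : Type*} {l : List α} {g : α → List β} {K N : ℕ}
    (hl : l.length ≤ N) (h : ∀ x ∈ l, (g x).length ≤ K) : (l.flatMap g).length ≤ N * K := by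
  rw [List.length_flatMap]
  refine (List.sum_le_card_nsmul _ K fun x hx => ?_).trans (by simpa using Nat.mul_le_mul_right K hl)
  obtain ⟨y, hy, rfl⟩ := List.mem_map.1 hx
  exact h y hy

theorem context_small (hB : Bounded orc G cores N) {s : List (Fin G.m) × List (Fin G.m)}
    (hs : s.1.length + s.2.length ≤ G.m) : (context G cores s).Small N := by
  have := hB.m_lt
  exact ⟨by simp [context]; omega, hB.length_cores _, by simp [context]; omega,
    hB.length_core _⟩

theorem length_improve (s : List (Fin G.m) × List (Fin G.m)) :
    (improve G cores s).1.length + (improve G cores s).2.length = s.1.length + s.2.length := by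
  simp only [improve]
  split
  · rfl
  · split
    · rfl
    · rename_i b _
      have h := List.length_eq_length_filter_add (l := s.1) b.has
      simp only [List.length_reverse, List.length_append]
      omega

end Sizes

/-! ### Running time of choosing and buying a spider, and of the whole program. -/

namespace Run

variable {orc : Val → Val} {G : Network} {cores : List (DEdge G.n) → List (List (Fin G.n))}
  {c : Ctx G.n G.m} {env : Val} {N : ℕ}

def tInner (N : ℕ) : ℕ := N * ((2 * tProbe N + 100) + 100) + 100

theorem inner (hB : Bounded orc G cores N) (hc : c.Small N) (e : Fin G.m) :
    Run orc Fn.inner (Val.cons (encRec G e) (encCtx G c)) (encBool (inner G cores c e))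
      (tInner N) := by
  refine (call (any (N := N) (t := 2 * tProbe N + 100)
    (env := Val.cons (encRec G e) (encCtx G c)) encNodes _ _ hc.L fun C hC => ?_)).mono
    (by simp [Exp.steps, tInner]; omega)
  refine (push (callOf (probe hB hc C (hc.core _ hC) (G.edge e).1) (by rfl)) (iteOf
    (t := tProbe N + 70) (encNodes_ne_nil _) (by rfl) (fun h1 => ?_) fun h1 => ?_)).mono
    (by simp [Exp.steps]; omega)
  · refine (push (callOf (probe hB hc C (hc.core _ hC) (G.edge e).2) (by rfl)) (iteOf
      (t := 10) (encNodes_ne_nil _) (by rfl) (fun h2 => ?_) fun h2 => ?_)).mono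
      (by simp [Exp.steps]; omega)
    · exact exp_const (by simp [h1, h2]; rfl) (by simp [Exp.steps])
    · exact exp_const (by rw [not_not] at h2; simp [h2]; rfl) (by simp [Exp.steps])
  · exact exp_const (by rw [not_not] at h1; simp [h1]; rfl) (by simp [Exp.steps])

def tPrice (N : ℕ) : ℕ := (N * (20 + 20) + 30) + tInner N + 100

theorem price (hB : Bounded orc G cores N) (hc : c.Small N) (e : Fin G.m)
    (X : List (Label G.n G.m)) (hX : X.length ≤ N) :
    Run orc Fn.price (Val.cons (encRec G e) (Val.cons (encLabels G X) (encCtx G c)))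
      (Val.num (price G cores c e X)) (tPrice N) := by
  unfold EdgeCover.price
  refine (push (callOf (fold (N := N) (B := 20) (env := Val.nil) (encLabel G) Val.num
    (fun s en => s + en.dist) (fun _ => True) X (G.cost e) hX trivial fun x _ b _ =>
      ⟨trivial, exp_const (by rfl) (by simp [Exp.steps])⟩) (by rfl))
    (push (callOf (inner hB hc e) (by rfl)) (iteBool (t := 10) (by rfl) (fun h1 => ?_)
      fun h1 => ?_))).mono (by simp [Exp.steps, tPrice]; omega)
  · exact exp_const (by simp [h1]; rfl) (by simp)
  · exact exp_const (by simp [h1]; rfl) (by simp [Exp.steps])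

def tSpider (N : ℕ) : ℕ := tFeet N + tPrice N + 200

theorem spider (hB : Bounded orc G cores N) (hc : c.Small N) (e : Fin G.m) (θ : ℚ) :
    Run orc Fn.spider (Val.cons (encRec G e) (Val.cons (Val.num θ)
      (Val.cons (encList ((EdgeCover.table G cores c).map (encRow G))) (encCtx G c))))
      (encList ((spider G cores c e θ).map (encSpider G))) (tSpider N) := by
  unfold EdgeCover.spider
  refine (push (feet hB hc e θ) (iteOf (t := tPrice N + 100) (encLabels_ne_nil G _) (by rfl)
    (fun h1 => ?_) fun h1 => ?_)).mono (by simp [tSpider]; omega)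
  · rw [if_neg h1]
    exact (push (callOf (price hB hc e _ (length_feet hc e θ)) (by rfl))
      (exp_const (t := 30) (by rfl) (by simp [Exp.steps]))).mono (by simp [Exp.steps]; omega)
  · rw [not_not] at h1
    rw [if_pos h1]
    exact exp_const rfl (by simp [Exp.steps])

def tSpiders (N : ℕ) : ℕ :=
  N * ((N * ((N * ((tSpider N + 30) + 1 * 30 + 90) + 80) + N * 1 * 30 + 90) + 80)
    + N * (N * 1) * 30 + 90) + 80

theorem spiders (hB : Bounded orc G cores N) (hc : c.Small N) :
    Run orc Fn.spiders (Val.cons (encList ((EdgeCover.table G cores c).map (encRow G)))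
      (encCtx G c)) (encList ((spiders G cores c).map (encSpider G))) (tSpiders N) := by
  refine (call (flatMap (N := N) (K := N * (N * 1))
    (t := N * ((N * ((tSpider N + 30) + 1 * 30 + 90) + 80) + N * 1 * 30 + 90) + 80)
    (env := Val.cons (encList ((EdgeCover.table G cores c).map (encRow G))) (encCtx G c))
    (encRec G) (encSpider G) _ _ hc.R (fun e _ => ?_) fun e _ => ?_)).mono
    (by simp [Exp.steps, tSpiders]; omega)
  · refine (call (flatMap (N := N) (K := N * 1)
      (t := N * ((tSpider N + 30) + 1 * 30 + 90) + 80)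
      (env := Val.cons (encRec G e) (Val.cons (encList ((EdgeCover.table G cores c).map (encRow G)))
        (encCtx G c))) (encRow G) (encSpider G) _ _ (length_table hc) (fun p hp => ?_)
        fun p hp => ?_)).mono (by simp [Exp.steps]; omega)
    · have h2 := (mem_table.1 hp).2 ▸ length_labels hB (hc.core _ (mem_table.1 hp).1)
      refine (callOf (flatMap (N := N) (K := 1) (t := tSpider N + 30)
        (env := Val.cons (encRec G e) (Val.cons (encList ((EdgeCover.table G cores c).map (encRow G)))
          (encCtx G c))) (encLabel G) (encSpider G) _ _ h2 (fun en _ => ?_)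
          fun en _ => length_spider_le e en.dist) (by rfl)).mono (by simp [Exp.steps]; omega)
      exact (callOf (spider hB hc e en.dist) (by rfl)).mono (by simp [Exp.steps]; omega)
    · rw [List.length_reverse]
      exact length_flatMap_le ((mem_table.1 hp).2 ▸ length_labels hB (hc.core _ (mem_table.1 hp).1))
        fun en _ => length_spider_le e en.dist
  · rw [List.length_reverse]
    refine length_flatMap_le (length_table hc) fun p hp => ?_
    rw [List.length_reverse]
    exact length_flatMap_le ((mem_table.1 hp).2 ▸ length_labels hB (hc.core _ (mem_table.1 hp).1))
      fun en _ => length_spider_le e en.dist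

def tTimes (N : ℕ) : ℕ := N * (10 + 20) + 50

theorem times {α : Type*} (enc : α → Val) (q : ℚ) (l : List α) (hl : l.length ≤ N) :
    Run orc Fn.times (Val.cons (Val.num q) (Val.cons (encList (l.map enc)) env))
      (Val.num (l.length * q)) (tTimes N) := by
  have h : ∀ a : ℚ, l.foldl (fun s _ => s + q) a = a + l.length * q := by
    clear hl
    induction l with
    | nil => simp
    | cons x l ih => intro a; rw [List.foldl_cons, ih]; push_cast [List.length_cons]; ring
  rw [← zero_add ((l.length : ℚ) * q), ← h]
  exact (call (fold (N := N) (B := 10) (env := Val.cons (Val.num q) Val.nil) enc Val.num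
    (fun s _ => s + q) (fun _ => True) l 0 hl trivial fun x _ b _ =>
      ⟨trivial, exp_const (by rfl) (by simp [Exp.steps])⟩)).mono
      (by simp [Exp.steps, tTimes]; omega)

def tLess (N : ℕ) : ℕ := 2 * tTimes N + 100

theorem lessDense {s t : Spider G.n G.m} (hs : s.Small N) (ht : t.Small N) :
    Run orc Fn.lessDense (Val.cons (encSpider G s) (Val.cons (encSpider G t) env))
      (encBool (decide (s.density < t.density))) (tLess N) := by
  refine (push (callOf (times (N := N) (env := Val.nil) (encLabel G) s.price t.feet ht.length_feet)
    (by rfl)) (push (callOf (times (N := N) (env := Val.nil) (encLabel G) t.price s.feet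
      hs.length_feet) (by rfl)) (exp_const (t := 10) ?_ (by simp [Exp.steps])))).mono
    (by simp [Exp.steps, tLess]; omega)
  rw [decide_eq_decide.2 (Spider.density_lt hs.feet_ne ht.feet_ne)]
  exact Val.num_lt _ _

def tHas (N : ℕ) : ℕ := N * ((N * (20 + 100) + 70) + 100) + 150

theorem idx_eq (a b : Fin G.m) :
    (Val.num ((a : ℕ) : ℚ)).eq (Val.num ((b : ℕ) : ℚ)) = encBool (decide (a = b)) := by
  simp [Val.num_eq, Fin.ext_iff]

theorem has {s : Spider G.n G.m} (hs : s.Small N) (e : Fin G.m) :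
    Run orc Fn.has (Val.cons (encRec G e) (Val.cons (encSpider G s) env)) (encBool (s.has e))
      (tHas N) := by
  unfold Spider.has
  refine (iteBool (t := N * ((N * (20 + 100) + 70) + 100) + 100) (by exact idx_eq s.edge e)
    (fun h => ?_) fun h => ?_).mono (by simp [Exp.steps, tHas]; omega)
  · rw [h]
    exact exp_const rfl (by simp [Exp.steps])
  · rw [h, Bool.false_or]
    refine (callOf (any (N := N) (t := N * (20 + 100) + 70) (env := Val.cons (encRec G e) Val.nil)
      (encLabel G) _ _ hs.length_feet fun en hen => ?_) (by rfl)).mono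
      (by simp [Exp.steps]; omega)
    exact (callOf (any (N := N) (t := 20) (env := Val.cons (encRec G e) Val.nil) (encRec G) _ _
      (hs.path en hen) fun e' _ => exp_const (by exact idx_eq e' e) (by simp [Exp.steps]))
      (by rfl)).mono (by simp [Exp.steps]; omega)

def tImprove (N : ℕ) : ℕ :=
  (N * (10 + 150) + 50) + tAsk N N + tTable N + tSpiders N +
    (N * (N * (N * 1)) * (tLess N + 100) + 50) +
    (N * ((tHas N + 30) + 150) + 50) + (N * (tHas N + 150) + 50) + (N * 30 + 30) + 500

theorem improve (hB : Bounded orc G cores N) (s : List (Fin G.m) × List (Fin G.m))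
    (hs : s.1.length + s.2.length ≤ G.m) :
    Run orc Fn.improve (Val.cons (encPurchase G s) (Val.cons (encNodes (List.finRange G.n))
      (Val.cons (encRecs G (List.finRange G.m).reverse) env)))
      (encPurchase G (improve G cores s)) (tImprove N) := by
  have hc := context_small hB hs
  have hm := hB.m_lt
  have hlen : (EdgeCover.spiders G cores (context G cores s)).length ≤ N * (N * (N * 1)) := by
    rw [EdgeCover.spiders, List.length_reverse]
    refine length_flatMap_le hc.R fun e _ => ?_
    rw [List.length_reverse]
    refine length_flatMap_le (length_table hc) fun p hp => ?_
    rw [List.length_reverse]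
    exact length_flatMap_le ((mem_table.1 hp).2 ▸ length_labels hB (hc.core _ (mem_table.1 hp).1))
      fun en _ => length_spider_le e en.dist
  simp only [EdgeCover.improve]
  refine (push (callOf (map (N := N) (t := 10) (env := Val.nil) (encRec G) encEdge G.edge s.2
    (by omega) fun e _ => exp_const (by rfl) (by simp [Exp.steps])) (by rfl))
    (push (callOf (ask_cores hB (context G cores s).Q hc.Q) (by rfl)) (iteOf
      (t := tTable N + tSpiders N + (N * (N * (N * 1)) * (tLess N + 100) + 50) +
    (N * ((tHas N + 30) + 150) + 50) + (N * (tHas N + 150) + 50) + (N * 30 + 30) + 400)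
      (encNodes_ne_nil ((context G cores s).L.headD [])) (by exact head_encCores _) (fun h1 => ?_) fun h1 => ?_))).mono
      (by simp [Exp.steps, tImprove]; omega)
  · simp only [if_neg h1]
    refine (push (exp _ _) (push (callOf (table hB hc) (by rfl)) (push
      (callOf (spiders hB hc) (by rfl)) (push (callOf (argmin (N := N * (N * (N * 1)))
      (t := tLess N) (env := Val.nil) (encSpider G) Spider.density _ hlen (encSpider_ne_nil G)
      fun x hx y hy => lessDense (small_of_mem_spiders hB hc hx) (small_of_mem_spiders hB hc hy))
      (by rfl)) (iteOf (t := (N * ((tHas N + 30) + 150) + 50) + (N * (tHas N + 150) + 50) +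
      (N * 30 + 30) + 200) (encOption_ne_nil (encSpider_ne_nil G) _) (by rfl)
      (fun h2 => ?_) fun h2 => ?_))))).mono (by simp [Exp.steps]; omega)
    · obtain ⟨b, hb⟩ := Option.isSome_iff_exists.1 h2
      have hbs := small_of_mem_spiders hB hc (List.argmin_mem hb)
      simp only [hb]
      have hf : (s.1.filter b.has).reverse.length ≤ N := by
        rw [List.length_reverse]
        exact (List.length_filter_le _ _).trans (by omega)
      have hra := reverseAppend (orc := orc) (env := Val.nil) (encRec G)
        (s.1.filter b.has).reverse s.2 hf
      rw [List.reverse_reverse] at hra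
      refine (push (callOf (filter (N := N) (t := tHas N + 30)
        (env := Val.cons (encSpider G b) Val.nil) (encRec G) (fun e => !b.has e) s.1 (by omega)
        fun e _ => (push (has hbs e) (iteBool (t := 10) (by rfl) (fun h3 => ?_)
          fun h3 => ?_)).mono (by simp)) (by rfl))
        (push (callOf (filter (N := N) (t := tHas N)
        (env := Val.cons (encSpider G b) Val.nil) (encRec G) b.has s.1 (by omega)
        fun e _ => has hbs e) (by rfl)) (push (callOf hra (by rfl)) (exp_const (t := 20) (by rfl)
          (by simp [Exp.steps]))))).mono (by simp [Exp.steps]; omega)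
      · exact exp_const (by rw [h3]; rfl) (by simp [Exp.steps])
      · exact exp_const (by rw [h3]; rfl) (by simp [Exp.steps])
    · have : (EdgeCover.spiders G cores (context G cores s)).argmin Spider.density = none := by
        simpa using h2
      simp only [this]
      exact exp_const (by rfl) (by simp)
  · rw [not_not] at h1
    simp only [if_pos h1]
    exact exp_const (by rfl) (by simp)

def tIota (N : ℕ) : ℕ := N * 30 + 50

theorem iota (n : ℕ) (hn : n ≤ N) :
    Run orc Fn.iota (Val.num n) (encNodes (List.finRange n)) (tIota N) := by
  have loop (k : ℕ) (j : ℕ) : ∀ (s : State) (acc : List Val), s k = Val.num j →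
      s (k + 1) = encList acc → ∃ t' s', t' ≤ j * 30 + 10 ∧
        Exec orc (Prog.loop (.lt (.num 0) (.var k))
          (Prog.seq (Prog.assign (k + 1) (.cons (.var k) (.var (k + 1))))
          (Prog.assign k (.sub (.var k) (.num 1))))) s t' s' ∧
        s' (k + 1) = encList ((List.range j).map (fun i : ℕ => Val.num ((i : ℚ) + 1)) ++ acc) ∧
        ∀ i < k, s' i = s i := by
    induction j with
    | zero =>
      intro s acc h0 h1
      exact ⟨_, s, by simp [Exp.steps], Exec.loop_done (by simp [Exp.eval, h0, Val.lt]),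
        by simpa using h1, fun _ _ => rfl⟩
    | succ j ih =>
      intro s acc h0 h1
      let s₂ := Function.update (Function.update s (k + 1)
        (encList (Val.num ((j : ℚ) + 1) :: acc))) k (Val.num j)
      obtain ⟨t', s', ht, he, h2, h3⟩ := ih s₂ (Val.num ((j : ℚ) + 1) :: acc) (by simp [s₂])
        (by simp [s₂])
      have hbody := Exec.seq (Exec.assign (orc := orc) (k + 1) (.cons (.var k) (.var (k + 1))) s)
        (Exec.assign k (.sub (.var k) (.num 1)) _)
      have hs₂ : Function.update (Function.update s (k + 1)
          ((Exp.cons (.var k) (.var (k + 1))).eval s)) k ((Exp.sub (.var k) (.num 1)).eval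
          (Function.update s (k + 1) ((Exp.cons (.var k) (.var (k + 1))).eval s))) = s₂ := by
        simp [s₂, Exp.eval, h0, h1, Val.sub, encList]
      rw [hs₂] at hbody
      refine ⟨_, s', ?_, Exec.loop_step ?_ hbody he, ?_, fun i hi => ?_⟩
      · simp only [Exp.steps]; omega
      · have : (0 : ℚ) < (j : ℚ) + 1 := by positivity
        simp [Exp.eval, h0, Val.lt, this]
      · rw [h2, List.range_succ]; simp
      · rw [h3 i hi]
        simp only [s₂]
        rw [Function.update_of_ne (by omega), Function.update_of_ne (by omega)]
  intro k s hs
  obtain ⟨t', s', ht, he, h1, h2⟩ := loop k n (Function.update s (k + 1) Val.nil) [] (by simp [hs])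
    (by simp [encList])
  refine ⟨_, Function.update s' k (s' (k + 1)), ?_, Exec.seq (Exec.assign _ _ _)
    (Exec.seq he (Exec.assign _ _ _)), ?_, fun i hi => ?_⟩
  · simp only [Exp.steps, tIota]; omega
  · rw [Function.update_self, h1, List.append_nil, encNodes, ← List.map_coe_finRange_eq_range,
      List.map_map]
    rfl
  · rw [Function.update_of_ne (by omega), h2 i hi, Function.update_of_ne (by omega)]

def tMain (N : ℕ) : ℕ :=
  tIota N + (N * (30 + 20) + 30) + (N * ((tImprove N + 20) + 20) + 30) + (N * (10 + 150) + 50) + 500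

theorem foldl_improve_length (l : List (Fin G.m)) (s : List (Fin G.m) × List (Fin G.m)) :
    (l.foldl (fun s _ => EdgeCover.improve G cores s) s).1.length +
      (l.foldl (fun s _ => EdgeCover.improve G cores s) s).2.length = s.1.length + s.2.length := by
  induction l generalizing s with
  | nil => rfl
  | cons x l ih => rw [List.foldl_cons, ih, length_improve]

theorem main (hB : Bounded orc G cores N) :
    Run orc Fn.main (encNetwork G)
      (encList ((solution G cores).reverse.map fun e : Fin G.m => Val.num ((e : ℕ) : ℚ))) (tMain N) := by
  have hm := hB.m_lt
  have hn := hB.n_lt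
  have hrec := fold_prefix (N := N) (B := 30) (env := Val.nil) (orc := orc)
    (body := Fn.exp (.cons (.add (.head (.arg 1)) (.num 1))
          (.cons (.cons (.head (.arg 1)) (.arg 0)) (.tail (.arg 1)))))
    (fun e : Fin G.m => Val.cons (encEdge (G.edge e)) (Val.num (G.cost e)))
    (fun l : List (Fin G.m) => Val.cons (Val.num (l.length : ℚ)) (encRecs G l))
    (fun l e => e :: l) (List.finRange G.m) [] (by simp; omega) fun l₁ x l₂ h => by
      -- The accumulator carries the number of records made so far, which is the index of the next
      -- edge.
      have hx : (x : ℕ) = l₁.length := by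
        have h1 : l₁.length < (List.finRange G.m).length := by rw [h]; simp
        have h2 : (List.finRange G.m)[l₁.length] = x := by simp [h]
        rw [← h2]; simp
      refine exp_const ?_ (by simp [Exp.steps])
      rw [foldl_cons_eq]
      simp only [List.append_nil, List.length_reverse, List.length_cons]
      rw [Nat.cast_succ]
      simp [Exp.ev, Exp.eval, Exp.arg, Exp.drop, Val.head, Val.tail, Val.add, encRecs, encRec,
        encList, hx]
  rw [foldl_cons_eq, List.append_nil] at hrec
  have himp := fold (N := N) (B := tImprove N + 20) (orc := orc)
    (body := Fn.call (.drop 1) Fn.improve)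
    (env := Val.cons (encNodes (List.finRange G.n))
      (Val.cons (encRecs G (List.finRange G.m).reverse) Val.nil))
    (encRec G) (encPurchase G) (fun s _ => EdgeCover.improve G cores s)
    (fun s => s.1.length + s.2.length = G.m)
    (List.finRange G.m).reverse ((List.finRange G.m).reverse, []) (by simp; omega) (by simp)
    fun x _ s hs => ⟨(length_improve s).trans hs, (callOf (improve hB s hs.le) (by rfl)).mono
      (by simp; omega)⟩
  have hlen : (solution G cores).length ≤ N := by
    have := foldl_improve_length (cores := cores) (List.finRange G.m).reverse
      ((List.finRange G.m).reverse, [])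
    simp only [List.length_reverse, List.length_finRange, List.length_nil] at this
    unfold solution
    omega
  have hmap := map (N := N) (t := 10) (env := Val.nil) (orc := orc) (encRec G)
    (fun e : Fin G.m => Val.num ((e : ℕ) : ℚ)) id (solution G cores) hlen
    (fF := Fn.exp (.head (.arg 0))) fun e _ => exp_const (by rfl) (by simp [Exp.steps])
  rw [List.map_id] at hmap
  exact (push (callOf (iota (N := N) G.n (by omega)) (by rfl)) (push (callOf hrec (by
      simp [Exp.ev, Exp.eval, Exp.drop, encNetwork, Val.tail, List.ofFn_eq_map, encRecs, encList]))
    (push (callOf himp (by rfl)) (callOf hmap (by rfl))))).mono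
      (by simp [Exp.steps, tMain]; omega)

end Run

/-! ### Families of sets -/

section Families

variable {n : ℕ} {T : Finset (Fin n)} {F : Set (Finset (Fin n))}

/-- A `T`-intersecting family, all of whose members meet `T`. -/
structure IntersectingFamily (T : Finset (Fin n)) (F : Set (Finset (Fin n))) : Prop where
  meets : ∀ A ∈ F, (A ∩ T).Nonempty
  inter : ∀ A ∈ F, ∀ B ∈ F, (A ∩ B ∩ T).Nonempty → A ∩ B ∈ F
  union : ∀ A ∈ F, ∀ B ∈ F, (A ∩ B ∩ T).Nonempty → A ∪ B ∈ F

theorem exists_core {A : Finset (Fin n)} (hA : A ∈ F) : ∃ C, IsCore F C ∧ C ⊆ A := by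
  obtain ⟨C, hC, h⟩ := exists_minimal_le_of_wellFoundedLT (fun A => A ∈ F) A hA
  exact ⟨C, h, hC⟩

/-- `A` is a member of `F` that contains no core except `C`. -/
structure Halo (F : Set (Finset (Fin n))) (C A : Finset (Fin n)) : Prop where
  mem : A ∈ F
  core_subset : C ⊆ A
  unique : ∀ C', IsCore F C' → C' ⊆ A → C' = C

/-- Some member of the halo family of `C` contains `u`. -/
def InHalo (F : Set (Finset (Fin n))) (C : Finset (Fin n)) (u : Node n) : Prop :=
  ∃ A, Halo F C A ∧ u ∈ lift A

theorem IsCore.halo {C : Finset (Fin n)} (hC : IsCore F C) : Halo F C C :=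
  ⟨hC.prop, subset_rfl, fun _ h h' => hC.eq_of_le h.prop h'⟩

/-- Any core inside `A` lies inside `B` and hence is `C`; so a member below a halo contains `C`
automatically. -/
theorem Halo.of_subset {A B C : Finset (Fin n)} (hB : Halo F C B) (hA : A ∈ F) (h : A ⊆ B) :
    Halo F C A := by
  obtain ⟨C', hC', h'⟩ := exists_core hA
  obtain rfl := hB.unique C' hC' (h'.trans h)
  exact ⟨hA, h', fun C'' h1 h2 => hB.unique C'' h1 (h2.trans h)⟩

namespace IntersectingFamily

/-- The intersection is a member below the core, hence all of it. -/
theorem core_subset (hF : IntersectingFamily T F) {A C : Finset (Fin n)} (hC : IsCore F C)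
    (hA : A ∈ F) (h : (C ∩ A ∩ T).Nonempty) : C ⊆ A :=
  (hC.le_of_le (hF.inter C hC.prop A hA h) Finset.inter_subset_left).trans
    Finset.inter_subset_right

theorem core_eq (hF : IntersectingFamily T F) {C D : Finset (Fin n)} (hC : IsCore F C)
    (hD : IsCore F D) (h : (C ∩ D ∩ T).Nonempty) : C = D :=
  (hF.core_subset hC hD.prop h).antisymm
    (hF.core_subset hD hC.prop (by rwa [Finset.inter_comm D C]))

theorem nonempty_inter (hF : IntersectingFamily T F) {A B C : Finset (Fin n)} (hC : IsCore F C)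
    (hA : C ⊆ A) (hB : C ⊆ B) : (A ∩ B ∩ T).Nonempty := by
  obtain ⟨t, ht⟩ := hF.meets C hC.prop
  simp only [Finset.mem_inter] at ht
  exact ⟨t, by simp [hA ht.1, hB ht.1, ht.2]⟩

theorem halo_inter (hF : IntersectingFamily T F) {A B C : Finset (Fin n)} (hB : Halo F C B)
    (hA : A ∈ F) (h : (A ∩ B ∩ T).Nonempty) : Halo F C (A ∩ B) :=
  hB.of_subset (hF.inter A hA B hB.mem h) Finset.inter_subset_right

/-- A terminal of a core inside the union lies in one of the two parts, and then the whole core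
does, by `core_subset`. -/
theorem halo_union (hF : IntersectingFamily T F) {A B C : Finset (Fin n)} (hC : IsCore F C)
    (hA : Halo F C A) (hB : Halo F C B) : Halo F C (A ∪ B) := by
  refine ⟨hF.union A hA.mem B hB.mem (hF.nonempty_inter hC hA.core_subset hB.core_subset),
    hA.core_subset.trans Finset.subset_union_left, fun D hD h => ?_⟩
  obtain ⟨t, ht⟩ := hF.meets D hD.prop
  obtain ⟨htD, htT⟩ := Finset.mem_inter.1 ht
  rcases Finset.mem_union.1 (h htD) with h' | h'
  · exact hA.unique D hD (hF.core_subset hD hA.mem ⟨t, by simp [htD, htT, h']⟩)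
  · exact hB.unique D hD (hF.core_subset hD hB.mem ⟨t, by simp [htD, htT, h']⟩)

/-- The intersection is a member, and a core inside it must be the core of both halos.
Contrapositively, halos of different cores share no terminal; this is how quasi-bipartiteness
becomes effective. -/
theorem halo_core_eq (hF : IntersectingFamily T F) {A B C D : Finset (Fin n)}
    (hA : Halo F C A) (hB : Halo F D B) (h : (A ∩ B ∩ T).Nonempty) : C = D := by
  obtain ⟨E, hE, hEs⟩ := exists_core (hF.inter A hA.mem B hB.mem h)
  rw [← hA.unique E hE (hEs.trans Finset.inter_subset_left),
    ← hB.unique E hE (hEs.trans Finset.inter_subset_right)]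

/-- The halo family of a core has a largest member. -/
theorem exists_greatest_halo (hF : IntersectingFamily T F) {C : Finset (Fin n)}
    (hC : IsCore F C) : ∃ M, Halo F C M ∧ ∀ u : Node n, InHalo F C u → u ∈ lift M := by
  obtain ⟨M, hM, h⟩ := (Set.toFinite {A | Halo F C A}).exists_maximal ⟨C, hC.halo⟩
  refine ⟨M, hM, fun u ⟨A, hA, hu⟩ => ?_⟩
  have := h (hF.halo_union hC hM hA) Finset.subset_union_left
  exact Finset.map_subset_map.2 (Finset.subset_union_right.trans this) hu

/-- There is a least member of the halo family of a core containing a given node. -/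
theorem exists_least_halo (hF : IntersectingFamily T F) {C : Finset (Fin n)} (hC : IsCore F C)
    {u : Node n} (hu : InHalo F C u) :
    ∃ D, Halo F C D ∧ u ∈ lift D ∧ ∀ B, Halo F C B → u ∈ lift B → D ⊆ B := by
  obtain ⟨A, hA, huA⟩ := hu
  obtain ⟨D, hD, h⟩ := (Set.toFinite {A | Halo F C A ∧ u ∈ lift A}).exists_minimal ⟨A, hA, huA⟩
  refine ⟨D, hD.1, hD.2, fun B hB huB => ?_⟩
  have h1 : Halo F C (D ∩ B) :=
    hF.halo_inter hB hD.1.mem (hF.nonempty_inter hC hD.1.core_subset hB.core_subset)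
  have h2 : u ∈ lift (D ∩ B) := by
    have := hD.2
    simp only [lift, Finset.mem_map, Finset.mem_inter] at this huB ⊢
    obtain ⟨x, hx, rfl⟩ := this
    obtain ⟨y, hy, hxy⟩ := huB
    obtain rfl : y = x := by simpa using hxy
    exact ⟨y, ⟨hx, hy⟩, rfl⟩
  exact (h ⟨h1, h2⟩ Finset.inter_subset_left).trans Finset.inter_subset_right

end IntersectingFamily

end Families

/-! ### Residual functions -/

section Residual

variable {n : ℕ} {T : Finset (Fin n)} {f : Finset (Fin n) → ℤ}

theorem some_mem_lift {A : Finset (Fin n)} {x : Fin n} : (some x : Node n) ∈ lift A ↔ x ∈ A := by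
  simp [lift]

theorem none_notMem_lift {A : Finset (Fin n)} : (none : Node n) ∉ lift A := by
  simp [lift]

/-- The edge `e` enters `A`. -/
def Enters (e : DEdge n) (A : Finset (Fin n)) : Prop := e.2 ∈ lift A ∧ e.1 ∉ lift A

theorem inDeg_add (I J : Multiset (DEdge n)) (A : Finset (Fin n)) :
    inDeg (I + J) A = inDeg I A + inDeg J A := Multiset.countP_add _ _ _

theorem inDeg_eq_zero {I : Multiset (DEdge n)} {A : Finset (Fin n)} :
    inDeg I A = 0 ↔ ∀ e ∈ I, ¬ Enters e A := Multiset.countP_eq_zero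

theorem inDeg_submodular (I : Multiset (DEdge n)) (A B : Finset (Fin n)) :
    inDeg I (A ∩ B) + inDeg I (A ∪ B) ≤ inDeg I A + inDeg I B := by
  induction I using Multiset.induction_on with
  | empty => simp [inDeg]
  | cons e I ih =>
    have h : inDeg {e} (A ∩ B) + inDeg {e} (A ∪ B) ≤ inDeg {e} A + inDeg {e} B := by
      simp only [inDeg, ← Multiset.cons_zero, Multiset.countP_cons, Multiset.countP_zero]
      have hu (x : Node n) : x ∈ lift (A ∪ B) ↔ x ∈ lift A ∨ x ∈ lift B := by
        simp only [lift, Finset.map_union, Finset.mem_union]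
      have hi (x : Node n) : x ∈ lift (A ∩ B) ↔ x ∈ lift A ∧ x ∈ lift B := by
        simp only [lift, Finset.map_inter, Finset.mem_inter]
      simp only [hu, hi]
      by_cases h1 : e.1 ∈ lift A <;> by_cases h2 : e.1 ∈ lift B <;>
        by_cases h3 : e.2 ∈ lift A <;> by_cases h4 : e.2 ∈ lift B <;> simp [h1, h2, h3, h4]
    rw [← Multiset.singleton_add]
    simp only [inDeg_add]
    omega

theorem le_maxVal (f : Finset (Fin n) → ℤ) (A : Finset (Fin n)) : f A ≤ maxVal f :=
  Finset.le_sup' f (Finset.mem_univ A)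

theorem exists_eq_maxVal (f : Finset (Fin n) → ℤ) : ∃ A, A ∈ maxFamily f := by
  obtain ⟨A, -, h⟩ := Finset.exists_mem_eq_sup' Finset.univ_nonempty f
  exact ⟨A, h.symm⟩

theorem residual_le_residual (I J : Multiset (DEdge n)) (A : Finset (Fin n)) :
    residual f (I + J) A ≤ residual f J A := by
  simp only [residual, inDeg_add]
  push_cast
  omega

theorem maxVal_residual_le (I J : Multiset (DEdge n)) :
    maxVal (residual f (I + J)) ≤ maxVal (residual f J) := by
  obtain ⟨A, hA⟩ := exists_eq_maxVal (residual f (I + J))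
  rw [← show residual f (I + J) A = _ from hA]
  exact (residual_le_residual I J A).trans (le_maxVal _ _)

theorem maxVal_residual_nonneg (I : Multiset (DEdge n)) : 0 ≤ maxVal (residual f I) :=
  (le_max_right _ _ : 0 ≤ residual f I ∅).trans (le_maxVal _ _)

/-- If some member of the family is not entered by `S`, then adding `S` does not change the maximum,
and leaves the members not entered by `S`. -/
theorem maxFamily_residual_add {I S : Multiset (DEdge n)} (hpos : 0 < maxVal (residual f I))
    {A : Finset (Fin n)} (hA : A ∈ maxFamily (residual f I)) (hS : inDeg S A = 0) :
    maxVal (residual f (S + I)) = maxVal (residual f I) ∧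
      ∀ B, B ∈ maxFamily (residual f (S + I)) ↔ B ∈ maxFamily (residual f I) ∧ inDeg S B = 0 := by
  have h1 : residual f (S + I) A = residual f I A := by
    simp [residual, inDeg_add, hS]
  have h2 : maxVal (residual f (S + I)) = maxVal (residual f I) := by
    refine (maxVal_residual_le S I).antisymm ?_
    rw [← show residual f I A = _ from hA, ← h1]
    exact le_maxVal _ _
  refine ⟨h2, fun B => ?_⟩
  have h3 := le_maxVal (residual f I) B
  simp only [maxFamily, Set.mem_ofPred_eq, h2]
  simp only [residual, inDeg_add] at h3 hpos ⊢
  push_cast at h3 ⊢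
  omega

theorem pos_of_mem_maxFamily {I : Multiset (DEdge n)} (hpos : 0 < maxVal (residual f I))
    {A : Finset (Fin n)} (hA : A ∈ maxFamily (residual f I)) :
    f A = maxVal (residual f I) + inDeg I A ∧ 0 < f A := by
  have : residual f I A = _ := hA
  simp only [residual] at this hpos ⊢
  omega

/-- By submodularity of the in-degree, `f - d_I` inherits the supermodular inequality. For two
maximisers both sets on the right-hand side must again be maximisers. Positivity of the level makes
the truncation at `0` harmless and makes `f` positive on the family. -/
theorem intersectingFamily_residual (hsup : PosIntersectingSupermodular T f)
    (hT : ∀ A, 0 < f A → (A ∩ T).Nonempty) {I : Multiset (DEdge n)}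
    (hpos : 0 < maxVal (residual f I)) : IntersectingFamily T (maxFamily (residual f I)) := by
  have key : ∀ A ∈ maxFamily (residual f I), ∀ B ∈ maxFamily (residual f I),
      (A ∩ B ∩ T).Nonempty → A ∩ B ∈ maxFamily (residual f I) ∧
        A ∪ B ∈ maxFamily (residual f I) := by
    intro A hA B hB h
    obtain ⟨a1, a2⟩ := pos_of_mem_maxFamily hpos hA
    obtain ⟨b1, b2⟩ := pos_of_mem_maxFamily hpos hB
    have h1 := hsup A B h a2 b2
    have h2 := inDeg_submodular I A B
    have h3 := le_maxVal (residual f I) (A ∩ B)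
    have h4 := le_maxVal (residual f I) (A ∪ B)
    simp only [maxFamily, Set.mem_ofPred_eq]
    generalize maxVal (residual f I) = k at *
    simp only [residual] at *
    omega
  exact ⟨fun A hA => hT A (pos_of_mem_maxFamily hpos hA).2, fun A hA B hB h => (key A hA B hB h).1,
    fun A hA B hB h => (key A hA B hB h).2⟩

end Residual

/-! ### Probing halo families -/

theorem mem_iff {n : ℕ} {u : Node n} {A : List (Fin n)} :
    mem u A = true ↔ u ∈ lift A.toFinset := by
  simp [mem, lift]

theorem notSub_iff {n : ℕ} {A B : List (Fin n)} :
    notSub A B = false ↔ A.toFinset ⊆ B.toFinset := by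
  have h (x : Fin n) : (mem (some x) B = true) ↔ x ∈ B := by rw [mem_iff, some_mem_lift]; simp
  simp [notSub, Finset.subset_iff, h]

theorem goodCore_iff {n : ℕ} {L : List (List (Fin n))} {C A : List (Fin n)} {u : Node n} :
    goodCore L C u A = true ↔ u ∈ lift A.toFinset ∧ C.toFinset ⊆ A.toFinset ∧
      ∀ C' ∈ L, C'.toFinset ⊆ A.toFinset → C'.toFinset ⊆ C.toFinset := by
  simp only [goodCore, Bool.and_eq_true, mem_iff, Bool.not_eq_true', notSub_iff, List.any_eq_false,
    not_and, Bool.not_eq_true]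

/-- `cores` lists the cores of the residual functions of `f`. -/
structure CoreLists {n : ℕ} (f : Finset (Fin n) → ℤ)
    (cores : List (DEdge n) → List (List (Fin n))) : Prop where
  nodup : ∀ I, ∀ C ∈ cores I, C.Nodup
  nodup_map : ∀ I, ((cores I).map List.toFinset).Nodup
  mem_iff : ∀ I A, A ∈ (cores I).map List.toFinset ↔
    IsCore (maxFamily (residual f (I : Multiset (DEdge n)))) A

theorem mem_isolating {n : ℕ} {C A : List (Fin n)} {e : DEdge n} :
    e ∈ isolating C A ↔ ∃ y, (y ∈ A ∧ ∃ x ∈ A, (y ∈ C → x ∈ C) ∧ (some x, some y) = e) ∨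
      (y ∉ A ∧ e = (none, some y)) := by
  have h (x : Fin n) (B : List (Fin n)) : (mem (some x) B = true) ↔ x ∈ B := by
    rw [mem_iff, some_mem_lift]; simp
  simp only [isolating, List.mem_reverse, List.mem_flatMap, List.mem_finRange, true_and, h]
  refine exists_congr fun y => ?_
  by_cases hy : y ∈ A
  · simp only [hy, if_true, List.mem_reverse, List.mem_map, List.mem_filter, Bool.or_eq_true,
      Bool.not_eq_true', ← Bool.not_eq_true, h, true_and, not_true, false_and, or_false, and_assoc,
      ← imp_iff_not_or]
  · simp [hy]

theorem not_enters_of_mem_isolating {n : ℕ} {C A : List (Fin n)} {e : DEdge n}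
    (he : e ∈ isolating C A) : ¬ Enters e A.toFinset ∧
      (C.toFinset ⊆ A.toFinset → ¬ Enters e C.toFinset) := by
  obtain ⟨y, ⟨hy, x, hx, h, rfl⟩ | ⟨hy, rfl⟩⟩ := mem_isolating.1 he
  · simp only [Enters, some_mem_lift, List.mem_toFinset]
    exact ⟨fun h' => h'.2 hx, fun _ h' => h'.2 (h h'.1)⟩
  · simp only [Enters, some_mem_lift, List.mem_toFinset]
    refine ⟨fun h' => hy h'.1, fun hCA h' => hy ?_⟩
    simpa using hCA (by simpa using h'.1)

/-- A node of `B` outside `A` receives an edge from `r`; a node of `B` outside `C` receives edges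
from all of `A`, forcing `B = A`; a node of `C` receives edges from all of `C`, which forces `B = C`
when `B` lies in `C`. -/
theorem exists_enters_of_isolating {n : ℕ} {C A : List (Fin n)} {B : Finset (Fin n)}
    (hB : B.Nonempty) (hC : B ≠ C.toFinset) (hA : B ≠ A.toFinset) (hCA : C.toFinset ⊆ A.toFinset) :
    ∃ e ∈ isolating C A, Enters e B := by
  by_contra! hcon
  have h0 : ∀ y ∈ B, y ∈ A := fun y hy => by
    by_contra hyA
    exact hcon (none, some y) (mem_isolating.2 ⟨y, Or.inr ⟨hyA, rfl⟩⟩)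
      ⟨some_mem_lift.2 hy, none_notMem_lift⟩
  have h1 : ∀ y ∈ B, ∀ x ∈ A, (y ∈ C → x ∈ C) → x ∈ B := fun y hy x hx h => by
    by_contra hxB
    exact hcon (some x, some y) (mem_isolating.2 ⟨y, Or.inl ⟨h0 y hy, x, hx, h, rfl⟩⟩)
      ⟨some_mem_lift.2 hy, fun h' => hxB (some_mem_lift.1 h')⟩
  by_cases h2 : ∃ y ∈ B, y ∉ C
  · obtain ⟨y, hy, hyC⟩ := h2
    refine hA (Finset.Subset.antisymm (fun z hz => by simpa using h0 z hz) fun z hz => ?_)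
    exact h1 y hy z (by simpa using hz) fun h => absurd h hyC
  · push Not at h2
    obtain ⟨y, hy⟩ := hB
    refine hC (Finset.Subset.antisymm (fun z hz => by simpa using h2 z hz) fun z hz => ?_)
    exact h1 y hy z (by simpa using hCA hz) fun _ => by simpa using hz

theorem inDeg_heavy_eq_zero {G : Network} {C A : List (Fin G.n)} {B : Finset (Fin G.n)}
    (h : ∀ e ∈ isolating C A, ¬ Enters e B) :
    inDeg ((heavy G C A).reverse : Multiset (DEdge G.n)) B = 0 := by
  refine inDeg_eq_zero.2 fun e he => h e ?_
  simp only [heavy, List.reverse_reverse, Multiset.mem_coe, List.mem_flatMap] at he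
  exact he.choose_spec.2

theorem le_inDeg_heavy {G : Network} {C A : List (Fin G.n)} {B : Finset (Fin G.n)}
    (h : ∃ e ∈ isolating C A, Enters e B) :
    G.m ≤ inDeg ((heavy G C A).reverse : Multiset (DEdge G.n)) B := by
  have h1 : 0 < List.countP (fun e : DEdge G.n => decide (e.2 ∈ lift B ∧ e.1 ∉ lift B))
      (isolating C A) := by
    rw [List.countP_pos_iff]
    obtain ⟨e, he, h'⟩ := h
    exact ⟨e, he, decide_eq_true h'⟩
  rw [inDeg, Multiset.coe_countP, heavy, List.reverse_reverse, List.countP_flatMap]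
  have h2 := List.card_nsmul_le_sum ((List.finRange G.m).reverse.map
    (List.countP (fun e : DEdge G.n => decide (e.2 ∈ lift B ∧ e.1 ∉ lift B)) ∘
      fun _ => isolating C A)) 1 fun x hx => by
      obtain ⟨y, -, rfl⟩ := List.mem_map.1 hx
      exact h1
  simpa using h2

/-- The assumptions on `f`, the consequence `f ≤ |E|` of the existence of a cover, and the
replies of the oracle. -/
structure Problem (G : Network) (f : Finset (Fin G.n) → ℤ)
    (cores : List (DEdge G.n) → List (List (Fin G.n))) : Prop where
  super : PosIntersectingSupermodular G.T f
  meets : ∀ A, 0 < f A → (A ∩ G.T).Nonempty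
  quasi : G.QuasiBipartite f
  le_card : ∀ A, f A ≤ G.m
  lists : CoreLists f cores

/-- The sets where the residual function of the edges bought is largest. -/
abbrev Ctx.family {n m : ℕ} (f : Finset (Fin n) → ℤ) (c : Ctx n m) : Set (Finset (Fin n)) :=
  maxFamily (residual f (c.Q : Multiset (DEdge n)))

/-- The maximum of the residual function of the edges bought. -/
abbrev Ctx.level {n m : ℕ} (f : Finset (Fin n) → ℤ) (c : Ctx n m) : ℤ :=
  maxVal (residual f (c.Q : Multiset (DEdge n)))

section Probe

variable {G : Network} {f : Finset (Fin G.n) → ℤ}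
  {cores : List (DEdge G.n) → List (List (Fin G.n))} {c : Ctx G.n G.m}

theorem Problem.family (hP : Problem G f cores) (hpos : 0 < c.level f) :
    IntersectingFamily G.T (c.family f) :=
  intersectingFamily_residual hP.super hP.meets hpos

theorem CoreLists.isCore (h : CoreLists f cores) {I : List (DEdge G.n)} {C : List (Fin G.n)}
    (hC : C ∈ cores I) : IsCore (maxFamily (residual f (I : Multiset (DEdge G.n)))) C.toFinset :=
  (h.mem_iff I _).1 (List.mem_map_of_mem hC)

theorem CoreLists.exists_mem (h : CoreLists f cores) {I : List (DEdge G.n)} {A : Finset (Fin G.n)}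
    (hA : IsCore (maxFamily (residual f (I : Multiset (DEdge G.n)))) A) :
    ∃ C ∈ cores I, C.toFinset = A := List.mem_map.1 ((h.mem_iff I A).2 hA)

/-- The maximum is attained, so the list of cores is never empty and the default is not used. -/
theorem CoreLists.isCore_headD (h : CoreLists f cores) (I : List (DEdge G.n)) :
    IsCore (maxFamily (residual f (I : Multiset (DEdge G.n)))) ((cores I).headD []).toFinset := by
  obtain ⟨A, hA⟩ := exists_eq_maxVal (residual f (I : Multiset (DEdge G.n)))
  obtain ⟨C, hC, -⟩ := exists_core hA
  obtain ⟨D, hD, -⟩ := h.exists_mem hC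
  cases hI : cores I with
  | nil => simp [hI] at hD
  | cons a l => exact h.isCore (I := I) (by simp [hI])

/-- Soundness of the probe: the second query rules out candidates that look like halos but lie below
the level. -/
theorem Problem.inHalo_of_probe (hP : Problem G f cores) (hL : c.L = cores c.Q)
    (hpos : 0 < c.level f) {C : List (Fin G.n)} (hC : IsCore (c.family f) C.toFinset)
    {u : Node G.n} (h : probe G cores c C u ≠ []) : InHalo (c.family f) C.toFinset u := by
  cases C with
  | nil => simp [probe] at h
  | cons x C' =>
    simp only [probe] at h
    set A := (lastSat (goodCore c.L (x :: C') u) (cores ((u, some x) :: c.Q))).getD [] with hA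
    split at h
    · simp at h
    rename_i hAne
    split at h
    swap
    · simp at h
    rename_i hmem
    have hgood : goodCore c.L (x :: C') u A = true := by
      cases h' : lastSat (goodCore c.L (x :: C') u) (cores ((u, some x) :: c.Q)) with
      | none => simp [hA, h'] at hAne
      | some A' => simpa [hA, h'] using (mem_of_lastSat h').2
    obtain ⟨huA, hCA, huniq⟩ := goodCore_iff.1 hgood
    by_cases huC : u ∈ lift (x :: C').toFinset
    · exact ⟨_, hC.halo, huC⟩
    have hBcore := hP.lists.isCore_headD ((u, some x) :: ((heavy G (x :: C') A).reverse ++ c.Q))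
    rw [mem_iff] at hmem
    set B := ((cores ((u, some x) :: ((heavy G (x :: C') A).reverse ++ c.Q))).headD []).toFinset
    have hsum : (((u, some x) :: ((heavy G (x :: C') A).reverse ++ c.Q) : List (DEdge G.n)) :
        Multiset (DEdge G.n)) = ({(u, some x)} + ((heavy G (x :: C') A).reverse :
          Multiset (DEdge G.n))) + c.Q := by
      rw [add_assoc, Multiset.coe_add, Multiset.singleton_add, Multiset.cons_coe]
    rw [hsum] at hBcore
    have hBne : B.Nonempty := by
      rcases u with _ | u
      · exact absurd hmem none_notMem_lift
      · exact ⟨u, some_mem_lift.1 hmem⟩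
    have hf0 : f ∅ ≤ 0 := by
      by_contra h0
      simpa using hP.meets ∅ (not_le.1 h0)
    have hkey : ∀ X : Finset (Fin G.n), residual f
        (({(u, some x)} + ((heavy G (x :: C') A).reverse : Multiset (DEdge G.n))) + c.Q) X =
        max (f X - ((inDeg {(u, some x)} X : ℤ) + inDeg ((heavy G (x :: C') A).reverse :
          Multiset (DEdge G.n)) X + inDeg (c.Q : Multiset (DEdge G.n)) X)) 0 := by
      intro X; simp only [residual, inDeg_add]; push_cast; ring_nf
    have hBval : residual f (({(u, some x)} + ((heavy G (x :: C') A).reverse :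
      Multiset (DEdge G.n))) + c.Q) B = _ := hBcore.prop
    have hone : inDeg {(u, some x)} (x :: C').toFinset ≤ 1 := by
      simpa [inDeg] using Multiset.countP_le_card
        (fun e : DEdge G.n => e.2 ∈ lift (x :: C').toFinset ∧ e.1 ∉ lift (x :: C').toFinset)
        {(u, some x)}
    -- Any other nonempty set is entered by at least `G.m` heavy edges, so `f ≤ G.m` makes its
    -- residual `0`; then the empty set would be a smaller maximiser.
    have hBA : B = A.toFinset := by
      by_contra hBA
      have hent := exists_enters_of_isolating hBne
        (fun h => huC (h ▸ hmem)) hBA hCA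
      have h1 := le_inDeg_heavy hent
      have h2 := hP.le_card B
      rw [hkey] at hBval
      have hmem0 : ∅ ∈ maxFamily (residual f (({(u, some x)} + ((heavy G (x :: C') A).reverse :
          Multiset (DEdge G.n))) + c.Q)) := by
        simp only [maxFamily, Set.mem_ofPred_eq]
        rw [← hBval, hkey]
        omega
      exact hBne.ne_empty (hBcore.eq_of_le hmem0 (Finset.empty_subset B)).symm
    have hCval := le_maxVal (residual f (({(u, some x)} + ((heavy G (x :: C') A).reverse :
      Multiset (DEdge G.n))) + c.Q)) (x :: C').toFinset
    have hCne : (x :: C').toFinset ∉ maxFamily (residual f (({(u, some x)} +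
        ((heavy G (x :: C') A).reverse : Multiset (DEdge G.n))) + c.Q)) := fun h => by
      have := hBcore.eq_of_le h (hBA ▸ hCA)
      exact huC (this ▸ hmem)
    have hCH : inDeg ((heavy G (x :: C') A).reverse : Multiset (DEdge G.n)) (x :: C').toFinset = 0 :=
      inDeg_heavy_eq_zero fun e he => (not_enters_of_mem_isolating he).2 hCA
    -- `C` loses at most one unit to the extra edge and none to the heavy ones, yet `A` strictly
    -- beats it, so `A` attains the level.
    have hAF : A.toFinset ∈ c.family f := by
      have h1 := le_maxVal (residual f (c.Q : Multiset (DEdge G.n))) A.toFinset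
      have h2 : residual f (c.Q : Multiset (DEdge G.n)) (x :: C').toFinset = c.level f := hC.prop
      simp only [maxFamily, Set.mem_ofPred_eq] at hCne ⊢
      rw [hBA] at hBval
      rw [← hBval, hkey, hkey, hCH] at hCval hCne
      simp only [Ctx.level, residual] at *
      omega
    exact ⟨A.toFinset, ⟨hAF, hCA, fun D hD hDA => by
      obtain ⟨D', hD', rfl⟩ := hP.lists.exists_mem hD
      exact hC.eq_of_le hD.prop (huniq D' (hL ▸ hD') hDA)⟩, huA⟩

/-- Completeness of the probe: the least halo `D` containing `u` is not entered by the extra edge,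
and a member inside `D` that survives must contain `u` and so equals `D`. Thus `D` is a core of the
first query. Any accepted candidate is a halo containing `u`, hence contains `D`, and being a core
it equals `D`. -/
theorem Problem.probe_of_inHalo (hP : Problem G f cores) (hL : c.L = cores c.Q)
    (hpos : 0 < c.level f) {C : List (Fin G.n)} (hC : IsCore (c.family f) C.toFinset)
    {u : Node G.n} (h : InHalo (c.family f) C.toFinset u) :
    probe G cores c C u ≠ [] ∧ Halo (c.family f) C.toFinset (probe G cores c C u).toFinset ∧
      u ∈ lift (probe G cores c C u).toFinset ∧ ∀ B, Halo (c.family f) C.toFinset B →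
        u ∈ lift B → (probe G cores c C u).toFinset ⊆ B := by
  have hF := hP.family hpos
  obtain ⟨D, hD, huD, hDmin⟩ := hF.exists_least_halo hC h
  cases C with
  | nil => simpa using hF.meets _ hC.prop
  | cons x C' =>
    have hxC : x ∈ (x :: C').toFinset := by simp
    have hux : ¬ Enters (u, some x) D := fun h' => h'.2 huD
    obtain ⟨-, hmem1⟩ := maxFamily_residual_add hpos hD.mem
      (S := {(u, some x)}) (inDeg_eq_zero.2 (by simpa using hux))
    have hsum1 : (((u, some x) :: c.Q : List (DEdge G.n)) : Multiset (DEdge G.n)) =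
        {(u, some x)} + c.Q := by
      rw [Multiset.singleton_add, Multiset.cons_coe]
    have hleast : ∀ B ∈ c.family f, B ⊆ D → ¬ Enters (u, some x) B → B = D := by
      intro B hB hBD hent
      have hBh := hD.of_subset hB hBD
      refine hBD.antisymm (hDmin B hBh ?_)
      by_contra huB
      exact hent ⟨some_mem_lift.2 (hBh.core_subset hxC), huB⟩
    have hDcore : IsCore (maxFamily (residual f
        (((u, some x) :: c.Q : List (DEdge G.n)) : Multiset (DEdge G.n)))) D := by
      rw [hsum1]
      refine ⟨(hmem1 D).2 ⟨hD.mem, inDeg_eq_zero.2 (by simpa using hux)⟩, fun B hB hBD => ?_⟩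
      obtain ⟨hB1, hB2⟩ := (hmem1 B).1 hB
      exact (hleast B hB1 hBD (by simpa using inDeg_eq_zero.1 hB2)).ge
    have hlast : ∃ A, lastSat (goodCore c.L (x :: C') u) (cores ((u, some x) :: c.Q)) = some A ∧
        A.toFinset = D := by
      obtain ⟨D', hD', hD'e⟩ := hP.lists.exists_mem hDcore
      have hgood : goodCore c.L (x :: C') u D' = true := by
        rw [goodCore_iff, hD'e]
        refine ⟨huD, hD.core_subset, fun C'' hC'' hsub => ?_⟩
        rw [hL] at hC''
        exact (hD.unique _ (hP.lists.isCore hC'') hsub).le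
      rcases lastSat_spec (goodCore c.L (x :: C') u) (cores ((u, some x) :: c.Q)) with
        ⟨-, h2⟩ | ⟨l₁, A, l₂, h1, h2, h3, -⟩
      · rw [h2 D' hD'] at hgood; simp at hgood
      · refine ⟨A, h2, ?_⟩
        obtain ⟨huA, hCA, huniq⟩ := goodCore_iff.1 h3
        have hAcore := hP.lists.isCore (I := (u, some x) :: c.Q) (C := A) (by rw [h1]; simp)
        have hAF : A.toFinset ∈ c.family f := by
          have := hAcore.prop
          rw [hsum1] at this
          exact ((hmem1 _).1 this).1
        have hAh : Halo (c.family f) (x :: C').toFinset A.toFinset := ⟨hAF, hCA, fun E hE hEA => by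
          obtain ⟨E', hE', rfl⟩ := hP.lists.exists_mem hE
          exact hC.eq_of_le hE.prop (huniq E' (hL ▸ hE') hEA)⟩
        exact (hAcore.eq_of_le hDcore.prop (hDmin _ hAh huA)).symm
    obtain ⟨A, hA, rfl⟩ := hlast
    have hAne : A ≠ [] := by rintro rfl; simp [lift] at huD
    have hprobe : probe G cores c (x :: C') u = A := by
      simp only [probe, hA, Option.getD_some, if_neg hAne]
      refine if_pos ?_
      rw [mem_iff]
      have hBcore := hP.lists.isCore_headD ((u, some x) :: ((heavy G (x :: C') A).reverse ++ c.Q))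
      set B := ((cores ((u, some x) :: ((heavy G (x :: C') A).reverse ++ c.Q))).headD []).toFinset
      have hsum : (((u, some x) :: ((heavy G (x :: C') A).reverse ++ c.Q) : List (DEdge G.n)) :
          Multiset (DEdge G.n)) = ({(u, some x)} + ((heavy G (x :: C') A).reverse :
            Multiset (DEdge G.n))) + c.Q := by
        rw [add_assoc, Multiset.coe_add, Multiset.singleton_add, Multiset.cons_coe]
      rw [hsum] at hBcore
      have hA0 : inDeg ({(u, some x)} + ((heavy G (x :: C') A).reverse :
          Multiset (DEdge G.n))) A.toFinset = 0 := by
        rw [inDeg_add, inDeg_heavy_eq_zero fun e he => (not_enters_of_mem_isolating he).1, add_zero]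
        exact inDeg_eq_zero.2 (by simpa using hux)
      obtain ⟨-, hmem2⟩ := maxFamily_residual_add hpos hD.mem hA0
      obtain ⟨hBF, hB0⟩ := (hmem2 B).1 hBcore.prop
      rw [inDeg_add, Nat.add_eq_zero_iff, inDeg_eq_zero] at hB0
      have hBne : B.Nonempty := by
        obtain ⟨t, ht⟩ := hF.meets B hBF
        exact ⟨t, (Finset.mem_inter.1 ht).1⟩
      have hm : 0 < G.m := by
        have h1 := hP.le_card B
        have h2 := (pos_of_mem_maxFamily hpos hBF).2
        omega
      -- The core returned by the second query is a member of the family that no heavy edge enters,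
      -- so it is `C` or `A`. The extra edge excludes `C` if `u` is missing, and `A` contains `u`.
      by_contra huB
      by_cases hBC : B = (x :: C').toFinset
      · exact hB0.1 _ (Multiset.mem_singleton_self _)
          ⟨by rw [hBC]; exact some_mem_lift.2 hxC, huB⟩
      · have hBA : B ≠ A.toFinset := fun h => huB (h ▸ huD)
        have := le_inDeg_heavy (exists_enters_of_isolating hBne hBC hBA hD.core_subset)
        omega
    rw [hprobe]
    exact ⟨hAne, hD, huD, hDmin⟩

theorem Problem.probe_eq_nil_iff (hP : Problem G f cores) (hL : c.L = cores c.Q)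
    (hpos : 0 < c.level f) {C : List (Fin G.n)} (hC : IsCore (c.family f) C.toFinset)
    {u : Node G.n} : probe G cores c C u = [] ↔ ¬ InHalo (c.family f) C.toFinset u :=
  ⟨fun h h' => (hP.probe_of_inHalo hL hpos hC h').1 h, fun h => by
    by_contra h'; exact h (hP.inHalo_of_probe hL hpos hC h')⟩

end Probe

/-! ### Distances to a core -/

theorem lastSat_cons {α : Type*} (p : α → Bool) (a : α) (l : List α) :
    lastSat p (a :: l) = (lastSat p l).or (if p a then some a else none) := by
  have h (o : Option α) : l.foldl (fun acc x => if p x then some x else acc) o =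
      (lastSat p l).or o := by
    induction l using List.reverseRecOn with
    | nil => simp [lastSat]
    | append_singleton l x ih =>
      simp only [List.foldl_append, List.foldl_cons, List.foldl_nil, lastSat] at ih ⊢
      rw [ih]
      split <;> simp
  rw [lastSat, List.foldl_cons, h]

theorem findLabel_cons {n m : ℕ} (a : Label n m) (l : List (Label n m)) (v : Node n) :
    findLabel (a :: l) v = (findLabel l v).or (if mem v a.set then some a else none) :=
  lastSat_cons _ _ _

theorem findLabel_eq_none_iff {n m : ℕ} {l : List (Label n m)} {v : Node n} :
    findLabel l v = none ↔ ∀ en ∈ l, mem v en.set = false := by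
  induction l with
  | nil => simp [findLabel, lastSat]
  | cons a l ih => rw [findLabel_cons, Option.or_eq_none_iff, ih]; simp [and_comm]

/-- Labels are listed with the farthest in front, so the last match, which `findLabel` returns, is a
nearest one. -/
theorem findLabel_dist_le {n m : ℕ} {l : List (Label n m)} {v : Node n} {en a : Label n m}
    (hs : l.Pairwise fun a b => b.dist ≤ a.dist) (h : findLabel l v = some en) (ha : a ∈ l)
    (hv : mem v a.set = true) : en.dist ≤ a.dist := by
  induction l with
  | nil => simp at ha
  | cons b l ih =>
    rw [List.pairwise_cons] at hs
    rw [findLabel_cons] at h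
    cases hl : findLabel l v with
    | some x =>
      rw [hl, Option.some_or, Option.some_inj] at h
      subst h
      rcases List.mem_cons.1 ha with rfl | ha
      · exact hs.1 _ ((mem_of_lastSat hl).1)
      · exact ih hs.2 hl ha
    | none =>
      rw [hl, Option.none_or] at h
      split at h
      · cases h
        rcases List.mem_cons.1 ha with rfl | ha
        · exact le_rfl
        · rw [findLabel_eq_none_iff] at hl
          rw [hl a ha] at hv
          simp at hv
      · simp at h

section Dijkstra

variable {G : Network} {f : Finset (Fin G.n) → ℤ}
  {cores : List (DEdge G.n) → List (List (Fin G.n))} {c : Ctx G.n G.m}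

/-- The path of the label lies in the halo family of `C`, has the right length and covers the
members of the halo family that do not contain its set. -/
structure Label.Valid (f : Finset (Fin G.n) → ℤ) (c : Ctx G.n G.m) (C : Finset (Fin G.n))
    (en : Label G.n G.m) : Prop where
  halo : Halo (c.family f) C en.set.toFinset
  dist_eq : en.dist = (en.path.map G.cost).sum
  mem_R : ∀ e ∈ en.path, e ∈ c.R
  inHalo : ∀ e ∈ en.path, InHalo (c.family f) C (G.edge e).1 ∧ InHalo (c.family f) C (G.edge e).2
  cover : ∀ A, Halo (c.family f) C A → ∀ v ∈ en.set.toFinset, v ∉ A →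
    ∃ e ∈ en.path, Enters (G.edge e) A

theorem Label.Valid.dist_nonneg {C : Finset (Fin G.n)} {en : Label G.n G.m}
    (h : en.Valid f c C) : 0 ≤ en.dist := by
  rw [h.dist_eq]
  refine List.sum_nonneg fun x hx => ?_
  obtain ⟨e, -, rfl⟩ := List.mem_map.1 hx
  exact G.cost_nonneg e

/-- The invariant of Dijkstra's algorithm. -/
structure DijkstraInv (f : Finset (Fin G.n) → ℤ) (c : Ctx G.n G.m) (C : Finset (Fin G.n))
    (l : List (Label G.n G.m)) : Prop where
  valid : ∀ en ∈ l, en.Valid f c C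
  sorted : l.Pairwise fun a b => b.dist ≤ a.dist
  base : ∃ en ∈ l, en.dist = 0
  -- No pending relaxation is shorter than an existing label; this keeps the list sorted when a
  -- label is added.
  cross : ∀ e ∈ c.R, ∀ en, findLabel l (G.edge e).2 = some en → findLabel l (G.edge e).1 = none →
    InHalo (c.family f) C (G.edge e).1 → ∀ a ∈ l, a.dist ≤ en.dist + G.cost e
  inside : ∀ e ∈ c.R, ∀ en a, findLabel l (G.edge e).2 = some en →
    findLabel l (G.edge e).1 = some a → a.dist ≤ en.dist + G.cost e

theorem dijkstraInv_init {C : List (Fin G.n)} (hC : IsCore (c.family f) C.toFinset) :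
    DijkstraInv f c C.toFinset [⟨C, 0, []⟩] where
  valid := by
    intro en hen
    obtain rfl := List.mem_singleton.1 hen
    exact ⟨hC.halo, by simp, by simp, by simp, fun A hA v hv hvA => absurd (hA.core_subset hv) hvA⟩
  sorted := by simp
  base := ⟨_, List.mem_singleton_self _, rfl⟩
  cross := by
    intro e _ en hen _ _ a ha
    have := (mem_of_findLabel hen).1
    rw [List.mem_singleton] at ha this
    subst ha this
    simpa using G.cost_nonneg e
  inside := by
    intro e _ en a hen ha
    have h1 := (mem_of_findLabel hen).1
    have h2 := (mem_of_findLabel ha).1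
    rw [List.mem_singleton] at h1 h2
    subst h1 h2
    simpa using G.cost_nonneg e

/-- As in Dijkstra's algorithm: the shortest pending label is chosen and costs are nonnegative, so
later relaxations are no shorter. Unlike there, a label reaches all nodes of the least halo
containing the tail at once. -/
theorem Problem.dijkstraInv_grow (hP : Problem G f cores) (hL : c.L = cores c.Q)
    (hpos : 0 < c.level f) {C : List (Fin G.n)} (hC : IsCore (c.family f) C.toFinset)
    {l : List (Label G.n G.m)} (h : DijkstraInv f c C.toFinset l) :
    DijkstraInv f c C.toFinset (grow G cores c C l) := by
  unfold grow
  split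
  · exact h
  rename_i b hb
  have hbmem := List.argmin_mem hb
  have hmin : ∀ e ∈ c.R, ∀ en, findLabel l (G.edge e).2 = some en →
      findLabel l (G.edge e).1 = none → InHalo (c.family f) C.toFinset (G.edge e).1 →
      b.dist ≤ en.dist + G.cost e := by
    intro e he en hen hnone hin
    exact List.le_of_mem_argmin (f := Label.dist) (a := ⟨probe G cores c C (G.edge e).1,
      en.dist + G.cost e, e :: en.path⟩)
      (mem_relax.2 ⟨e, he, en, hen, hnone, (hP.probe_of_inHalo hL hpos hC hin).1, rfl⟩) hb
  obtain ⟨e, he, en, hen, hnone, hne, hbe⟩ := mem_relax.1 hbmem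
  have hin := hP.inHalo_of_probe hL hpos hC hne
  obtain ⟨-, hhalo, hue, hleast⟩ := hP.probe_of_inHalo hL hpos hC hin
  obtain ⟨henl, henm⟩ := mem_of_findLabel hen
  have hv := h.valid en henl
  have hbd : b.dist = en.dist + G.cost e := by rw [hbe]
  have hle : ∀ a ∈ l, a.dist ≤ b.dist := fun a ha => hbd ▸ h.cross e he en hen hnone hin a ha
  have hfind : ∀ {v a}, findLabel (b :: l) v = some a → findLabel l v = some a ∨
      (findLabel l v = none ∧ a = b) := by
    intro v a hva
    rw [findLabel_cons] at hva
    cases hl : findLabel l v with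
    | some x => left; simpa [hl] using hva
    | none =>
      right
      rw [hl, Option.none_or] at hva
      split at hva
      · exact ⟨rfl, (Option.some_inj.1 hva).symm⟩
      · simp at hva
  have hfindnone : ∀ {v}, findLabel (b :: l) v = none → findLabel l v = none := by
    intro v hva
    rw [findLabel_cons, Option.or_eq_none_iff] at hva
    exact hva.1
  have hbin : ∀ v, mem v b.set = true → InHalo (c.family f) C.toFinset v := by
    intro v hvb
    rw [hbe, mem_iff] at hvb
    exact ⟨_, hhalo, hvb⟩
  have hsome : ∀ {v a}, findLabel (b :: l) v = some a → InHalo (c.family f) C.toFinset v := by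
    intro v a hva
    obtain ⟨h1, h2⟩ := mem_of_findLabel hva
    rcases List.mem_cons.1 h1 with rfl | h1
    · exact hbin v h2
    · exact ⟨_, (h.valid a h1).halo, mem_iff.1 h2⟩
  refine ⟨?_, ?_, ?_, ?_, ?_⟩
  · intro a ha
    rcases List.mem_cons.1 ha with rfl | ha
    · rw [hbe]
      refine ⟨hhalo, by simp [hv.dist_eq, add_comm], ?_, ?_, ?_⟩
      · intro e' he'
        rcases List.mem_cons.1 he' with rfl | he'
        · exact he
        · exact hv.mem_R e' he'
      · intro e' he'
        rcases List.mem_cons.1 he' with rfl | he'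
        · exact ⟨hin, _, hv.halo, mem_iff.1 henm⟩
        · exact hv.inHalo e' he'
      · intro A hA v hvD hvA
        -- A halo that misses a node of the least halo of the tail misses the tail itself. Either
        -- `e` enters it, or it also misses the head of `e` and the older path takes over.
        have hyA : (G.edge e).1 ∉ lift A := fun h' => hvA (hleast A hA h' hvD)
        by_cases hzA : (G.edge e).2 ∈ lift A
        · exact ⟨e, by simp, hzA, hyA⟩
        · have hz := mem_iff.1 henm
          simp only [lift, Finset.mem_map] at hz
          obtain ⟨z, hz, hze⟩ := hz
          obtain ⟨e', he', hent⟩ := hv.cover A hA z hz fun h' => hzA (by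
            rw [← hze]; exact some_mem_lift.2 h')
          exact ⟨e', by simp [he'], hent⟩
    · exact h.valid a ha
  · exact List.pairwise_cons.2 ⟨hle, h.sorted⟩
  · obtain ⟨a, ha, h0⟩ := h.base
    exact ⟨a, by simp [ha], h0⟩
  · intro e' he' a ha hnone' hin' x hx
    have h1 := hfindnone hnone'
    have h2 : b.dist ≤ a.dist + G.cost e' := by
      rcases hfind ha with h3 | ⟨-, rfl⟩
      · exact hmin e' he' a h3 h1 hin'
      · linarith [G.cost_nonneg e']
    rcases List.mem_cons.1 hx with rfl | hx
    · exact h2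
    · exact (hle x hx).trans h2
  · intro e' he' a x ha hx
    rcases hfind ha with h1 | ⟨h1, rfl⟩
    · rcases hfind hx with h2 | ⟨h2, rfl⟩
      · exact h.inside e' he' a x h1 h2
      · exact hmin e' he' a h1 h2 (hsome hx)
    · have : x.dist ≤ a.dist := by
        rcases hfind hx with h2 | ⟨h2, rfl⟩
        · exact hle x (mem_of_findLabel h2).1
        · exact le_rfl
      linarith [G.cost_nonneg e']

/-- The nodes that have a label. -/
def labelled (l : List (Label G.n G.m)) : Finset (Fin G.n) :=
  Finset.univ.filter fun v => (findLabel l (some v)).isSome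

theorem Problem.labelled_grow (hP : Problem G f cores) (hL : c.L = cores c.Q)
    (hpos : 0 < c.level f) {C : List (Fin G.n)} (hC : IsCore (c.family f) C.toFinset)
    {l : List (Label G.n G.m)} (h : relax G cores c C l ≠ []) :
    (labelled l).card < (labelled (grow G cores c C l)).card := by
  unfold grow
  split
  · rename_i h'
    exact absurd (List.argmin_eq_none.1 h') h
  rename_i b hb
  obtain ⟨e, he, en, hen, hnone, hne, hbe⟩ := mem_relax.1 (List.argmin_mem hb)
  obtain ⟨-, -, hue, -⟩ := hP.probe_of_inHalo hL hpos hC (hP.inHalo_of_probe hL hpos hC hne)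
  have hue' := hue
  simp only [lift, Finset.mem_map] at hue'
  obtain ⟨y, -, hy⟩ := hue'
  have hy' : (G.edge e).1 = some y := hy.symm
  refine Finset.card_lt_card ((Finset.ssubset_iff_of_subset ?_).2 ⟨y, ?_, ?_⟩)
  · intro v hv
    simp only [labelled, Finset.mem_filter, Finset.mem_univ, true_and] at hv ⊢
    rw [findLabel_cons]
    simp [hv]
  · simp only [labelled, Finset.mem_filter, Finset.mem_univ, true_and]
    rw [findLabel_cons, ← hy', hnone, hbe, if_pos (mem_iff.2 hue)]
    rfl
  · simp [labelled, ← hy', hnone]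

theorem grow_of_relax_eq_nil {C : List (Fin G.n)} {l : List (Label G.n G.m)}
    (h : relax G cores c C l = []) : grow G cores c C l = l := by
  unfold grow
  rw [h]
  rfl

/-- The core provides a labelled node at the start and each productive round labels another, so
`G.n` rounds cannot all be productive; after an idle round nothing changes. -/
theorem Problem.labels_inv (hP : Problem G f cores) (hL : c.L = cores c.Q)
    (hpos : 0 < c.level f) {C : List (Fin G.n)} (hC : IsCore (c.family f) C.toFinset) :
    DijkstraInv f c C.toFinset (labels G cores c C) ∧ relax G cores c C (labels G cores c C) = [] := by
  have key : ∀ r : List (Fin G.n), DijkstraInv f c C.toFinset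
      (r.foldl (fun l _ => grow G cores c C l) [⟨C, 0, []⟩]) ∧
      (relax G cores c C (r.foldl (fun l _ => grow G cores c C l) [⟨C, 0, []⟩]) = [] ∨
        r.length + 1 ≤ (labelled (r.foldl (fun l _ => grow G cores c C l) [⟨C, 0, []⟩])).card) := by
    intro r
    induction r using List.reverseRecOn with
    | nil =>
      refine ⟨dijkstraInv_init hC, Or.inr ?_⟩
      obtain ⟨t, ht⟩ := (hP.family hpos).meets _ hC.prop
      simp only [List.length_nil, zero_add, List.foldl_nil]
      refine Finset.card_pos.2 ⟨t, ?_⟩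
      simp only [labelled, Finset.mem_filter, Finset.mem_univ, true_and]
      rw [findLabel_cons, if_pos (mem_iff.2 (some_mem_lift.2 (Finset.mem_inter.1 ht).1))]
      simp
    | append_singleton r x ih =>
      rw [List.foldl_append, List.foldl_cons, List.foldl_nil]
      refine ⟨hP.dijkstraInv_grow hL hpos hC ih.1, ?_⟩
      by_cases h : relax G cores c C (r.foldl (fun l _ => grow G cores c C l) [⟨C, 0, []⟩]) = []
      · left
        have : grow G cores c C (r.foldl (fun l _ => grow G cores c C l) [⟨C, 0, []⟩]) =
            r.foldl (fun l _ => grow G cores c C l) [⟨C, 0, []⟩] :=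
          grow_of_relax_eq_nil h
        rw [this, h]
      · right
        have h1 := ih.2.resolve_left h
        have h2 := hP.labelled_grow hL hpos hC h
        simp only [List.length_append, List.length_cons, List.length_nil]
        omega
  obtain ⟨h1, h2⟩ := key (List.finRange G.n)
  refine ⟨h1, h2.resolve_right fun h => ?_⟩
  have := h.trans (Finset.card_le_univ _)
  simp at this

/-- The triangle inequality for final distances. The tail has a label because nothing is left to
relax. -/
theorem Problem.exists_label (hP : Problem G f cores) (hL : c.L = cores c.Q)
    (hpos : 0 < c.level f) {C : List (Fin G.n)} (hC : IsCore (c.family f) C.toFinset)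
    {e : Fin G.m} (he : e ∈ c.R) (hin : InHalo (c.family f) C.toFinset (G.edge e).1)
    {en : Label G.n G.m} (hen : findLabel (labels G cores c C) (G.edge e).2 = some en) :
    ∃ a, findLabel (labels G cores c C) (G.edge e).1 = some a ∧ a.dist ≤ en.dist + G.cost e := by
  obtain ⟨h1, h2⟩ := hP.labels_inv hL hpos hC
  cases ha : findLabel (labels G cores c C) (G.edge e).1 with
  | none =>
    have := mem_relax.2 ⟨e, he, en, hen, ha, (hP.probe_of_inHalo hL hpos hC hin).1, rfl⟩
    rw [h2] at this
    simp at this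
  | some a => exact ⟨a, rfl, h1.inside e he en a hen ha⟩

end Dijkstra

/-! ### The number of cores decreases -/

section Decrease

variable {n : ℕ} {T : Finset (Fin n)} {F F' : Set (Finset (Fin n))}

/-- Choosing in each `D ∈ Y` a core of `F` outside `X` is injective: a terminal of the chosen core
would be common to two cores of `F'`. The second alternative covers the case that such a terminal is
missing. -/
theorem ncard_cores_add_le (hF' : IntersectingFamily T F') (X : Finset (Finset (Fin n)))
    (hX : ∀ C ∈ X, IsCore F C) (Y : Set (Finset (Fin n))) (hY : ∀ D ∈ Y, IsCore F' D)
    (h : ∀ D ∈ Y, ∃ C, IsCore F C ∧ C ∉ X ∧ C ⊆ D) :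
    Y.ncard + X.card ≤ {C | IsCore F C}.ncard ∨ ∃ C, IsCore F C ∧ C ∩ T = ∅ := by
  by_cases hT : ∃ C, IsCore F C ∧ C ∩ T = ∅
  · exact Or.inr hT
  left
  push Not at hT
  choose! φ h1 h2 h3 using h
  have hinj : Set.InjOn φ Y := by
    intro D hD E hE hDE
    refine hF'.core_eq (hY D hD) (hY E hE) ?_
    obtain ⟨t, ht⟩ := hT _ (h1 D hD)
    obtain ⟨ht1, ht2⟩ := Finset.mem_inter.1 ht
    exact ⟨t, by simp [h3 D hD ht1, h3 E hE (hDE ▸ ht1), ht2]⟩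
  rw [← hinj.ncard_image, ← Set.ncard_coe_finset,
    ← Set.ncard_union_eq ?_ (Set.toFinite _) (Set.toFinite _)]
  · refine Set.ncard_le_ncard ?_ (Set.toFinite _)
    rintro C (⟨D, hD, rfl⟩ | hC)
    · exact h1 D hD
    · exact hX C hC
  · refine Set.disjoint_left.2 ?_
    rintro _ ⟨D, hD, rfl⟩ hC
    exact h2 D hD hC

/-- If every member of `F'` that contains a core in `X` contains both ends of `e`, and one of them
is a terminal, then `F'` has fewer cores than `F`. -/
theorem ncard_cores_le (hF : IntersectingFamily T F) (hF' : IntersectingFamily T F')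
    (hsub : F' ⊆ F) {X : Finset (Finset (Fin n))} (hX : ∀ C ∈ X, IsCore F C)
    (hne : X.Nonempty) {e : DEdge n}
    (hT : (e.1 ∈ lift T ∨ e.2 ∈ lift T) ∨ ∀ A ∈ F, ¬ (e.1 ∈ lift A ∧ e.2 ∈ lift A))
    (hXe : ∀ C ∈ X, ∀ A ∈ F', C ⊆ A → e.1 ∈ lift A ∧ e.2 ∈ lift A)
    (hu : ∀ C ∈ X, ¬ InHalo F C e.1) :
    ((∃ C, IsCore F C ∧ InHalo F C e.1 ∧ InHalo F C e.2) →
      {C | IsCore F' C}.ncard + X.card ≤ {C | IsCore F C}.ncard) ∧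
    2 * {C | IsCore F' C}.ncard + X.card ≤ 2 * {C | IsCore F C}.ncard := by
  have hnoT : ¬ ∃ C, IsCore F C ∧ C ∩ T = ∅ := by
    rintro ⟨C, hC, h⟩
    have := hF.meets C hC.prop
    rw [h] at this
    simp at this
  -- The terminal end of `e` is a common element; if `e` has none, no member contains both ends.
  have hcommon : ∀ C ∈ X, ∀ A ∈ F', C ⊆ A → ∀ B, e.1 ∈ lift B → e.2 ∈ lift B →
      (A ∩ B ∩ T).Nonempty := by
    intro C hC A hA hCA B h1 h2
    obtain ⟨h3, h4⟩ := hXe C hC A hA hCA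
    rcases hT with hT | hT
    · have key : ∀ u : Node n, u ∈ lift A → u ∈ lift B → u ∈ lift T → (A ∩ B ∩ T).Nonempty := by
        intro u ha hb ht
        cases u with
        | none => exact absurd ha none_notMem_lift
        | some x =>
          rw [some_mem_lift] at ha hb ht
          exact ⟨x, by simp [ha, hb, ht]⟩
      rcases hT with hT | hT
      · exact key _ h3 h1 hT
      · exact key _ h4 h2 hT
    · exact absurd ⟨h3, h4⟩ (hT A (hsub hA))
  have hall : (∀ D, IsCore F' D → (∃ C ∈ X, C ⊆ D) → ∃ C, IsCore F C ∧ C ∉ X ∧ C ⊆ D) →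
      {C | IsCore F' C}.ncard + X.card ≤ {C | IsCore F C}.ncard := by
    intro h
    refine (ncard_cores_add_le hF' X hX {C | IsCore F' C} (fun _ h => h)
      fun D hD => ?_).resolve_right hnoT
    by_cases hD' : ∃ C ∈ X, C ⊆ D
    · exact h D hD hD'
    · push Not at hD'
      obtain ⟨C, hC, hCD⟩ := exists_core (hsub (Minimal.prop hD))
      exact ⟨C, hC, fun h => hD' C h hCD, hCD⟩
  refine ⟨?_, ?_⟩
  · rintro ⟨C', hC', hu', hv'⟩
    -- The greatest halo of `C'` contains both ends of `e`, so it meets `D` in a terminal and `D`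
    -- contains `C'`. This core is not in `X`, since its halos reach the tail.
    refine hall fun D hD ⟨C, hC, hCD⟩ => ?_
    obtain ⟨M, hM, hMg⟩ := hF.exists_greatest_halo hC'
    refine ⟨C', hC', fun h => hu C' h hu', ?_⟩
    exact (hF.halo_inter hM (hsub hD.prop)
      (hcommon C hC D hD.prop hCD M (hMg _ hu') (hMg _ hv'))).core_subset.trans
        Finset.inter_subset_left
  · by_cases h : ∀ D, IsCore F' D → (∃ C ∈ X, C ⊆ D) → ∃ C, IsCore F C ∧ C ∉ X ∧ C ⊆ D
    · have := hall h
      omega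
    · push Not at h
      obtain ⟨D, hD, ⟨C, hC, hCD⟩, hDX⟩ := h
      -- Otherwise `D` is a halo of the only core in `X` and contains the tail of `e`. So `X` has at
      -- least two elements, and a loss of `X.card - 1` cores is at least half of `X.card`.
      have h1 : X.card ≠ 1 := by
        intro h1
        obtain ⟨C₀, rfl⟩ := Finset.card_eq_one.1 h1
        obtain rfl := Finset.mem_singleton.1 hC
        refine hu C hC ⟨D, ⟨hsub hD.prop, hCD, fun E hE hED => ?_⟩, (hXe C hC D hD.prop hCD).1⟩
        by_contra hEC
        exact hDX E hE (by simpa using hEC) hED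
      have h2 : 0 < X.card := hne.card_pos
      -- Only `D` can fail to contain a core outside `X`: another core of `F'` containing an element
      -- of `X` would share with `D` the terminal end of `e`.
      have h3 := (ncard_cores_add_le hF' X hX ({C | IsCore F' C} \ {D}) (fun _ h => h.1)
        fun E hE => ?_).resolve_right hnoT
      · have h4 := Set.ncard_sdiff_singleton_add_one (s := {C | IsCore F' C}) (a := D) hD
          (Set.toFinite _)
        omega
      · obtain ⟨C', hC', hCE⟩ := exists_core (hsub (Minimal.prop hE.1))
        refine ⟨C', hC', fun hX' => hE.2 ?_, hCE⟩
        obtain ⟨h5, h6⟩ := hXe C' hX' E (Minimal.prop hE.1) hCE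
        exact hF'.core_eq hE.1 hD (by
          rw [Finset.inter_comm E D]; exact hcommon C hC D hD.prop hCD E h5 h6)

theorem mem_maxFamily_residual_add {f : Finset (Fin n) → ℤ} {I S : Multiset (DEdge n)}
    (hpos : 0 < maxVal (residual f I))
    (h : maxVal (residual f (S + I)) = maxVal (residual f I)) (B : Finset (Fin n)) :
    B ∈ maxFamily (residual f (S + I)) ↔ B ∈ maxFamily (residual f I) ∧ inDeg S B = 0 := by
  have h3 := le_maxVal (residual f I) B
  simp only [maxFamily, Set.mem_ofPred_eq, h]
  simp only [residual, inDeg_add] at h3 hpos ⊢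
  push_cast at h3 ⊢
  omega

end Decrease

/-! ### Spiders -/

section Spiders

variable {G : Network} {f : Finset (Fin G.n) → ℤ}
  {cores : List (DEdge G.n) → List (List (Fin G.n))} {c : Ctx G.n G.m}

theorem CoreLists.length_eq (h : CoreLists f cores) (I : List (DEdge G.n)) :
    (cores I).length =
      {C | IsCore (maxFamily (residual f (I : Multiset (DEdge G.n)))) C}.ncard := by
  have : {C | IsCore (maxFamily (residual f (I : Multiset (DEdge G.n)))) C} =
      (((cores I).map List.toFinset).toFinset : Set (Finset (Fin G.n))) := by
    ext A
    rw [Finset.mem_coe, List.mem_toFinset, h.mem_iff]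
    rfl
  rw [this, Set.ncard_coe_finset, List.toFinset_card_of_nodup (h.nodup_map I), List.length_map]

variable (G cores c) in
/-- The distance from `v` to the core `C`. -/
def distTo (C : List (Fin G.n)) (v : Node G.n) : ℚ :=
  ((findLabel (labels G cores c C) v).map Label.dist).getD 0

variable (G cores c) in
/-- The cores at the feet of a spider. -/
def footCores (e : Fin G.m) (θ : ℚ) : Finset (List (Fin G.n)) :=
  c.L.toFinset.filter fun C => probe G cores c C (G.edge e).1 = [] ∧
    ∃ en, findLabel (labels G cores c C) (G.edge e).2 = some en ∧ en.dist ≤ θ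

theorem mem_footCores {e : Fin G.m} {θ : ℚ} {C : List (Fin G.n)} :
    C ∈ footCores G cores c e θ ↔ C ∈ c.L ∧ probe G cores c C (G.edge e).1 = [] ∧
      ∃ en, findLabel (labels G cores c C) (G.edge e).2 = some en ∧ en.dist ≤ θ := by
  simp [footCores]

theorem feet_sum (hnd : c.L.Nodup) (e : Fin G.m) (θ : ℚ) :
    (feet G cores c e θ).length = (footCores G cores c e θ).card ∧
    ((feet G cores c e θ).map Label.dist).sum =
      ∑ C ∈ footCores G cores c e θ, distTo G cores c C (G.edge e).2 := by
  let g : List (Fin G.n) → List (Label G.n G.m) := fun C =>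
    if probe G cores c C (G.edge e).1 = [] then
      match findLabel (labels G cores c C) (G.edge e).2 with
      | none => []
      | some en => if θ < en.dist then [] else [en]
    else []
  have hperm : (feet G cores c e θ).Perm (c.L.flatMap g) := by
    unfold feet table
    refine (List.reverse_perm _).trans ?_
    refine ((List.reverse_perm _).flatMap_right _).trans ?_
    exact List.Perm.of_eq (List.flatMap_map ..)
  have hg : ∀ C ∈ c.L, (g C).length = (if C ∈ footCores G cores c e θ then 1 else 0) ∧
      ((g C).map Label.dist).sum = (if C ∈ footCores G cores c e θ then
        distTo G cores c C (G.edge e).2 else 0) := by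
    intro C hC
    simp only [g, mem_footCores, hC, true_and, distTo]
    by_cases h1 : probe G cores c C (G.edge e).1 = []
    · simp only [h1, if_true, true_and]
      cases h2 : findLabel (labels G cores c C) (G.edge e).2 with
      | none => simp
      | some en =>
        by_cases h3 : θ < en.dist
        · simp [h3]
        · simp [h3, not_lt.1 h3]
    · simp [h1]
  have hsub : c.L.toFinset.filter (fun C => C ∈ footCores G cores c e θ) =
      footCores G cores c e θ := by
    ext C
    simp only [Finset.mem_filter, List.mem_toFinset, and_iff_right_iff_imp]
    exact fun h => (mem_footCores.1 h).1
  constructor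
  · rw [hperm.length_eq, List.length_flatMap, List.map_congr_left fun C hC => (hg C hC).1,
      ← List.sum_toFinset _ hnd, ← Finset.sum_filter, hsub, Finset.card_eq_sum_ones]
  · rw [(hperm.map _).sum_eq, List.map_flatMap, List.flatMap_def, List.sum_flatten, List.map_map]
    simp only [Function.comp_def]
    rw [
      List.map_congr_left fun C hC => (hg C hC).2, ← List.sum_toFinset _ hnd,
      ← Finset.sum_filter, hsub]

theorem price_eq (e : Fin G.m) (X : List (Label G.n G.m)) :
    price G cores c e X = (if inner G cores c e = true then 1 else 2) *
      (G.cost e + (X.map Label.dist).sum) := by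
  have h (q : ℚ) : X.foldl (fun s en => s + en.dist) q = q + (X.map Label.dist).sum := by
    induction X generalizing q with
    | nil => simp
    | cons a X ih => rw [List.foldl_cons, ih, List.map_cons, List.sum_cons, add_assoc]
  simp only [price, h]
  split <;> simp [two_mul]

theorem inner_iff (e : Fin G.m) : inner G cores c e = true ↔
    ∃ C ∈ c.L, probe G cores c C (G.edge e).1 ≠ [] ∧ probe G cores c C (G.edge e).2 ≠ [] := by
  simp [inner]

theorem Problem.inner_iff_inHalo (hP : Problem G f cores) (hL : c.L = cores c.Q)
    (hpos : 0 < c.level f) (e : Fin G.m) : inner G cores c e = true ↔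
    ∃ C, IsCore (c.family f) C ∧ InHalo (c.family f) C (G.edge e).1 ∧
      InHalo (c.family f) C (G.edge e).2 := by
  rw [inner_iff]
  constructor
  · rintro ⟨C, hC, h1, h2⟩
    have hC' := hP.lists.isCore (I := c.Q) (hL ▸ hC)
    exact ⟨_, hC', hP.inHalo_of_probe hL hpos hC' h1, hP.inHalo_of_probe hL hpos hC' h2⟩
  · rintro ⟨A, hA, h1, h2⟩
    obtain ⟨C, hC, rfl⟩ := hP.lists.exists_mem (I := c.Q) hA
    exact ⟨C, hL ▸ hC, (hP.probe_of_inHalo hL hpos hA h1).1, (hP.probe_of_inHalo hL hpos hA h2).1⟩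

theorem Problem.nodup_cores (hP : Problem G f cores) (hL : c.L = cores c.Q) : c.L.Nodup :=
  hL ▸ (hP.lists.nodup_map c.Q).of_map _

/-- At an unchanged level the new family consists of the old members that the bought edges do not
enter. The paths force each such member containing a foot core to contain the head of `e`, and `e`
itself then forces its tail; `ncard_cores_le` does the counting. -/
theorem Problem.decrease (hP : Problem G f cores) (hL : c.L = cores c.Q) (hpos : 0 < c.level f)
    {b : Spider G.n G.m} (hb : b ∈ spiders G cores c) {S Q' : List (DEdge G.n)}
    (hS : ∀ e ∈ c.R, b.has e = true → G.edge e ∈ S)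
    (hQ' : (Q' : Multiset (DEdge G.n)) = (S : Multiset (DEdge G.n)) + c.Q)
    (hlevel : maxVal (residual f (Q' : Multiset (DEdge G.n))) = c.level f) :
    (inner G cores c b.edge = true → (cores Q').length + b.feet.length ≤ c.L.length) ∧
      2 * (cores Q').length + b.feet.length ≤ 2 * c.L.length := by
  obtain ⟨e, he, C₀, hC₀, en₀, hen₀, hne, rfl⟩ := mem_spiders.1 hb
  set θ := en₀.dist
  have hF := hP.family hpos
  have hpos' : 0 < maxVal (residual f (Q' : Multiset (DEdge G.n))) := hlevel ▸ hpos
  have hF' := intersectingFamily_residual hP.super hP.meets hpos'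
  rw [hQ'] at hlevel
  have hmem := mem_maxFamily_residual_add hpos hlevel
  rw [← hQ'] at hmem
  have hinj : Set.InjOn List.toFinset (footCores G cores c e θ : Set (List (Fin G.n))) := by
    intro C hC D hD hCD
    exact List.inj_on_of_nodup_map (hP.lists.nodup_map c.Q) (hL ▸ (mem_footCores.1 hC).1)
      (hL ▸ (mem_footCores.1 hD).1) hCD
  have hlen := (feet_sum (cores := cores) (hP.nodup_cores hL) e θ).1
  have hcard : ((footCores G cores c e θ).image List.toFinset).card =
      (feet G cores c e θ).length := by rw [Finset.card_image_of_injOn hinj, hlen]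
  have hXne : ((footCores G cores c e θ).image List.toFinset).Nonempty := by
    rw [← Finset.card_pos, hcard]
    exact List.length_pos_iff.2 hne
  have hcore : ∀ C ∈ footCores G cores c e θ, IsCore (c.family f) C.toFinset :=
    fun C hC => hP.lists.isCore (I := c.Q) (hL ▸ (mem_footCores.1 hC).1)
  have key := ncard_cores_le hF hF' (e := G.edge e)
    (X := (footCores G cores c e θ).image List.toFinset) (fun A hA => ((hmem A).1 hA).1)
    (by
      intro C hC
      obtain ⟨C, h, rfl⟩ := Finset.mem_image.1 hC
      exact hcore C h) hXne
    ((hP.quasi e).imp_right fun h A hA => h A (pos_of_mem_maxFamily hpos hA).2)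
    (by
      intro C hC A hA hCA
      obtain ⟨C, h, rfl⟩ := Finset.mem_image.1 hC
      replace hC := h
      obtain ⟨hAF, hA0⟩ := (hmem A).1 hA
      rw [inDeg_eq_zero] at hA0
      obtain ⟨hCL, hprobe, en, hen, hdist⟩ := mem_footCores.1 hC
      have hv := (hP.labels_inv hL hpos (hcore C hC)).1.valid en (mem_of_findLabel hen).1
      have hfoot : en ∈ feet G cores c e θ := mem_feet.2 ⟨C, hCL, hprobe, hen, hdist⟩
      have h2 : (G.edge e).2 ∈ lift A := by
        by_contra h2
        -- The path is known to cover halos only, so `A` is replaced by `A ∩ M`. The tail of the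
        -- path edge found lies in `M`, so that edge enters `A` as well.
        obtain ⟨M, hM, hMg⟩ := hF.exists_greatest_halo (hcore C hC)
        have hAM := hF.halo_inter hM hAF (hF.nonempty_inter (hcore C hC) hCA hM.core_subset)
        have hvset := mem_iff.1 (mem_of_findLabel hen).2
        simp only [lift, Finset.mem_map] at hvset
        obtain ⟨x, hx, hxe⟩ := hvset
        obtain ⟨e', he', h3, h4⟩ := hv.cover _ hAM x hx fun hxA => h2 (by
          rw [← hxe]; exact some_mem_lift.2 (Finset.mem_inter.1 hxA).1)
        have hi : ∀ w : Node G.n, w ∈ lift (A ∩ M) ↔ w ∈ lift A ∧ w ∈ lift M := by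
          intro w
          simp only [lift, Finset.map_inter, Finset.mem_inter]
        rw [hi] at h3 h4
        refine hA0 (G.edge e') (hS e' (hv.mem_R e' he') ?_) ⟨h3.1, fun h5 => h4 ⟨h5, ?_⟩⟩
        · simp only [Spider.has, Bool.or_eq_true, List.any_eq_true, decide_eq_true_eq]
          exact Or.inr ⟨en, hfoot, e', he', rfl⟩
        · exact hMg _ (hv.inHalo e' he').1
      refine ⟨?_, h2⟩
      by_contra h1
      exact hA0 (G.edge e) (hS e he (by simp [Spider.has])) ⟨h2, h1⟩)
    (by
      intro C hC
      obtain ⟨C, h, rfl⟩ := Finset.mem_image.1 hC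
      exact (hP.probe_eq_nil_iff hL hpos (hcore C h)).1 (mem_footCores.1 h).2.1)
  rw [hcard, ← hP.lists.length_eq Q'] at key
  have hν := hP.lists.length_eq c.Q
  rw [← hL] at hν
  change _ = {C | IsCore (c.family f) C}.ncard at hν
  rw [← hν] at key
  exact ⟨fun h => key.1 ((hP.inner_iff_inHalo hL hpos e).1 h), key.2⟩

end Spiders

/-! ### Lower bound on the cost of a cover -/

/-- Each `t` in `[0, β)` lies in at least `l` of the intervals `[a i, b i)`; integrating over `t`
gives the bound. -/
theorem mul_le_sum_max_sub {ι : Type*} (K : Finset ι) (a b : ι → ℝ) {β l : ℝ} (hβ : 0 ≤ β)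
    (ha : ∀ i, 0 ≤ a i) (hb : ∀ i, b i ≤ β)
    (h : ∀ t, 0 ≤ t → t < β → l ≤ ((K.filter fun i => a i ≤ t ∧ t < b i).card : ℝ)) :
    l * β ≤ ∑ i ∈ K, max (b i - a i) 0 := by
  have hint : ∀ i ∈ K, MeasureTheory.IntegrableOn
      ((Set.Ico (a i) (b i)).indicator fun _ => (1 : ℝ)) (Set.Ico 0 β) := by
    intro i _
    exact (MeasureTheory.integrable_indicator_iff measurableSet_Ico).2
      (MeasureTheory.integrableOn_const (by simp [Set.Ico_inter_Ico]))
  have h1 : ∫ t in Set.Ico 0 β, ∑ i ∈ K, (Set.Ico (a i) (b i)).indicator (fun _ => (1 : ℝ)) t =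
      ∑ i ∈ K, max (b i - a i) 0 := by
    rw [MeasureTheory.integral_finsetSum _ hint]
    refine Finset.sum_congr rfl fun i _ => ?_
    rw [MeasureTheory.setIntegral_indicator measurableSet_Ico, Set.Ico_inter_Ico,
      MeasureTheory.setIntegral_const, sup_eq_right.2 (ha i), inf_eq_right.2 (hb i),
      Real.volume_real_Ico, smul_eq_mul, mul_one]
  have h2 : ∫ _ in Set.Ico 0 β, l = l * β := by
    rw [MeasureTheory.setIntegral_const, Real.volume_real_Ico, sub_zero, max_eq_left hβ,
      smul_eq_mul, mul_comm]
  rw [← h1, ← h2]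
  refine MeasureTheory.setIntegral_mono_on (MeasureTheory.integrableOn_const (by simp))
    (MeasureTheory.integrable_finsetSum _ hint) measurableSet_Ico fun t ht => ?_
  refine (h t ht.1 ht.2).trans (le_of_eq ?_)
  rw [Finset.card_filter, Nat.cast_sum]
  refine Finset.sum_congr rfl fun i _ => ?_
  simp [Set.indicator_apply]

section Dual

variable {G : Network} {f : Finset (Fin G.n) → ℤ}
  {cores : List (DEdge G.n) → List (List (Fin G.n))} {c : Ctx G.n G.m}

/-- Balls around a core are halos, being unions of the label sets with distance at most `t`. A node
of such a set has its own label no farther away, by sortedness. -/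
theorem Problem.exists_halo_lt (hP : Problem G f cores) (hL : c.L = cores c.Q)
    (hpos : 0 < c.level f) {C : List (Fin G.n)} (hC : IsCore (c.family f) C.toFinset) {t : ℝ}
    (ht : 0 ≤ t) : ∃ A, Halo (c.family f) C.toFinset A ∧ ∀ w : Node G.n,
      w ∈ lift A ↔ ∃ en, findLabel (labels G cores c C) w = some en ∧ (en.dist : ℝ) ≤ t := by
  obtain ⟨hI, -⟩ := hP.labels_inv hL hpos hC
  have key : ∀ l : List (Label G.n G.m), (∀ en ∈ l, en ∈ labels G cores c C) →
      ∃ A, Halo (c.family f) C.toFinset A ∧ (∀ en ∈ l, en.set.toFinset ⊆ A) ∧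
        ∀ x ∈ A, x ∈ C.toFinset ∨ ∃ en ∈ l, x ∈ en.set.toFinset := by
    intro l hl
    induction l with
    | nil => exact ⟨_, hC.halo, by simp, fun x hx => Or.inl hx⟩
    | cons a l ih =>
      obtain ⟨A, hA, h1, h2⟩ := ih fun en hen => hl en (by simp [hen])
      refine ⟨A ∪ a.set.toFinset, (hP.family hpos).halo_union hC hA (hI.valid a (hl a (by simp))).halo,
        ?_, ?_⟩
      · intro en hen
        rcases List.mem_cons.1 hen with rfl | hen
        · exact Finset.subset_union_right
        · exact (h1 en hen).trans Finset.subset_union_left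
      · intro x hx
        rcases Finset.mem_union.1 hx with hx | hx
        · rcases h2 x hx with h | ⟨en, hen, h⟩
          · exact Or.inl h
          · exact Or.inr ⟨en, by simp [hen], h⟩
        · exact Or.inr ⟨a, by simp, hx⟩
  obtain ⟨A, hA, h1, h2⟩ := key ((labels G cores c C).filter fun en => decide ((en.dist : ℝ) ≤ t))
    fun en hen => (List.mem_filter.1 hen).1
  refine ⟨A, hA, fun w => ⟨fun hw => ?_, ?_⟩⟩
  · have hset : ∃ en ∈ labels G cores c C, (en.dist : ℝ) ≤ t ∧ w ∈ lift en.set.toFinset := by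
      simp only [lift, Finset.mem_map] at hw
      obtain ⟨x, hx, rfl⟩ := hw
      rcases h2 x hx with h | ⟨en, hen, h⟩
      -- Nodes of the core are within distance `0`, which is where `0 ≤ t` is used.
      · obtain ⟨en, hen, h0⟩ := hI.base
        exact ⟨en, hen, by rw [h0]; simpa using ht,
          some_mem_lift.2 ((hI.valid en hen).halo.core_subset h)⟩
      · rw [List.mem_filter, decide_eq_true_eq] at hen
        exact ⟨en, hen.1, hen.2, some_mem_lift.2 h⟩
    obtain ⟨en, hen, hd, hw⟩ := hset
    cases hl : findLabel (labels G cores c C) w with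
    | none =>
      have := findLabel_eq_none_iff.1 hl en hen
      rw [mem_iff.2 hw] at this
      simp at this
    | some a =>
      refine ⟨a, rfl, le_trans ?_ hd⟩
      exact_mod_cast findLabel_dist_le hI.sorted hl hen (mem_iff.2 hw)
  · rintro ⟨en, hen, hd⟩
    obtain ⟨h3, h4⟩ := mem_of_findLabel hen
    refine Finset.map_subset_map.2 (h1 en ?_) (mem_iff.1 h4)
    simpa [h3] using hd

variable (G cores c) in
/-- The distance from `w` to the core `C`, truncated at `β`. -/
def truncDist (β : ℚ) (C : List (Fin G.n)) (w : Node G.n) : ℚ :=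
  match findLabel (labels G cores c C) w with
  | none => β
  | some en => min en.dist β

theorem truncDist_le (β : ℚ) (C : List (Fin G.n)) (w : Node G.n) :
    truncDist G cores c β C w ≤ β := by
  unfold truncDist
  split
  · exact le_rfl
  · exact min_le_right _ _

theorem Problem.truncDist_nonneg (hP : Problem G f cores) (hL : c.L = cores c.Q)
    (hpos : 0 < c.level f) {C : List (Fin G.n)} (hC : IsCore (c.family f) C.toFinset) {β : ℚ}
    (hβ : 0 ≤ β) (w : Node G.n) : 0 ≤ truncDist G cores c β C w := by
  unfold truncDist
  split
  · exact hβ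
  · rename_i en hen
    exact le_min ((hP.labels_inv hL hpos hC).1.valid en (mem_of_findLabel hen).1).dist_nonneg hβ

theorem inDeg_map_val {K : Finset (Fin G.m)} {A : Finset (Fin G.n)}
    [DecidablePred fun e => Enters (G.edge e) A] :
    inDeg (K.val.map G.edge) A = (K.filter fun e => Enters (G.edge e) A).card := by
  rw [inDeg, Multiset.countP_map, Finset.card_def, Finset.filter_val]
  congr 1
  exact Multiset.filter_congr fun e _ => Iff.rfl

/-- The edges of a cover that enter the members of the halo family of `C`. -/
theorem Problem.level_mul_le (hP : Problem G f cores) (hL : c.L = cores c.Q)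
    (hpos : 0 < c.level f) {C : List (Fin G.n)} (hC : IsCore (c.family f) C.toFinset) {β : ℚ}
    (hβ : 0 ≤ β) {K : Finset (Fin G.m)}
    (hcov : ∀ A ∈ c.family f, c.level f ≤ inDeg (K.val.map G.edge) A) :
    (c.level f : ℚ) * β ≤ ∑ e ∈ K, max (truncDist G cores c β C (G.edge e).1 -
      truncDist G cores c β C (G.edge e).2) 0 := by
  classical
  -- For `t < β` an edge enters the ball of radius `t` exactly if the truncated distance is at most
  -- `t` at its head and exceeds `t` at its tail. The cover supplies at least `level` such edges.
  have h := mul_le_sum_max_sub K (fun e => (truncDist G cores c β C (G.edge e).2 : ℝ))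
    (fun e => (truncDist G cores c β C (G.edge e).1 : ℝ)) (β := β) (l := c.level f)
    (by exact_mod_cast hβ) (fun e => by exact_mod_cast hP.truncDist_nonneg hL hpos hC hβ _)
    (fun e => by exact_mod_cast truncDist_le _ _ _) fun t ht htβ => by
      obtain ⟨A, hA, hmem⟩ := hP.exists_halo_lt hL hpos hC ht
      have hA' : ∀ w, w ∈ lift A ↔ (truncDist G cores c β C w : ℝ) ≤ t := by
        intro w
        rw [hmem, truncDist]
        cases findLabel (labels G cores c C) w with
        | none => simpa using htβ
        | some en =>
          simp only [Option.some_inj, exists_eq_left', Rat.cast_min, min_le_iff]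
          exact ⟨Or.inl, fun h => h.resolve_right (not_le.2 htβ)⟩
      have := hcov A hA.mem
      rw [inDeg_map_val] at this
      refine le_trans (b := (((K.filter fun e => Enters (G.edge e) A).card : ℤ) : ℝ))
        (by exact_mod_cast this) (le_of_eq ?_)
      rw [Int.cast_natCast]
      congr 2
      refine Finset.filter_congr fun e _ => ?_
      rw [Enters, hA', hA', not_le]
  exact_mod_cast h

/-- Dual feasibility at an edge. Only cores near its head are charged: `X` are those whose halos `e`
enters, `Y` those whose halos contain its tail too. The feet in `X` are paid for by the price of a
spider, and `Y` has at most one element. -/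
theorem Problem.sum_load_le (hP : Problem G f cores) (hL : c.L = cores c.Q)
    (hpos : 0 < c.level f) {β : ℚ} (hβ : 0 ≤ β)
    (hs : ∀ b ∈ spiders G cores c, 2 * β * b.feet.length ≤ b.price) {e : Fin G.m} (he : e ∈ c.R) :
    ∑ C ∈ c.L.toFinset, max (truncDist G cores c β C (G.edge e).1 -
      truncDist G cores c β C (G.edge e).2) 0 ≤ G.cost e := by
  classical
  have hF := hP.family hpos
  have hcore : ∀ C ∈ c.L, IsCore (c.family f) C.toFinset :=
    fun C hC => hP.lists.isCore (I := c.Q) (hL ▸ hC)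
  set load := fun C => max (truncDist G cores c β C (G.edge e).1 -
      truncDist G cores c β C (G.edge e).2) 0 with hload
  let near : List (Fin G.n) → Prop := fun C =>
    ∃ en, findLabel (labels G cores c C) (G.edge e).2 = some en ∧ en.dist < β
  have hnear : ∀ C, ¬ near C → load C = 0 := by
    intro C h
    have h1 := truncDist_le (G := G) (cores := cores) (c := c) β C (G.edge e).1
    have h2 : truncDist G cores c β C (G.edge e).2 = β := by
      unfold truncDist
      split
      · rfl
      · rename_i en hen
        exact min_eq_right (not_lt.1 fun h' => h ⟨en, hen, h'⟩)
    simp only [hload]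
    rw [h2]
    exact max_eq_right (by linarith)
  have hcost := G.cost_nonneg e
  set X := c.L.toFinset.filter fun C => near C ∧ probe G cores c C (G.edge e).1 = []
  set Y := c.L.toFinset.filter fun C => near C ∧ probe G cores c C (G.edge e).1 ≠ []
  have hmX : ∀ C ∈ X, C ∈ c.L ∧ near C ∧ probe G cores c C (G.edge e).1 = [] := by
    intro C hC
    simpa [X] using hC
  have hmY : ∀ C ∈ Y, C ∈ c.L ∧ near C ∧ probe G cores c C (G.edge e).1 ≠ [] := by
    intro C hC
    simpa [Y] using hC
  have hsplit : ∑ C ∈ c.L.toFinset, load C = ∑ C ∈ X, load C + ∑ C ∈ Y, load C := by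
    rw [← Finset.sum_filter_add_sum_filter_not c.L.toFinset
      (fun C => near C ∧ probe G cores c C (G.edge e).1 = [])]
    congr 1
    refine (Finset.sum_subset ?_ ?_).symm
    · intro C hC
      simp only [Y, Finset.mem_filter] at hC ⊢
      exact ⟨hC.1, fun h => hC.2.2 h.2⟩
    · intro C hC hC'
      refine hnear C fun h => hC' ?_
      simp only [Y, Finset.mem_filter] at hC ⊢
      exact ⟨hC.1, h, fun h' => hC.2 ⟨h, h'⟩⟩
  have hinH : ∀ C ∈ c.L, near C → InHalo (c.family f) C.toFinset (G.edge e).2 := by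
    rintro C hC ⟨en, hen, -⟩
    obtain ⟨h1, h2⟩ := mem_of_findLabel hen
    exact ⟨_, ((hP.labels_inv hL hpos (hcore C hC)).1.valid en h1).halo, mem_iff.1 h2⟩
  -- The greatest halos of both cores contain both ends of `e`, one of which is a terminal.
  have hYsub : ∀ C ∈ Y, ∀ D ∈ Y, C = D := by
    intro C hC D hD
    obtain ⟨hC1, hC2, hC3⟩ := hmY C hC
    obtain ⟨hD1, hD2, hD3⟩ := hmY D hD
    obtain ⟨M, hM, hMg⟩ := hF.exists_greatest_halo (hcore C hC1)
    obtain ⟨M', hM', hMg'⟩ := hF.exists_greatest_halo (hcore D hD1)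
    have a1 := hMg _ (hP.inHalo_of_probe hL hpos (hcore C hC1) hC3)
    have a2 := hMg _ (hinH C hC1 hC2)
    have b1 := hMg' _ (hP.inHalo_of_probe hL hpos (hcore D hD1) hD3)
    have b2 := hMg' _ (hinH D hD1 hD2)
    have hcommon : (M ∩ M' ∩ G.T).Nonempty := by
      have key : ∀ u : Node G.n, u ∈ lift M → u ∈ lift M' → u ∈ lift G.T →
          (M ∩ M' ∩ G.T).Nonempty := by
        intro u ha hb ht
        cases u with
        | none => exact absurd ha none_notMem_lift
        | some x =>
          rw [some_mem_lift] at ha hb ht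
          exact ⟨x, by simp [ha, hb, ht]⟩
      rcases hP.quasi e with (h | h) | h
      · exact key _ a1 b1 h
      · exact key _ a2 b2 h
      · exact absurd ⟨a1, a2⟩ (h M (pos_of_mem_maxFamily hpos hM.mem).2)
    exact List.inj_on_of_nodup_map (hP.lists.nodup_map c.Q) (hL ▸ hC1) (hL ▸ hD1)
      (hF.halo_core_eq hM hM' hcommon)
  have hloadY : ∀ C ∈ Y, load C ≤ G.cost e ∧ load C ≤ β := by
    intro C hC
    obtain ⟨hC1, ⟨en, hen, hd⟩, hC3⟩ := hmY C hC
    have h0 := hP.truncDist_nonneg hL hpos (hcore C hC1) hβ (G.edge e).2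
    have h1 := truncDist_le (G := G) (cores := cores) (c := c) β C (G.edge e).1
    obtain ⟨a, ha, had⟩ := hP.exists_label hL hpos (hcore C hC1) he
      (hP.inHalo_of_probe hL hpos (hcore C hC1) hC3) hen
    refine ⟨max_le ?_ hcost, max_le (by linarith) hβ⟩
    simp only [truncDist, ha, hen]
    rw [min_eq_left hd.le]
    linarith [min_le_left a.dist β]
  have hloadX : ∑ C ∈ X, load C ≤ β * X.card - ∑ C ∈ X, distTo G cores c C (G.edge e).2 := by
    have : β * X.card - ∑ C ∈ X, distTo G cores c C (G.edge e).2 =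
        ∑ C ∈ X, (β - distTo G cores c C (G.edge e).2) := by
      rw [Finset.sum_sub_distrib, Finset.sum_const, nsmul_eq_mul, mul_comm]
    rw [this]
    refine Finset.sum_le_sum fun C hC => ?_
    obtain ⟨hC1, ⟨en, hen, hd⟩, hC3⟩ := hmX C hC
    have h1 := truncDist_le (G := G) (cores := cores) (c := c) β C (G.edge e).1
    have h2 : truncDist G cores c β C (G.edge e).2 = en.dist := by
      simp only [truncDist, hen, min_eq_left hd.le]
    have h3 : distTo G cores c C (G.edge e).2 = en.dist := by simp [distTo, hen]
    simp only [hload]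
    rw [h2, h3]
    exact max_le (by linarith) (by linarith)
  have hprice : X.Nonempty → 2 * β * X.card ≤ (if inner G cores c e = true then 1 else 2) *
      (G.cost e + ∑ C ∈ X, distTo G cores c C (G.edge e).2) := by
    intro hX
    obtain ⟨C, hC, hmax⟩ := X.exists_max_image (fun C => distTo G cores c C (G.edge e).2) hX
    obtain ⟨hC1, ⟨en, hen, hd⟩, hC3⟩ := hmX C hC
    have hdC : distTo G cores c C (G.edge e).2 = en.dist := by simp [distTo, hen]
    -- With the largest distance occurring in `X` as radius, the feet are exactly `X`.
    have hfX : footCores G cores c e en.dist = X := by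
      ext D
      rw [mem_footCores]
      simp only [X, near, Finset.mem_filter, List.mem_toFinset]
      constructor
      · rintro ⟨h1, h2, a, ha, had⟩
        exact ⟨h1, ⟨a, ha, had.trans_lt hd⟩, h2⟩
      · rintro ⟨h1, ⟨a, ha, had⟩, h2⟩
        refine ⟨h1, h2, a, ha, ?_⟩
        have := hmax D (by simp only [X, near, Finset.mem_filter, List.mem_toFinset]
                           exact ⟨h1, ⟨a, ha, had⟩, h2⟩)
        simp only [hdC] at this
        simpa [distTo, ha] using this
    obtain ⟨hl, hsum⟩ := feet_sum (cores := cores) (hP.nodup_cores hL) e en.dist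
    rw [hfX] at hl hsum
    have hne : feet G cores c e en.dist ≠ [] := by
      rw [← List.length_pos_iff, hl]
      exact hX.card_pos
    have := hs _ (mem_spiders.2 ⟨e, he, C, hC1, en, (mem_of_findLabel hen).1, hne, rfl⟩)
    rw [price_eq, hsum] at this
    simpa only [hl] using this
  rw [hsplit]
  have hdX : ∀ C ∈ X, 0 ≤ distTo G cores c C (G.edge e).2 := by
    intro C hC
    obtain ⟨hC1, ⟨en, hen, hd⟩, hC3⟩ := hmX C hC
    have h3 : distTo G cores c C (G.edge e).2 = en.dist := by simp [distTo, hen]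
    rw [h3]
    exact ((hP.labels_inv hL hpos (hcore C hC1)).1.valid en (mem_of_findLabel hen).1).dist_nonneg
  have hdX' := Finset.sum_nonneg hdX
  rcases Y.eq_empty_or_nonempty with hY | ⟨C, hC⟩
  · rw [hY, Finset.sum_empty, add_zero]
    rcases X.eq_empty_or_nonempty with hX | hX
    · rw [hX, Finset.sum_empty]
      exact hcost
    · have := hprice hX
      -- The factor `1` or `2` in the price is at most `2`, so `β * |X|` is at most the cost plus
      -- the distances.
      split at this <;> linarith
  · have hYs : Y = {C} := Finset.eq_singleton_iff_unique_mem.2 ⟨hC, fun D hD => hYsub D hD C hC⟩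
    rw [hYs, Finset.sum_singleton]
    obtain ⟨h1, h2⟩ := hloadY C hC
    rcases X.eq_empty_or_nonempty with hX | hX
    · rw [hX, Finset.sum_empty, zero_add]
      exact h1
    · obtain ⟨hC1, hC2, hC3⟩ := hmY C hC
      have hin : inner G cores c e = true := inner_iff e |>.2
        ⟨C, hC1, hC3, (hP.probe_of_inHalo hL hpos (hcore C hC1) (hinH C hC1 hC2)).1⟩
      have := hprice hX
      -- Here `e` is inner and the price is not doubled, so the load of `X` is at most `cost - β *
      -- |X|`; this leaves room for the load of `Y`, which is at most `β`.
      rw [if_pos hin] at this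
      have hcard : (1 : ℚ) ≤ X.card := by exact_mod_cast hX.card_pos
      have := mul_le_mul_of_nonneg_left hcard hβ
      linarith

/-- If all spiders are expensive, then so is every cover. -/
theorem Problem.dual_bound (hP : Problem G f cores) (hL : c.L = cores c.Q)
    (hpos : 0 < c.level f) {β : ℚ} (hβ : 0 ≤ β)
    (hs : ∀ b ∈ spiders G cores c, 2 * β * b.feet.length ≤ b.price) {K : Finset (Fin G.m)}
    (hK : ∀ e ∈ K, e ∈ c.R) (hcov : ∀ A ∈ c.family f, c.level f ≤ inDeg (K.val.map G.edge) A) :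
    (c.level f : ℚ) * c.L.length * β ≤ G.totalCost K := by
  have h1 : ∑ C ∈ c.L.toFinset, (c.level f : ℚ) * β ≤
      ∑ C ∈ c.L.toFinset, ∑ e ∈ K, max (truncDist G cores c β C (G.edge e).1 -
        truncDist G cores c β C (G.edge e).2) 0 :=
    Finset.sum_le_sum fun C hC => hP.level_mul_le hL hpos
      (hP.lists.isCore (I := c.Q) (hL ▸ List.mem_toFinset.1 hC)) hβ hcov
  rw [Finset.sum_comm, Finset.sum_const, List.toFinset_card_of_nodup (hP.nodup_cores hL),
    nsmul_eq_mul] at h1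
  have h2 := Finset.sum_le_sum fun e (he : e ∈ K) => hP.sum_load_le hL hpos hβ hs (hK e he)
  rw [Network.totalCost]
  linarith

end Dual

/-! ### One iteration -/

section Improve

variable {G : Network} {f : Finset (Fin G.n) → ℤ}
  {cores : List (DEdge G.n) → List (List (Fin G.n))} {c : Ctx G.n G.m}

/-- The two lists partition the set of edges. -/
structure Split {m : ℕ} (s : List (Fin m) × List (Fin m)) : Prop where
  nodup_fst : s.1.Nodup
  nodup_snd : s.2.Nodup
  mem_iff : ∀ e, e ∈ s.1 ↔ e ∉ s.2

/-- The edges of a spider cost at most the sum of its lengths. -/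
theorem Problem.cost_spider_le (hP : Problem G f cores) (hL : c.L = cores c.Q)
    (hpos : 0 < c.level f) (hR : c.R.Nodup) {b : Spider G.n G.m} (hb : b ∈ spiders G cores c) :
    ((c.R.filter b.has).map G.cost).sum ≤ G.cost b.edge + (b.feet.map Label.dist).sum := by
  obtain ⟨e, he, C₀, hC₀, en₀, hen₀, hne, rfl⟩ := mem_spiders.1 hb
  dsimp only
  set X := feet G cores c e en₀.dist with hX
  have hvalid : ∀ en ∈ X, en.dist = (en.path.map G.cost).sum := by
    intro en hen
    obtain ⟨C, hC, -, hen', -⟩ := mem_feet.1 (hX ▸ hen)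
    exact ((hP.labels_inv hL hpos (hP.lists.isCore (I := c.Q) (hL ▸ hC))).1.valid en
      (mem_of_findLabel hen').1).dist_eq
  have hsum : G.cost e + (X.map Label.dist).sum = ((e :: X.flatMap Label.path).map G.cost).sum := by
    rw [List.map_cons, List.sum_cons, List.map_congr_left hvalid, List.map_flatMap,
      List.flatMap_def, List.sum_flatten, List.map_map]
    rfl
  rw [hsum]
  -- Edges shared by several paths are bought once but counted with each path, hence only an
  -- inequality.
  obtain ⟨l', hperm, hsub⟩ := (hR.filter (Spider.has ⟨e, price G cores c e X, X⟩)).subperm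
    (l₂ := e :: X.flatMap Label.path) (by
      intro x hx
      have := (List.mem_filter.1 hx).2
      simp only [Spider.has, Bool.or_eq_true, List.any_eq_true, decide_eq_true_eq] at this
      rcases this with rfl | ⟨en, hen, y, hy, rfl⟩
      · simp
      · exact List.mem_cons_of_mem _ (List.mem_flatMap.2 ⟨en, hen, hy⟩))
  rw [← (hperm.map _).sum_eq]
  refine (hsub.map G.cost).sum_le_sum fun x hx => ?_
  obtain ⟨y, -, rfl⟩ := List.mem_map.1 hx
  exact G.cost_nonneg y

/-- Edges of `J` that are no longer available have been bought and are already counted in the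
residual function; the others must supply the whole level. -/
theorem Split.cover {s : List (Fin G.m) × List (Fin G.m)} (hs : Split s)
    (hpos : 0 < (context G cores s).level f) {J : Finset (Fin G.m)} (hJ : G.Covers f J)
    {A : Finset (Fin G.n)} (hA : A ∈ (context G cores s).family f) :
    (context G cores s).level f ≤ inDeg ((J.filter (· ∈ s.1)).val.map G.edge) A := by
  have h1 := (pos_of_mem_maxFamily hpos hA).1
  have h2 := hJ A
  have h3 : inDeg (J.val.map G.edge) A ≤
      inDeg ((J.filter (· ∈ s.1)).val.map G.edge) A +
        inDeg ((context G cores s).Q : Multiset (DEdge G.n)) A := by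
    rw [← Multiset.filter_add_not (· ∈ s.1) J.val, Multiset.map_add, inDeg_add, Finset.filter_val]
    refine Nat.add_le_add_left ?_ _
    simp only [context, Multiset.coe_reverse]
    rw [← Multiset.map_coe]
    refine Multiset.countP_le_of_le _ (Multiset.map_le_map ?_)
    refine (Multiset.le_iff_subset (J.nodup.filter _)).2 fun e he => ?_
    rw [Multiset.mem_filter, hs.mem_iff, not_not] at he
    exact Multiset.mem_coe.2 he.2
  change f A = (context G cores s).level f + _ at h1
  omega

theorem totalCost_mono {J K : Finset (Fin G.m)} (h : J ⊆ K) : G.totalCost J ≤ G.totalCost K :=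
  Finset.sum_le_sum_of_subset_of_nonneg h fun e _ _ => G.cost_nonneg e

theorem totalCost_nonneg (J : Finset (Fin G.m)) : 0 ≤ G.totalCost J :=
  Finset.sum_nonneg fun e _ => G.cost_nonneg e

theorem Problem.headD_ne_nil (hP : Problem G f cores) {I : List (DEdge G.n)}
    (hpos : 0 < maxVal (residual f (I : Multiset (DEdge G.n)))) : (cores I).headD [] ≠ [] := by
  intro h
  have h1 := hP.lists.isCore_headD I
  rw [h] at h1
  have := (intersectingFamily_residual hP.super hP.meets hpos).meets _ h1.prop
  simp at this

theorem CoreLists.headD_eq_nil (h : CoreLists f cores) {I : List (DEdge G.n)}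
    (h0 : maxVal (residual f (I : Multiset (DEdge G.n))) = 0) : (cores I).headD [] = [] := by
  have h1 := h.isCore_headD I
  have h2 : (∅ : Finset (Fin G.n)) ∈ maxFamily (residual f (I : Multiset (DEdge G.n))) := by
    change _ = _
    rw [h0]
    exact ((le_maxVal _ _).trans h0.le).antisymm (le_max_right _ _)
  have h3 := h1.eq_of_le h2 (Finset.empty_subset _)
  exact List.toFinset_eq_empty_iff _ |>.1 h3.symm

/-- The cost `w` of a round is charged to the cores it removes or, if the level drops, to the level.
Both bounds compare the density of the chosen spider with `Problem.dual_bound`. -/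
theorem Problem.improve_spec (hP : Problem G f cores) {s : List (Fin G.m) × List (Fin G.m)}
    (hs : Split s) (hpos : 0 < (context G cores s).level f) {J : Finset (Fin G.m)}
    (hJ : G.Covers f J) :
    Split (improve G cores s) ∧ (improve G cores s).1.length < s.1.length ∧
      ∃ w : ℚ, ((improve G cores s).2.map G.cost).sum = w + (s.2.map G.cost).sum ∧
        (((context G cores (improve G cores s)).level f = (context G cores s).level f ∧
          (context G cores (improve G cores s)).L.length ≤ (context G cores s).L.length ∧
          w * (context G cores s).level f * (context G cores s).L.length ≤ 2 * G.totalCost J *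
            ((context G cores s).L.length - (context G cores (improve G cores s)).L.length)) ∨
        ((context G cores (improve G cores s)).level f < (context G cores s).level f ∧
          w * (context G cores s).level f ≤ 2 * G.totalCost J)) := by
  set c := context G cores s with hc
  have hL : c.L = cores c.Q := rfl
  have hR : c.R = s.1 := rfl
  have hK : ∀ e ∈ J.filter (· ∈ s.1), e ∈ c.R := fun e he => (Finset.mem_filter.1 he).2
  have hKJ : G.totalCost (J.filter (· ∈ s.1)) ≤ G.totalCost J :=
    totalCost_mono (Finset.filter_subset _ _)
  have hlev : (1 : ℚ) ≤ c.level f := by exact_mod_cast hpos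
  have hν : 0 < c.L.length := by
    have := hP.headD_ne_nil hpos
    rw [List.length_pos_iff]
    intro h
    rw [← hL, h] at this
    simp at this
  have hν' : (1 : ℚ) ≤ c.L.length := by exact_mod_cast hν
  obtain ⟨b, hb⟩ : ∃ b, (spiders G cores c).argmin Spider.density = some b := by
    rw [← Option.ne_none_iff_exists']
    intro h
    have h0 := totalCost_nonneg (G := G) J
    -- Without spiders the dual bound holds for every `β`, contradicting the existence of the cover
    -- `J`.
    have h1 := hP.dual_bound hL hpos (β := G.totalCost J + 1) (by linarith)
      (by rw [List.argmin_eq_none.1 h]; simp) hK fun A hA => hs.cover hpos hJ hA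
    have h2 : (1 : ℚ) ≤ c.level f * c.L.length := one_le_mul_of_one_le_of_one_le hlev hν'
    nlinarith
  have himp : improve G cores s = ((s.1.filter fun e => !b.has e).reverse,
      s.1.filter b.has ++ s.2) := by
    have hne : ¬ (context G cores s).L.headD [] = [] := hP.headD_ne_nil hpos
    rw [improve, if_neg hne]
    simp only [← hc, hb]
  have hbm := List.argmin_mem hb
  have hmin : ∀ b' ∈ spiders G cores c, b.density ≤ b'.density :=
    fun b' hb' => List.le_of_mem_argmin hb' hb
  have hfeet : ∀ b' ∈ spiders G cores c, (0 : ℚ) < b'.feet.length := by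
    intro b' hb'
    obtain ⟨e, -, C, -, en, -, hne, rfl⟩ := mem_spiders.1 hb'
    exact_mod_cast List.length_pos_iff.2 hne
  have hbf := hfeet b hbm
  have hw := hP.cost_spider_le hL hpos hs.nodup_fst hbm
  rw [hR] at hw
  set w := ((s.1.filter b.has).map G.cost).sum with hwdef
  have hw0 : 0 ≤ w := List.sum_nonneg fun x hx => by
    obtain ⟨e, -, rfl⟩ := List.mem_map.1 hx
    exact G.cost_nonneg e
  have hprice : b.price = (if inner G cores c b.edge = true then 1 else 2) *
      (G.cost b.edge + (b.feet.map Label.dist).sum) := by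
    obtain ⟨e, -, C, -, en, -, hne, rfl⟩ := mem_spiders.1 hbm
    exact price_eq _ _
  have hbe : b.edge ∈ s.1 ∧ b.feet.length ≤ c.L.length := by
    obtain ⟨e, he, C, -, en, -, hne, rfl⟩ := mem_spiders.1 hbm
    refine ⟨he, ?_⟩
    rw [(feet_sum (hP.nodup_cores hL) e en.dist).1,
      ← List.toFinset_card_of_nodup (hP.nodup_cores hL)]
    exact Finset.card_le_card (Finset.filter_subset _ _)
  have hprice0 : 0 ≤ b.price := by
    rw [hprice]
    refine mul_nonneg ?_ (hw0.trans hw)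
    split <;> norm_num
  have hdual : b.price * c.level f * c.L.length ≤ 2 * G.totalCost J * b.feet.length := by
    -- The largest radius allowed by the least density.
    have h1 := hP.dual_bound hL hpos (β := b.density / 2)
      (div_nonneg (div_nonneg hprice0 hbf.le) (by norm_num))
      (fun b' hb' => by
        have h2 := hmin b' hb'
        rw [Spider.density, Spider.density, le_div_iff₀ (hfeet b' hb')] at h2
        rw [Spider.density]
        linarith) hK fun A hA => hs.cover hpos hJ hA
    have h2 : b.density * b.feet.length = b.price := div_mul_cancel₀ _ hbf.ne'
    have h3 := mul_le_mul_of_nonneg_right (h1.trans hKJ) hbf.le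
    have h4 : (c.level f : ℚ) * c.L.length * (b.density / 2) * b.feet.length =
        b.price * c.level f * c.L.length / 2 := by rw [← h2]; ring
    rw [h4] at h3
    linarith
  rw [himp]
  refine ⟨⟨?_, ?_, ?_⟩, ?_, w, ?_, ?_⟩
  · exact List.nodup_reverse.2 (hs.nodup_fst.filter _)
  · refine (hs.nodup_fst.filter _).append hs.nodup_snd fun e he he' => ?_
    exact (hs.mem_iff e).1 (List.mem_filter.1 he).1 he'
  · intro e
    simp only [List.mem_reverse, List.mem_filter, List.mem_append, hs.mem_iff e]
    cases b.has e <;> simp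
  · rw [List.length_reverse]
    refine List.length_filter_lt_length_iff_exists.2 ⟨b.edge, hbe.1, ?_⟩
    simp [Spider.has]
  · rw [List.map_append, List.sum_append]
  · set s' := ((s.1.filter fun e => !b.has e).reverse, s.1.filter b.has ++ s.2)
    have hQ' : ((context G cores s').Q : Multiset (DEdge G.n)) =
        (((s.1.filter b.has).map G.edge : List (DEdge G.n)) : Multiset (DEdge G.n)) + c.Q := by
      simp only [context, s', hc, Multiset.coe_reverse, List.map_append, Multiset.coe_add]
    have hle : (context G cores s').level f ≤ c.level f := by
      simp only [Ctx.level]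
      rw [hQ']
      exact maxVal_residual_le _ _
    rcases hle.lt_or_eq with hlt | heq
    · refine Or.inr ⟨hlt, ?_⟩
      have h1 : w ≤ b.price := by
        rw [hprice]
        split <;> linarith
      have h2 : (b.feet.length : ℚ) ≤ c.L.length := by exact_mod_cast hbe.2
      have h3 : w * c.level f * c.L.length ≤ 2 * G.totalCost J * c.L.length := by
        refine le_trans ?_ (hdual.trans ?_)
        · gcongr
        · have := totalCost_nonneg (G := G) J
          gcongr
      exact le_of_mul_le_mul_right h3 (by linarith)
    · have hdec := hP.decrease hL hpos hbm (S := (s.1.filter b.has).map G.edge)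
        (Q' := (context G cores s').Q)
        (fun e he hbe' => List.mem_map_of_mem (List.mem_filter.2 ⟨he, hbe'⟩)) hQ' heq
      rw [show cores (context G cores s').Q = (context G cores s').L from rfl] at hdec
      refine Or.inl ⟨heq, by omega, ?_⟩
      have h0 := totalCost_nonneg (G := G) J
      have hlν : (0 : ℚ) ≤ c.level f * c.L.length := by positivity
      -- Inner: the spider costs at most its price and removes a core per foot. Not inner: it costs
      -- at most half its price and removes at least half as many. The resulting inequality is the
      -- same.
      by_cases hin : inner G cores c b.edge = true
      · rw [if_pos hin] at hprice
        have h1 : ((context G cores s').L.length : ℚ) + b.feet.length ≤ c.L.length := by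
          exact_mod_cast hdec.1 hin
        have h2 : w ≤ b.price := by linarith
        have h3 := mul_le_mul_of_nonneg_right h2 hlν
        have h4 := mul_le_mul_of_nonneg_left h1 h0
        linarith
      · rw [if_neg hin] at hprice
        have h1 : 2 * ((context G cores s').L.length : ℚ) + b.feet.length ≤ 2 * c.L.length := by
          exact_mod_cast hdec.2
        have h2 : 2 * w ≤ b.price := by linarith
        have h3 := mul_le_mul_of_nonneg_right h2 hlν
        have h4 := mul_le_mul_of_nonneg_left h1 h0
        linarith

end Improve

/-! ### The approximation ratio -/

/-- Each of the `b - a` additional terms is at least `1 / b`. -/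
theorem div_le_harmonic_sub {a b : ℕ} (h : a ≤ b) :
    ((b : ℝ) - a) / b ≤ (harmonic b : ℝ) - harmonic a := by
  have key : ∀ k : ℕ, a + k ≤ b → (k : ℝ) / b ≤ (harmonic (a + k) : ℝ) - harmonic a := by
    intro k
    induction k with
    | zero => simp
    | succ k ih =>
      intro hk
      have h1 := ih (by omega)
      rw [← add_assoc, harmonic_succ]
      push_cast
      have h2 : (1 : ℝ) / b ≤ ((a : ℝ) + k + 1)⁻¹ := by
        rw [one_div]
        refine inv_anti₀ (by positivity) ?_
        exact_mod_cast hk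
      rw [add_div]
      linarith
  have := key (b - a) (by omega)
  rwa [Nat.add_sub_cancel' h, Nat.cast_sub h] at this

theorem harmonic_nonneg (n : ℕ) : (0 : ℝ) ≤ harmonic n := by
  have : (0 : ℚ) ≤ harmonic n := Finset.sum_nonneg fun i _ => by positivity
  exact_mod_cast this

/-- The bound on the cost still to be paid, per half of the cost of a cover, when the residual
function has maximum `l` and there are `ν` cores. -/
noncomputable def potential (T : ℕ) (l ν : ℕ) : ℝ :=
  if l = 0 then 0 else (1 + Real.log T) * harmonic (l - 1) + harmonic ν / l

theorem potential_nonneg (T l ν : ℕ) : 0 ≤ potential T l ν := by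
  unfold potential
  split
  · exact le_rfl
  · have := harmonic_nonneg (l - 1)
    have := harmonic_nonneg ν
    have := Real.log_natCast_nonneg T
    positivity

/-- Since `H(ν) ≤ 1 + ln ν ≤ 1 + ln T`, the term of the current level is at most the summand that
extends `H(l - 1)` to `H(l)`. -/
theorem potential_le {T l ν : ℕ} (hν : 0 < ν) (hT : ν ≤ T) :
    potential T l ν ≤ (1 + Real.log T) * harmonic l := by
  have hlog := Real.log_natCast_nonneg T
  unfold potential
  split
  · exact mul_nonneg (by linarith) (harmonic_nonneg _)
  · rename_i hl
    obtain ⟨k, rfl⟩ := Nat.exists_eq_succ_of_ne_zero hl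
    have h1 : (harmonic ν : ℝ) ≤ 1 + Real.log T :=
      (harmonic_le_one_add_log ν).trans (by
        have : Real.log ν ≤ Real.log T :=
          Real.log_le_log (by exact_mod_cast hν) (by exact_mod_cast hT)
        linarith)
    rw [Nat.succ_eq_add_one, Nat.add_sub_cancel, harmonic_succ]
    push_cast
    rw [mul_add, div_eq_mul_inv]
    gcongr

theorem le_potential_sub {T l ν ν' : ℕ} (hl : 0 < l) (hν : ν' ≤ ν) :
    ((ν : ℝ) - ν') / (l * ν) ≤ potential T l ν - potential T l ν' := by
  unfold potential
  rw [if_neg hl.ne', if_neg hl.ne']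
  have h := div_le_div_of_nonneg_right (div_le_harmonic_sub hν) (Nat.cast_nonneg (α := ℝ) l)
  rw [div_div, mul_comm (ν : ℝ), sub_div _ _ (l : ℝ)] at h
  linarith

/-- The new potential is absorbed by the terms of the levels below `l`, so all of `H(ν) / l ≥ 1 / l`
is released. -/
theorem le_potential_sub_of_lt {T l l' ν ν' : ℕ} (hl : l' < l) (hν : 0 < ν) (hν' : 0 < ν')
    (hT : ν' ≤ T) : 1 / (l : ℝ) ≤ potential T l ν - potential T l' ν' := by
  have hlog := Real.log_natCast_nonneg T
  have h1 := potential_le (l := l') hν' hT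
  have h2 : (harmonic l' : ℝ) ≤ harmonic (l - 1) := by
    have := div_le_harmonic_sub (show l' ≤ l - 1 by omega)
    have h3 : (l' : ℝ) ≤ ((l - 1 : ℕ) : ℝ) := by exact_mod_cast (show l' ≤ l - 1 by omega)
    have h4 : 0 ≤ (((l - 1 : ℕ) : ℝ) - l') / ((l - 1 : ℕ) : ℝ) :=
      div_nonneg (by linarith) (Nat.cast_nonneg _)
    linarith
  have h3 : (1 : ℝ) ≤ harmonic ν := by
    have := div_le_harmonic_sub (show 1 ≤ ν from hν)
    have h4 : (1 : ℝ) ≤ ν := by exact_mod_cast hν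
    have h5 : 0 ≤ ((ν : ℝ) - (1 : ℕ)) / ν := div_nonneg (by push_cast; linarith) (by linarith)
    have h6 : (harmonic 1 : ℝ) = 1 := by norm_num [harmonic]
    linarith
  have h4 : potential T l ν = (1 + Real.log T) * harmonic (l - 1) + harmonic ν / l := by
    rw [potential, if_neg (by omega)]
  rw [h4]
  have h5 := mul_le_mul_of_nonneg_left h2 (show 0 ≤ 1 + Real.log T by linarith)
  have h6 := div_le_div_of_nonneg_right h3 (Nat.cast_nonneg (α := ℝ) l)
  linarith

section Solution

variable {G : Network} {f : Finset (Fin G.n) → ℤ}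
  {cores : List (DEdge G.n) → List (List (Fin G.n))}

/-- Distinct cores share no terminal, so choosing a terminal in each is injective. -/
theorem IntersectingFamily.ncard_cores_le {n : ℕ} {T : Finset (Fin n)} {F : Set (Finset (Fin n))}
    (hF : IntersectingFamily T F) : {C | IsCore F C}.ncard ≤ T.card := by
  have h : ∀ C ∈ {C | IsCore F C}, ∃ t, t ∈ C ∩ T := fun C hC => hF.meets C (Minimal.prop hC)
  rcases {C | IsCore F C}.eq_empty_or_nonempty with h0 | ⟨C, hC⟩
  · simp [h0]
  have : Nonempty (Fin n) := ⟨(h C hC).choose⟩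
  choose! φ hφ using h
  rw [← Set.ncard_coe_finset]
  refine Set.ncard_le_ncard_of_injOn φ (fun C hC => ?_) (fun C hC D hD h => ?_) (Set.toFinite _)
  · exact (Finset.mem_inter.1 (hφ C hC)).2
  · obtain ⟨h1, h2⟩ := Finset.mem_inter.1 (hφ C hC)
    exact hF.core_eq hC hD ⟨φ C, by
      rw [Finset.mem_inter, Finset.mem_inter]
      exact ⟨⟨h1, h ▸ (Finset.mem_inter.1 (hφ D hD)).1⟩, h2⟩⟩

variable (G f cores) in
/-- The potential of the current state. -/
noncomputable def statePotential (s : List (Fin G.m) × List (Fin G.m)) : ℝ :=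
  potential G.T.card ((context G cores s).level f).toNat (context G cores s).L.length

theorem Problem.card_bounds (hP : Problem G f cores) {s : List (Fin G.m) × List (Fin G.m)}
    (hpos : 0 < (context G cores s).level f) : 0 < (context G cores s).L.length ∧
      (context G cores s).L.length ≤ G.T.card := by
  constructor
  · have := hP.headD_ne_nil hpos
    rw [List.length_pos_iff]
    intro h
    rw [show cores (context G cores s).Q = [] from h] at this
    simp at this
  · exact (hP.lists.length_eq _).trans_le (hP.family hpos).ncard_cores_le

/-- The money spent plus `2 * c(J)` times the potential never increases. -/
theorem Problem.statePotential_improve (hP : Problem G f cores)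
    {s : List (Fin G.m) × List (Fin G.m)} (hs : Split s) {J : Finset (Fin G.m)}
    (hJ : G.Covers f J) :
    (((improve G cores s).2.map G.cost).sum : ℝ) +
        2 * G.totalCost J * statePotential G f cores (improve G cores s) ≤
      ((s.2.map G.cost).sum : ℝ) + 2 * G.totalCost J * statePotential G f cores s := by
  rcases (maxVal_residual_nonneg (f := f)
    ((context G cores s).Q : Multiset (DEdge G.n))).eq_or_lt with h0 | hpos
  · have h1 : (context G cores s).L.headD [] = [] := hP.lists.headD_eq_nil h0.symm
    rw [improve, if_pos h1]
  · obtain ⟨-, -, w, hw, h⟩ := hP.improve_spec hs hpos hJ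
    rw [hw, Rat.cast_add]
    set s' := improve G cores s
    have hJ0 : (0 : ℝ) ≤ G.totalCost J := by exact_mod_cast totalCost_nonneg J
    obtain ⟨hν, hνT⟩ := hP.card_bounds hpos
    have hl : ((((context G cores s).level f).toNat : ℕ) : ℝ) = (context G cores s).level f := by
      exact_mod_cast Int.toNat_of_nonneg hpos.le
    have hl0 : (0 : ℝ) < (context G cores s).level f := by exact_mod_cast hpos
    have hν0 : (0 : ℝ) < (context G cores s).L.length := by exact_mod_cast hν
    have key : ∀ d : ℝ, (w : ℝ) ≤ 2 * G.totalCost J * d →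
        d ≤ statePotential G f cores s - statePotential G f cores s' →
        (w : ℝ) + ((s.2.map G.cost).sum : ℝ) + 2 * G.totalCost J * statePotential G f cores s' ≤
          ((s.2.map G.cost).sum : ℝ) + 2 * G.totalCost J * statePotential G f cores s := by
      intro d h1 h2
      have := mul_le_mul_of_nonneg_left h2 (show (0 : ℝ) ≤ 2 * G.totalCost J by linarith)
      linarith
    rcases h with ⟨h1, h2, h3⟩ | ⟨h1, h3⟩
    · refine key _ ?_ (?_ : (((context G cores s).L.length : ℝ) - (context G cores s').L.length) /
        ((context G cores s).level f * (context G cores s).L.length) ≤ _)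
      · rw [mul_div_assoc', le_div_iff₀ (by positivity), ← mul_assoc]
        exact_mod_cast h3
      · have := le_potential_sub (T := G.T.card) (Int.lt_toNat.2 (by simpa using hpos) :
          0 < ((context G cores s).level f).toNat) h2
        rw [hl] at this
        simp only [statePotential]
        rw [h1]
        exact this
    · refine key (1 / ((context G cores s).level f : ℝ)) ?_ ?_
      · rw [mul_div_assoc', le_div_iff₀ hl0, mul_one]
        exact_mod_cast h3
      · rcases (maxVal_residual_nonneg (f := f)
          ((context G cores s').Q : Multiset (DEdge G.n))).eq_or_lt with h0 | hpos'
        · have h4 : statePotential G f cores s' = 0 := by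
            rw [statePotential, potential, if_pos (by rw [Ctx.level, ← h0]; rfl)]
          -- At level `0` the potential vanishes whatever the number of cores; the old number is
          -- inserted only to meet the hypotheses.
          have h5 := le_potential_sub_of_lt (T := G.T.card) (l := ((context G cores s).level f).toNat)
            (l' := 0) (Int.lt_toNat.2 (by simpa using hpos)) hν hν hνT
          rw [hl] at h5
          rw [h4]
          have h6 := potential_nonneg G.T.card 0 (context G cores s).L.length
          simp only [statePotential]
          linarith
        · obtain ⟨hν', hνT'⟩ := hP.card_bounds hpos'
          have h5 := le_potential_sub_of_lt (T := G.T.card) (l := ((context G cores s).level f).toNat)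
            (l' := ((context G cores s').level f).toNat)
            ((Int.toNat_lt_toNat hpos).2 h1) hν hν' hνT'
          rw [hl] at h5
          exact h5

theorem Problem.solution_spec (hP : Problem G f cores) {J : Finset (Fin G.m)}
    (hJ : G.Covers f J) :
    (solution G cores).Nodup ∧ G.Covers f (solution G cores).toFinset ∧
      (((solution G cores).map G.cost).sum : ℝ) ≤
        2 * harmonic (maxVal f).toNat * (1 + Real.log G.T.card) * G.totalCost J := by
  set s₀ : List (Fin G.m) × List (Fin G.m) := ((List.finRange G.m).reverse, []) with hs₀
  have key : ∀ r : List (Fin G.m), ∃ s, r.foldl (fun s _ => improve G cores s) s₀ = s ∧ Split s ∧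
      ((s.2.map G.cost).sum : ℝ) + 2 * G.totalCost J * statePotential G f cores s ≤
        2 * G.totalCost J * statePotential G f cores s₀ ∧
      ((context G cores s).level f = 0 ∨ s.1.length + r.length ≤ G.m) := by
    intro r
    induction r using List.reverseRecOn with
    | nil =>
      refine ⟨s₀, rfl, ⟨List.nodup_reverse.2 (List.nodup_finRange _), List.nodup_nil, ?_⟩, ?_,
        Or.inr ?_⟩
      · simp [hs₀]
      · simp [hs₀]
      · simp [hs₀]
    | append_singleton r x ih =>
      obtain ⟨s, hr, hs, hcost, hlev⟩ := ih
      rw [List.foldl_append, List.foldl_cons, List.foldl_nil, hr]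
      refine ⟨_, rfl, ?_⟩
      have h := (hP.statePotential_improve hs hJ).trans hcost
      rcases (maxVal_residual_nonneg (f := f)
        ((context G cores s).Q : Multiset (DEdge G.n))).eq_or_lt with h0 | hpos
      · have h1 : (context G cores s).L.headD [] = [] := hP.lists.headD_eq_nil h0.symm
        have h2 : improve G cores s = s := by rw [improve, if_pos h1]
        rw [h2] at h ⊢
        exact ⟨hs, h, Or.inl h0.symm⟩
      · obtain ⟨h1, h2, -⟩ := hP.improve_spec hs hpos hJ
        refine ⟨h1, h, Or.inr ?_⟩
        have := hlev.resolve_left hpos.ne'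
        simp only [List.length_append, List.length_cons, List.length_nil]
        omega
  obtain ⟨s, hr, hs, hcost, hlev⟩ := key (List.finRange G.m).reverse
  have hsol : solution G cores = s.2 := by rw [← hr]; rfl
  -- At a positive level all `G.m` rounds would have removed an edge, leaving none, yet another
  -- round would still remove one.
  have hzero : (context G cores s).level f = 0 := by
    by_contra hne
    have hpos := lt_of_le_of_ne (maxVal_residual_nonneg (f := f)
      ((context G cores s).Q : Multiset (DEdge G.n))) (Ne.symm hne)
    have h1 := hlev.resolve_left hne
    have h2 := (hP.improve_spec hs hpos hJ).2.1
    rw [List.length_reverse, List.length_finRange] at h1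
    omega
  rw [hsol]
  refine ⟨hs.nodup_snd, fun A => ?_, ?_⟩
  · have h1 := le_maxVal (residual f ((context G cores s).Q : Multiset (DEdge G.n))) A
    rw [show maxVal (residual f ((context G cores s).Q : Multiset (DEdge G.n))) = 0 from hzero]
      at h1
    have h2 := (le_max_left _ _).trans h1
    have h3 : s.2.toFinset.val.map G.edge = ((context G cores s).Q : Multiset (DEdge G.n)) := by
      rw [List.toFinset_val, hs.nodup_snd.dedup]
      simp [context]
    rw [h3]
    linarith
  · have hJ0 : (0 : ℝ) ≤ G.totalCost J := by exact_mod_cast totalCost_nonneg J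
    have h1 : (0 : ℝ) ≤ 2 * G.totalCost J * statePotential G f cores s :=
      mul_nonneg (by linarith) (potential_nonneg _ _ _)
    have h2 : ((context G cores s₀).level f).toNat = (maxVal f).toNat := by
      have h3 : (context G cores s₀).level f = max (maxVal f) 0 := by
        simp only [Ctx.level, context, hs₀, List.map_nil, List.reverse_nil]
        refine le_antisymm ?_ (max_le ?_ (maxVal_residual_nonneg _))
        · obtain ⟨A, hA⟩ := exists_eq_maxVal (residual f (([] : List (DEdge G.n)) : Multiset _))
          rw [← show residual f _ A = _ from hA]
          have := le_maxVal f A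
          simp only [residual]
          omega
        · obtain ⟨A, hA⟩ := exists_eq_maxVal f
          rw [← show f A = _ from hA]
          refine le_trans ?_ (le_maxVal _ A)
          simp [residual, inDeg]
      rw [h3]
      omega
    have h3 : statePotential G f cores s₀ ≤
        (1 + Real.log G.T.card) * harmonic (maxVal f).toNat := by
      rw [statePotential, h2]
      rcases (maxVal_residual_nonneg (f := f)
        ((context G cores s₀).Q : Multiset (DEdge G.n))).eq_or_lt with h0 | hpos
      · rw [← h2, Ctx.level, ← h0, potential, if_pos (by rfl)]
        simp
      · obtain ⟨h4, h5⟩ := hP.card_bounds hpos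
        exact potential_le h4 h5
    have h4 := mul_le_mul_of_nonneg_left h3 (show (0 : ℝ) ≤ 2 * G.totalCost J by linarith)
    push_cast at hcost h1 h4 ⊢
    linarith

end Solution

/-! ### Polynomial running time -/

/-- The function is given by a polynomial. -/
@[fun_prop]
def PolyFun (g : ℕ → ℕ) : Prop := ∃ P : Polynomial ℕ, ∀ N, P.eval N = g N

@[fun_prop]
theorem PolyFun.id' : PolyFun fun N => N := ⟨Polynomial.X, by simp⟩

@[fun_prop]
theorem PolyFun.const (k : ℕ) : PolyFun fun _ => k := ⟨Polynomial.C k, by simp⟩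

@[fun_prop]
theorem PolyFun.add {g h : ℕ → ℕ} (hg : PolyFun g) (hh : PolyFun h) :
    PolyFun fun N => g N + h N := by
  obtain ⟨P, hP⟩ := hg
  obtain ⟨Q, hQ⟩ := hh
  exact ⟨P + Q, fun N => by rw [Polynomial.eval_add, hP, hQ]⟩

@[fun_prop]
theorem PolyFun.mul {g h : ℕ → ℕ} (hg : PolyFun g) (hh : PolyFun h) :
    PolyFun fun N => g N * h N := by
  obtain ⟨P, hP⟩ := hg
  obtain ⟨Q, hQ⟩ := hh
  exact ⟨P * Q, fun N => by rw [Polynomial.eval_mul, hP, hQ]⟩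

@[fun_prop]
theorem PolyFun.comp {g h : ℕ → ℕ} (hg : PolyFun g) (hh : PolyFun h) :
    PolyFun fun N => g (h N) := by
  obtain ⟨P, hP⟩ := hg
  obtain ⟨Q, hQ⟩ := hh
  exact ⟨P.comp Q, fun N => by rw [Polynomial.eval_comp, hQ, hP]⟩

namespace Run

@[fun_prop]
theorem polyFun_tMem : PolyFun tMem := by unfold tMem; fun_prop

@[fun_prop]
theorem polyFun_tNotSub : PolyFun tNotSub := by unfold tNotSub; fun_prop

@[fun_prop]
theorem polyFun_tGood : PolyFun tGood := by unfold tGood; fun_prop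

@[fun_prop]
theorem polyFun_tIsol : PolyFun tIsol := by unfold tIsol; fun_prop

@[fun_prop]
theorem polyFun_tProbe : PolyFun tProbe := by unfold tProbe tAsk; fun_prop

@[fun_prop]
theorem polyFun_tFind : PolyFun tFind := by unfold tFind; fun_prop

@[fun_prop]
theorem polyFun_tRelax : PolyFun tRelax := by unfold tRelax; fun_prop

@[fun_prop]
theorem polyFun_tGrow : PolyFun tGrow := by unfold tGrow; fun_prop

@[fun_prop]
theorem polyFun_tLabels : PolyFun tLabels := by unfold tLabels; fun_prop

@[fun_prop]
theorem polyFun_tTable : PolyFun tTable := by unfold tTable; fun_prop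

@[fun_prop]
theorem polyFun_tFeet : PolyFun tFeet := by unfold tFeet; fun_prop

@[fun_prop]
theorem polyFun_tInner : PolyFun tInner := by unfold tInner; fun_prop

@[fun_prop]
theorem polyFun_tPrice : PolyFun tPrice := by unfold tPrice; fun_prop

@[fun_prop]
theorem polyFun_tSpider : PolyFun tSpider := by unfold tSpider; fun_prop

@[fun_prop]
theorem polyFun_tSpiders : PolyFun tSpiders := by unfold tSpiders; fun_prop

@[fun_prop]
theorem polyFun_tTimes : PolyFun tTimes := by unfold tTimes; fun_prop

@[fun_prop]
theorem polyFun_tLess : PolyFun tLess := by unfold tLess; fun_prop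

@[fun_prop]
theorem polyFun_tHas : PolyFun tHas := by unfold tHas; fun_prop

@[fun_prop]
theorem polyFun_tImprove : PolyFun tImprove := by unfold tImprove tAsk; fun_prop

@[fun_prop]
theorem polyFun_tIota : PolyFun tIota := by unfold tIota; fun_prop

@[fun_prop]
theorem polyFun_tMain : PolyFun tMain := by unfold tMain; fun_prop

end Run

/-! ### Core oracles -/

section Oracle

variable {G : Network} {f : Finset (Fin G.n) → ℤ} {orc : Val → Val}

theorem IsCoreOracle.exists_cores (h : IsCoreOracle f orc) :
    ∃ cores : List (DEdge G.n) → List (List (Fin G.n)), CoreLists f cores ∧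
      ∀ I, orc (encQuery I) = encCores (cores I) := by
  choose cores h1 h2 h3 h4 using h
  exact ⟨cores, ⟨h2, h3, h4⟩, h1⟩

/-- At a positive level cores are bounded in number by the terminals, and at level `0` the only core
is empty. No cover is needed, so the time bound also holds for infeasible instances. -/
theorem CoreLists.bounded {cores : List (DEdge G.n) → List (List (Fin G.n))}
    (h : CoreLists f cores) (hreply : ∀ I, orc (encQuery I) = encCores (cores I))
    (hsup : PosIntersectingSupermodular G.T f) (hT : ∀ A, 0 < f A → (A ∩ G.T).Nonempty) :
    Bounded orc G cores (G.size + 1) where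
  n_lt := by unfold Network.size; omega
  m_lt := by unfold Network.size; omega
  reply := hreply
  length_cores I := by
    have hn : G.n ≤ G.size := by unfold Network.size; omega
    rw [h.length_eq]
    rcases (maxVal_residual_nonneg (f := f) (I : Multiset (DEdge G.n))).eq_or_lt with h0 | hpos
    · refine le_trans ?_ (Nat.le_add_left 1 _)
      rw [Set.ncard_le_one]
      have hall : ∀ C, IsCore (maxFamily (residual f (I : Multiset (DEdge G.n)))) C → C = ∅ := by
        intro C hC
        refine (hC.eq_of_le (y := ∅) ?_ (Finset.empty_subset _)).symm
        change _ = _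
        rw [← h0]
        exact ((le_maxVal _ _).trans h0.ge).antisymm (le_max_right _ _)
      intro C hC D hD
      rw [hall C hC, hall D hD]
    · refine (intersectingFamily_residual hsup hT hpos).ncard_cores_le.trans ?_
      have := G.T.card_le_univ
      rw [Fintype.card_fin] at this
      omega
  length_core I C hC := by
    have hn : G.n ≤ G.size := by unfold Network.size; omega
    have := (h.nodup I C hC).length_le_card
    rw [Fintype.card_fin] at this
    omega

end Oracle

end EdgeCover

theorem theorem1 :
    ∃ (p : EdgeCover.Prog) (P : Polynomial ℕ),
      ∀ (G : EdgeCover.Network) (f : Finset (Fin G.n) → ℤ) (orc : EdgeCover.Val → EdgeCover.Val),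
        EdgeCover.PosIntersectingSupermodular G.T f →
        (∀ A : Finset (Fin G.n), 0 < f A → (A ∩ G.T).Nonempty) →
        G.QuasiBipartite f →
        EdgeCover.IsCoreOracle f orc →
        ∃ (t : ℕ) (s : EdgeCover.State),
          EdgeCover.Exec orc p (EdgeCover.initState G) t s ∧
          t ≤ P.eval G.size ∧
          ((∃ J : Finset (Fin G.m), G.Covers f J) →
            ∃ J : Finset (Fin G.m), EdgeCover.Outputs G s J ∧ G.Covers f J ∧
              ∀ J' : Finset (Fin G.m), G.Covers f J' →
                (G.totalCost J : ℝ) ≤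
                  2 * (harmonic (EdgeCover.maxVal f).toNat : ℝ) *
                    (1 + Real.log (G.T.card : ℝ)) * (G.totalCost J' : ℝ)) := by
  obtain ⟨P, hP⟩ := EdgeCover.PolyFun.comp EdgeCover.Run.polyFun_tMain
    ((EdgeCover.PolyFun.id').add (EdgeCover.PolyFun.const 1))
  refine ⟨EdgeCover.Fn.main 0, P, fun G f orc hsup hT hquasi horc => ?_⟩
  obtain ⟨cores, hcores, hreply⟩ := horc.exists_cores
  obtain ⟨t, s, ht, hexec, hs, -⟩ := EdgeCover.Run.main
    (hcores.bounded hreply hsup hT) 0 (EdgeCover.initState G) (if_pos rfl)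
  refine ⟨t, s, hexec, ht.trans_eq (hP _).symm, ?_⟩
  rintro ⟨J₀, hJ₀⟩
  -- The existence of a cover gives `f ≤ G.m`, which is what makes `G.m` copies of the isolating
  -- edges heavy enough.
  have hprob : EdgeCover.Problem G f cores := ⟨hsup, hT, hquasi, fun A => by
    refine (hJ₀ A).trans ?_
    have h1 := Multiset.countP_le_card (fun e : EdgeCover.DEdge G.n =>
      e.2 ∈ EdgeCover.lift A ∧ e.1 ∉ EdgeCover.lift A) (J₀.val.map G.edge)
    rw [Multiset.card_map] at h1
    have h2 := J₀.card_le_univ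
    rw [Fintype.card_fin] at h2
    exact_mod_cast h1.trans h2, hcores⟩
  -- The solution does not depend on the cover it is compared with: `J₀` gives feasibility, and the
  -- ratio follows for each `J'` separately.
  obtain ⟨hnd, hcov, -⟩ := hprob.solution_spec hJ₀
  refine ⟨(EdgeCover.solution G cores).toFinset, ⟨(EdgeCover.solution G cores).reverse,
    List.nodup_reverse.2 hnd, List.toFinset_reverse, by
      rw [hs]
      congr 1
      simp only [List.bind_eq_flatMap, List.pure_def, List.map_flatMap, List.map_cons, List.map_nil]
      exact List.map_eq_flatMap⟩, hcov, fun J' hJ' => ?_⟩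
  rw [EdgeCover.Network.totalCost, List.sum_toFinset _ hnd]
  exact (hprob.solution_spec hJ').2.2
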